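/- **Setting.** Let $f=f(w,v)\in C^3(\mathbb R^2)$ have bounded derivatives of all orders $\le 3$, and let $r>0$ be such that $\partial_w f>-1$ on $[-r,r]^2$. Put $\|D^2_{ww}f\|=\sup|\partial_w^2 f|$ and $\|D^3_{wwv}f\|=\sup|\partial_w^2\partial_v f|$. Fix $\varepsilon>0$; for $g:\mathbb R\to\mathbb R$ let $g_\varepsilon$ be its piecewise affine interpolation on the grid $\mathbb Z\varepsilon$. Let $(w,v)$ be an $\varepsilon$-wavefront solution of $w_t+\partial_wf(w,v)\,w_x=0$, $v_t-v_x=0$. This means the following. The initial data $w(0,\cdot),v(0,\cdot)$ are right continuous, piecewise constant, compactly supported, with values in $\mathbb Z\varepsilon\cap[-r,r]$; $v(t,x)=v(0,x+t)$; and $w$ is obtained by wavefront tracking: at $t=0$ and after each collision of wavefronts, the solution is continued by the Riemann solver which, for left and right states $(w^-,v^-)$, $(w^+,v^+)$, uses for $w$ the right continuous entropy solution of the scalar Riemann problem $(w^-,w^+)$ with flux $f_\varepsilon(\cdot,v^+)$. Jumps of $v$ are wavefronts of the first family, jumps of $w$ are wavefronts of the second family. The collision points are $(t_j,x_j)$,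 $1\le j\le J$, with $0=:t_0<t_1<\dots<t_J$, and at each $(t_j,x_j)$ exactly two wavefronts meet. A collision point is a *positive interaction* if both colliding wavefronts are upward jumps of $w$, and *transversal* if they belong to different families. **Waves.** Let $W(x)=\mathrm{Tot.Var.}(w(0,\cdot);(-\infty,x])$ and $\mathcal W=\{1,\dots,\varepsilon^{-1}\mathrm{Tot.Var.}(w(0,\cdot))\}$. The wave $s\in\mathcal W$ has strength $|s|=\varepsilon$, initial position $\mathtt x(0,s)=\inf\{x:\varepsilon s\le W(x)\}=:x_0$, sign $\mathcal S(s)=\mathrm{sign}(w(0,x_0)-w(0,x_0-))$ and right state $\hat w(s)=w(0,x_0-)+\mathcal S(s)(\varepsilon s-W(x_0-))$. Its segment is $(\hat w(s)-\varepsilon,\hat w(s)]$ if $\mathcal S(s)=1$ and $[\hat w(s),\hat w(s)+\varepsilon)$ if $\mathcal S(s)=-1$. For a homogeneous (i.e. all signs equal) interval of waves $\mathcal I$, let $I$ be the union of the segments of its waves, and let $|\mathcal I|=\varepsilon\,\mathrm{card}\,\mathcal I$. Put $$\sigma^{\rm rh}(g,\mathcal I)=\frac{g(\sup I)-g(\inf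 I)}{\sup I-\inf I},$$ and let $\sigma^{\rm ent}(g,\mathcal I,s)$ be the slope, on the segment of $s\in\mathcal I$, of the convex (if $\mathcal S=1$) or concave (if $\mathcal S=-1$) envelope of $g_\varepsilon$ on $[\inf I,\sup I]$. One says that $\mathcal I$ with flux $g$ *divides* $s,s'\in\mathcal I$ if $\sigma^{\rm ent}(g,\mathcal I,s)\ne\sigma^{\rm ent}(g,\mathcal I,s')$. At time $t_j$ the wave $s$ has speed $\sigma(t_j,s)=\sigma^{\rm ent}\big(f(\cdot,v(t_j,\mathtt x(t_j,s))),\{p:\mathtt x(t_j,p)=\mathtt x(t_j,s)\},s\big)$, and it moves with this speed up to $t_{j+1}$. If it then arrives at $x_{j+1}$, it is removed (its position becomes and stays $+\infty$) unless $\mathcal S(s)w(t_{j+1},x_{j+1}-)\le\mathcal S(s)\hat w(s)-\varepsilon$ and $\mathcal S(s)\hat w(s)\le\mathcal S(s)w(t_{j+1},x_{j+1})$. Put $\mathcal W(t)=\{s:\mathtt x(t,s)<\infty\}$ and $\mathcal W(t,x)=\{s:\mathtt x(t,s)=x\}$. A wavefront of the second family present in $(t_j,t_{j+1})$ is identified with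 the set of waves of $\mathcal W(t_j)$ having its position and speed at time $t_j$. **Effective flux.** An effective flux $\mathtt f^{\rm eff}_{t_j}$ on a maximal homogeneous interval of $\mathcal W(t_j)$ is any $C^{1,1}$ function with second derivative equal to $\partial_w^2f(\cdot,v(t_j,\mathtt x(t_j,s)))$ a.e. on the segment of each wave $s$ of that interval (it is determined up to affine functions). **Pairs of waves.** Let $s<s'$ be in $\mathcal W(t_j)$. They have *already interacted* at $t_j$ if $\mathtt x(t,s)=\mathtt x(t,s')$ for some $t\le t_j$; otherwise they have *never interacted*. They are *divided* at $t_j$ if $(\mathtt x,\sigma)(t_j,s)\ne(\mathtt x,\sigma)(t_j,s')$, and *joined* otherwise. If they have already interacted and are divided at $t_j$, let $T=\max\{t\le t_j:\mathtt x(t,s)=\mathtt x(t,s')\}$ and $\mathcal I(t_j,s,s')=\mathcal W(T,\mathtt x(T,s))\cap\mathcal W(t_j)$. The partition $\mathcal P(t_j,s,s')$ of $\mathcal I(t_j,s,s')$ is defined recursively as follows. * If $T=t_j$, then $p\sim p'$ iff $p,p'$ are joined at $t_j$. * If $T<t_j$, then $p\sim p'$ iff they belong to the same $\mathcal J\in\mathcal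 P(t_{j-1},s,s')$ and $\mathcal J\cap\mathcal W(t_j)$ with flux $\mathtt f^{\rm eff}_{t_j}$ does not divide them. The function $\pi$ is defined recursively as follows. * $\pi(t_j,s,s')[p,p']=0$ if $j=0$ or $s,s'$ are joined at $t_{j-1}$. * Otherwise $\pi(t_j,s,s')[p,p']=\pi(t_{j-1},s,s')[p,p']$ if $(t_j,x_j)$ is not transversal, and if it is transversal $$\pi(t_j,s,s')[p,p']=\pi(t_{j-1},s,s')[p,p']+2\|D^3_{wwv}f\|\,|v(t_j,x_j)-v(t_j,x_j-)|\sum_{\mathcal J}|\mathcal J|,$$ where the sum is over the $\mathcal J\in\mathcal P(t_{j-1},s,s')$ which are contained in $\mathcal W(t_j,x_j)$ and lie between the elements containing $p$ and $p'$ (these included). **Theorem.** Let $(t_j,x_j)$, $1\le j\le J$, be a positive interaction point, and let $\mathcal L<\mathcal R$ be the two wavefronts (as sets of waves) interacting there. Then, for every effective flux $\mathtt f^{\rm eff}_{t_{j-1}}$ on the maximal homogeneous interval of waves at time $t_{j-1}$ containing them, $$\big[\sigma^{\rm rh}(\mathtt f^{\rm eff}_{t_{j-1}},\mathcal L)-\sigma^{\rm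 rh}(\mathtt f^{\rm eff}_{t_{j-1}},\mathcal R)\big]|\mathcal L||\mathcal R|\le\sum_{\substack{(s,s')\in\mathcal L\times\mathcal R\\ \text{already interacted at }t_{j-1}}}\pi(t_{j-1},s,s')[s,s']\,|s||s'|+\sum_{\substack{(s,s')\in\mathcal L\times\mathcal R\\ \text{never interacted at }t_{j-1}}}\|D^2_{ww}f\|\big(|\mathcal L|+|\mathcal R|\big)|s||s'| .$$ -/

import Mathlib

open Set MeasureTheory

namespace TriangularSystem

noncomputable section

/-! ### Envelopes, interpolation, speeds -/

/-- Convex envelope of `g` on `[a, b]`: supremum of the convex functions on `[a, b]` below `g`. -/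
def convEnv (g : ℝ → ℝ) (a b u : ℝ) : ℝ :=
  sSup {y | ∃ h : ℝ → ℝ, ConvexOn ℝ (Icc a b) h ∧ (∀ z ∈ Icc a b, h z ≤ g z) ∧ y = h u}

/-- Concave envelope of `g` on `[a, b]`: infimum of the concave functions on `[a, b]` above `g`. -/
def concEnv (g : ℝ → ℝ) (a b u : ℝ) : ℝ :=
  sInf {y | ∃ h : ℝ → ℝ, ConcaveOn ℝ (Icc a b) h ∧ (∀ z ∈ Icc a b, g z ≤ h z) ∧ y = h u}

/-- Piecewise affine interpolation of `g` with grid size `ε` (it agrees with `g` on `ℤ ε`). -/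
def interp (ε : ℝ) (g : ℝ → ℝ) (u : ℝ) : ℝ :=
  g (⌊u / ε⌋ * ε) + (u - ⌊u / ε⌋ * ε) / ε * (g ((⌊u / ε⌋ + 1) * ε) - g (⌊u / ε⌋ * ε))

/-- Rankine-Hugoniot speed given to the interval `I` by the function `g`. -/
def rhSpeed (g : ℝ → ℝ) (I : Set ℝ) : ℝ :=
  (g (sSup I) - g (sInf I)) / (sSup I - sInf I)

/-! ### Derivatives of the flux and their sup norms -/

/-- `∂²f/∂w²`, where `f = f(w, v)`. -/
def fww (f : ℝ → ℝ → ℝ) (w v : ℝ) : ℝ := iteratedDeriv 2 (fun w' => f w' v) w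

/-- `∂³f/∂w²∂v`. -/
def fwwv (f : ℝ → ℝ → ℝ) (w v : ℝ) : ℝ := deriv (fun v' => fww f w v') v

/-- `‖D²_{ww} f‖_{L^∞}` (the function is continuous, so this is the supremum). -/
def normD2 (f : ℝ → ℝ → ℝ) : ℝ := ⨆ p : ℝ × ℝ, |fww f p.1 p.2|

/-- `‖D³_{wwv} f‖_{L^∞}`. -/
def normD3 (f : ℝ → ℝ → ℝ) : ℝ := ⨆ p : ℝ × ℝ, |fwwv f p.1 p.2|

/-- The standing assumptions on the flux: `f` is `C³` with bounded derivatives up to order `3`. -/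
def IsAdmissibleFlux (f : ℝ → ℝ → ℝ) : Prop :=
  ContDiff ℝ 3 (fun p : ℝ × ℝ => f p.1 p.2) ∧
    ∀ k : ℕ, k ≤ 3 → ∃ C : ℝ, ∀ p : ℝ × ℝ,
      ‖iteratedFDeriv ℝ k (fun p : ℝ × ℝ => f p.1 p.2) p‖ ≤ C

/-! ### The approximate Riemann solver -/

/-- The elementary jumps of size `ε` composing the jump from `wl` to `wr`, labelled by their right
state `k ε`. -/
def cells (ε wl wr : ℝ) : Set ℤ :=
  {k | (wl < k * ε ∧ k * ε ≤ wr) ∨ (wr ≤ k * ε ∧ k * ε < wl)}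

open Classical in
/-- The speed of the elementary jump with right state `k ε` in the scalar Riemann problem
`(wl, wr)` with flux `interp ε g`: the derivative of the convex (if `wl < wr`) or concave (if
`wr < wl`) envelope, which is constant on the grid cell of the elementary jump. -/
def cellSpeed (ε : ℝ) (g : ℝ → ℝ) (wl wr : ℝ) (k : ℤ) : ℝ :=
  if wl < wr then deriv (convEnv (interp ε g) wl wr) (k * ε - ε / 2)
  else deriv (concEnv (interp ε g) wr wl) (k * ε + ε / 2)

/-- The right continuous entropy solution at `(τ, x)`, `τ ≥ 0`, of the scalar Riemann problem
`(wl, wr)`, centered at the origin, with flux `interp ε g`: starting from the left state `wl`, all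
elementary jumps located in `(-∞, x]` have been crossed. -/
def riemannSol (ε : ℝ) (g : ℝ → ℝ) (wl wr τ x : ℝ) : ℝ :=
  wl + Real.sign (wr - wl) * ε *
    ((({k ∈ cells ε wl wr | cellSpeed ε g wl wr k * τ ≤ x} : Set ℤ).ncard : ℕ) : ℝ)

/-! ### Wavefront solutions -/

/-- Piecewise constant, right continuous, compactly supported functions with values in `ℤ ε`. -/
def IsGridDatum (ε : ℝ) (u : ℝ → ℝ) : Prop :=
  (∀ x, ∃ m : ℤ, u x = m * ε) ∧ HasCompactSupport u ∧
    (∀ x, ContinuousWithinAt u (Ici x) x) ∧ {x | ¬ ContinuousAt u x}.Finite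

/-- The two characteristic families: `first` for `v`, `second` for `w`. -/
inductive Family where
  | first
  | second

/-- A wavefront: its family, its starting position and its speed. -/
structure Front where
  family : Family
  start : ℝ
  speed : ℝ

/-- Position of the wavefront after a time `τ`. -/
def Front.pos (a : Front) (τ : ℝ) : ℝ := a.start + a.speed * τ

/-- The wavefronts generated by solving, at each point, the Riemann problem given by the profiles
`w`, `v`. The flux of the Riemann problem for `w` is frozen at the right state of `v`. -/
def frontsOf (f : ℝ → ℝ → ℝ) (ε : ℝ) (w v : ℝ → ℝ) : Set Front :=
  {a | match a.family with
    | .first => Function.leftLim v a.start ≠ v a.start ∧ a.speed = -1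
    | .second => ∃ k ∈ cells ε (Function.leftLim w a.start) (w a.start),
        a.speed = cellSpeed ε (fun u => f u (v a.start))
          (Function.leftLim w a.start) (w a.start) k}

/-- An `ε`-wavefront solution `(w, v)` of `w_t + (∂f/∂w)(w,v) w_x = 0`, `v_t - v_x = 0`, produced
by wavefront tracking, together with its collision points `(t j, xc j)`, `1 ≤ j ≤ J`
(and `t 0 = 0`). -/
structure WavefrontSolution (f : ℝ → ℝ → ℝ) (ε : ℝ) where
  w : ℝ → ℝ → ℝ
  v : ℝ → ℝ → ℝ
  J : ℕ
  t : ℕ → ℝ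
  xc : ℕ → ℝ
  w_init : IsGridDatum ε (w 0)
  v_init : IsGridDatum ε (v 0)
  t_zero : t 0 = 0
  t_lt : ∀ j < J, t j < t (j + 1)
  /-- The jumps of `v` travel with speed `-1`. -/
  v_eq : ∀ τ, 0 ≤ τ → ∀ x, v τ x = v 0 (x + τ)
  /-- From each collision time to the next one, `w` is the juxtaposition of the solutions of the
  Riemann problems at the points `y` of the line at time `t j`: it is the sum of the increments of
  these solutions with respect to their left states. -/
  w_eq : ∀ j ≤ J, ∀ τ, t j ≤ τ → (j < J → τ ≤ t (j + 1)) → ∀ x,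
    w τ x = ∑ᶠ y : ℝ,
      (riemannSol ε (fun u => f u (v (t j) y)) (Function.leftLim (w (t j)) y) (w (t j) y)
        (τ - t j) (x - y) - Function.leftLim (w (t j)) y)
  /-- No two wavefronts meet strictly between two consecutive collision times, or after the last
  one. -/
  no_collision : ∀ j ≤ J, ∀ τ, t j < τ → (j < J → τ < t (j + 1)) →
    ∀ a ∈ frontsOf f ε (w (t j)) (v (t j)), ∀ b ∈ frontsOf f ε (w (t j)) (v (t j)),
      a.pos (τ - t j) = b.pos (τ - t j) → a = b
  /-- At each collision time exactly two wavefronts meet, and they do so at `xc (j + 1)`. -/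
  collision : ∀ j < J, ∃ a ∈ frontsOf f ε (w (t j)) (v (t j)),
    ∃ b ∈ frontsOf f ε (w (t j)) (v (t j)), a ≠ b ∧
      a.pos (t (j + 1) - t j) = xc (j + 1) ∧ b.pos (t (j + 1) - t j) = xc (j + 1) ∧
      ∀ c ∈ frontsOf f ε (w (t j)) (v (t j)), ∀ d ∈ frontsOf f ε (w (t j)) (v (t j)), c ≠ d →
        c.pos (t (j + 1) - t j) = d.pos (t (j + 1) - t j) → (c = a ∨ c = b) ∧ (d = a ∨ d = b)

namespace WavefrontSolution

variable {f : ℝ → ℝ → ℝ} {ε : ℝ} (S : WavefrontSolution f ε)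

/-- The wavefronts present in the time interval from `t j` to `t (j + 1)`. -/
def fronts (j : ℕ) : Set Front := frontsOf f ε (S.w (S.t j)) (S.v (S.t j))

/-- `a` and `b` are the two wavefronts colliding at `(t (j + 1), xc (j + 1))`. -/
def Collide (j : ℕ) (a b : Front) : Prop :=
  a ∈ S.fronts j ∧ b ∈ S.fronts j ∧ a ≠ b ∧
    a.pos (S.t (j + 1) - S.t j) = S.xc (j + 1) ∧ b.pos (S.t (j + 1) - S.t j) = S.xc (j + 1)

/-- A positive wavefront of the second family among those present from `t j` to `t (j + 1)`. -/
def IsPositiveFront (j : ℕ) (a : Front) : Prop :=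
  a.family = Family.second ∧ Function.leftLim (S.w (S.t j)) a.start < S.w (S.t j) a.start

/-- `(t (j + 1), xc (j + 1))` is a positive interaction point, with colliding wavefronts
`a`, `b`. -/
def PositiveInteraction (j : ℕ) (a b : Front) : Prop :=
  S.Collide j a b ∧ S.IsPositiveFront j a ∧ S.IsPositiveFront j b

/-- `(t (j + 1), xc (j + 1))` is a transversal interaction point. -/
def Transversal (j : ℕ) : Prop :=
  ∃ a b, S.Collide j a b ∧ a.family = Family.first ∧ b.family = Family.second

/-- Strength `|v_h|` of the wavefront of the first family passing through `(t j, xc j)`. -/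
def vStrength (j : ℕ) : ℝ :=
  |S.v (S.t j) (S.xc j) - Function.leftLim (S.v (S.t j)) (S.xc j)|

/-! ### Enumeration of waves of the initial datum -/

/-- Total variation of the initial datum on `(-∞, x]`. -/
def variation0 (x : ℝ) : ℝ := (eVariationOn (S.w 0) (Iic x)).toReal

/-- The set of waves `{1, ..., Tot.Var.(w(0, ·)) / ε}`. -/
def waves : Finset ℕ := Finset.Icc 1 ⌊(eVariationOn (S.w 0) univ).toReal / ε⌋₊

/-- Initial position of a wave. -/
def x0 (s : ℕ) : ℝ := sInf {x | ε * s ≤ S.variation0 x}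

/-- Sign of a wave. -/
def sgn (s : ℕ) : ℝ := Real.sign (S.w 0 (S.x0 s) - Function.leftLim (S.w 0) (S.x0 s))

/-- The right state `ŵ(s)` of a wave. -/
def what (s : ℕ) : ℝ :=
  Function.leftLim (S.w 0) (S.x0 s) +
    S.sgn s * (ε * s - Function.leftLim S.variation0 (S.x0 s))

open Classical in
/-- The segment of a wave: `(ŵ(s) - ε, ŵ(s)]` if it is positive, `[ŵ(s), ŵ(s) + ε)` if it is
negative. -/
def seg (s : ℕ) : Set ℝ :=
  if 0 < S.sgn s then Ioc (S.what s - ε) (S.what s) else Ico (S.what s) (S.what s + ε)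

/-- The union of the segments of the waves in `I`. -/
def span (I : Set ℕ) : Set ℝ := ⋃ s ∈ I, S.seg s

/-- Strength of a set of waves. -/
def strength (_S : WavefrontSolution f ε) (I : Set ℕ) : ℝ := ε * (I.ncard : ℝ)

open Classical in
/-- Entropic speed given to the wave `s` by the Riemann problem `I` with flux `g`; the derivative
of the envelope is constant on the grid cell of `s` and is evaluated at its midpoint. -/
def entSpeed (g : ℝ → ℝ) (I : Set ℕ) (s : ℕ) : ℝ :=
  if 0 < S.sgn s then
    deriv (convEnv (interp ε g) (sInf (S.span I)) (sSup (S.span I))) (S.what s - ε / 2)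
  else
    deriv (concEnv (interp ε g) (sInf (S.span I)) (sSup (S.span I))) (S.what s + ε / 2)

/-! ### Position and speed of the waves -/

/-- Speed at time `t j` of a wave `s` (not removed), if the positions of the waves at time `t j`
are given by `P`. -/
def speedOf (j : ℕ) (P : ℕ → WithTop ℝ) (s : ℕ) : ℝ :=
  S.entSpeed (fun u => f u (S.v (S.t j) ((P s).untopD 0))) {p | p ∈ S.waves ∧ P p = P s} s

/-- The wave `s`, if it arrives at the collision point `(t j, xc j)`, survives it. -/
def Survives (j : ℕ) (s : ℕ) : Prop :=
  S.sgn s * Function.leftLim (S.w (S.t j)) (S.xc j) ≤ S.sgn s * S.what s - ε ∧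
    S.sgn s * S.what s ≤ S.sgn s * S.w (S.t j) (S.xc j)

open Classical in
/-- Position `x(t j, s)` of the wave `s` at the collision time `t j`; it is `⊤` if the wave has been
removed. -/
def pos : ℕ → ℕ → WithTop ℝ
  | 0, s => (S.x0 s : WithTop ℝ)
  | j + 1, s =>
    if pos j s = ⊤ then ⊤
    else
      let z : ℝ := (pos j s).untopD 0 + S.speedOf j (pos j) s * (S.t (j + 1) - S.t j)
      if z = S.xc (j + 1) ∧ ¬ S.Survives (j + 1) s then ⊤ else (z : WithTop ℝ)

/-- Speed `σ(t j, s)` of the wave `s` at the time `t j` (meaningful if it has not been removed). -/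
def speed (j : ℕ) (s : ℕ) : ℝ := S.speedOf j (S.pos j) s

open Classical in
/-- The last `j ≤ J` with `t j ≤ τ`. -/
def stage (τ : ℝ) : ℕ := Nat.findGreatest (fun j => S.t j ≤ τ) S.J

open Classical in
/-- Position `x(τ, s)` of the wave `s` at time `τ ≥ 0`. -/
def position (τ : ℝ) (s : ℕ) : WithTop ℝ :=
  if S.pos (S.stage τ) s = ⊤ then ⊤
  else (((S.pos (S.stage τ) s).untopD 0 +
    S.speed (S.stage τ) s * (τ - S.t (S.stage τ)) : ℝ) : WithTop ℝ)

/-- `s ∈ 𝒲(t j)`: the wave is real (not removed) at time `t j`. -/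
def Alive (j : ℕ) (s : ℕ) : Prop := s ∈ S.waves ∧ S.position (S.t j) s ≠ ⊤

/-- The waves forming, as a set, the wavefront `a` of the second family present from `t j` to
`t (j + 1)`. -/
def wavesOf (j : ℕ) (a : Front) : Set ℕ :=
  {s | S.Alive j s ∧ S.position (S.t j) s = (a.start : WithTop ℝ) ∧ S.speed j s = a.speed}

/-! ### Effective flux function -/

/-- The maximal homogeneous interval of waves at time `t j` containing `s`. -/
def homComponent (j : ℕ) (s : ℕ) : Set ℕ :=
  {p | S.Alive j p ∧ ∀ q, S.Alive j q → min s p ≤ q → q ≤ max s p → S.sgn q = S.sgn s}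

/-- `F` is an effective flux function at time `t j` on the set of waves `M`: a `C^{1,1}` function
whose second derivative is a.e. `∂²f/∂w²(·, v(t j, x(t j, s)))` on the segment of each `s ∈ M`. -/
def IsEffectiveFlux (j : ℕ) (M : Set ℕ) (F : ℝ → ℝ) : Prop :=
  ContDiff ℝ 1 F ∧ (∃ K, LipschitzWith K (deriv F)) ∧
    ∀ s ∈ M, ∀ᵐ u ∂(volume : Measure ℝ), u ∈ S.seg s →
      HasDerivAt (deriv F) (fww f u (S.v (S.t j) ((S.position (S.t j) s).untopD 0))) u

/-- The Riemann problem `I` (a homogeneous interval of waves at time `t j` containing `p`, `p'`)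
with the effective flux at time `t j` does not divide `p`, `p'`. Effective fluxes differ by affine
functions, so one of them does not divide `p`, `p'` if and only if none does. -/
def NotDividedEff (j : ℕ) (I : Set ℕ) (p p' : ℕ) : Prop :=
  ∃ F, S.IsEffectiveFlux j (S.homComponent j p) F ∧ S.entSpeed F I p = S.entSpeed F I p'

/-! ### Pairs of waves -/

/-- `s`, `s'` have already interacted at time `t j`. -/
def AlreadyInteracted (j : ℕ) (s s' : ℕ) : Prop :=
  S.Alive j s ∧ S.Alive j s' ∧
    ∃ τ, 0 ≤ τ ∧ τ ≤ S.t j ∧ S.position τ s = S.position τ s'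

/-- `s`, `s'` have never interacted at time `t j`. -/
def NeverInteracted (j : ℕ) (s s' : ℕ) : Prop :=
  S.Alive j s ∧ S.Alive j s' ∧
    ∀ τ, 0 ≤ τ → τ ≤ S.t j → S.position τ s ≠ S.position τ s'

/-- `s`, `s'` have different position or different speed at time `t j`. -/
def Divided (j : ℕ) (s s' : ℕ) : Prop :=
  ¬ (S.position (S.t j) s = S.position (S.t j) s' ∧ S.speed j s = S.speed j s')

/-- Time of last interaction `T(t j, s, s')`. -/
def lastTime (j : ℕ) (s s' : ℕ) : ℝ :=
  sSup {τ | 0 ≤ τ ∧ τ ≤ S.t j ∧ S.position τ s = S.position τ s'}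

/-- The interval of waves `ℐ(t j, s, s')`: the waves real at time `t j` that are at the point of
last interaction of `s`, `s'` at the time of last interaction. -/
def interval (j : ℕ) (s s' : ℕ) : Set ℕ :=
  {p | S.Alive j p ∧ S.position (S.lastTime j s s') p = S.position (S.lastTime j s s') s}

/-- The equivalence relation on `ℐ(t j, s, s')` defining the partition `𝒫(t j, s, s')`. -/
def partRel : ℕ → ℕ → ℕ → ℕ → ℕ → Prop
  | 0, s, s', p, p' => p ∈ S.interval 0 s s' ∧ p' ∈ S.interval 0 s s' ∧ ¬ S.Divided 0 p p'
  | j + 1, s, s', p, p' =>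
    (S.lastTime (j + 1) s s' = S.t (j + 1) ∧
      p ∈ S.interval (j + 1) s s' ∧ p' ∈ S.interval (j + 1) s s' ∧ ¬ S.Divided (j + 1) p p') ∨
    (S.lastTime (j + 1) s s' ≠ S.t (j + 1) ∧
      S.Alive (j + 1) p ∧ S.Alive (j + 1) p' ∧ partRel j s s' p p' ∧
      S.NotDividedEff (j + 1) {q | partRel j s s' p q ∧ S.Alive (j + 1) q} p p')

/-- The element of the partition `𝒫(t j, s, s')` containing `p`. -/
def partClass (j : ℕ) (s s' p : ℕ) : Set ℕ := {q | S.partRel j s s' p q}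

/-- The partition `𝒫(t j, s, s')` of `ℐ(t j, s, s')`. -/
def partition (j : ℕ) (s s' : ℕ) : Set (Set ℕ) :=
  {C | ∃ p ∈ S.interval j s s', C = S.partClass j s s' p}

end WavefrontSolution

/-- The order on intervals of waves: every wave of `A` precedes every wave of `B`. -/
def Precedes (A B : Set ℕ) : Prop := ∀ s ∈ A, ∀ s' ∈ B, s < s'

namespace WavefrontSolution

variable {f : ℝ → ℝ → ℝ} {ε : ℝ} (S : WavefrontSolution f ε)

/-- `M(t (j + 1), s, s')[p, p']`: total strength of the elements of `𝒫(t j, s, s')` which lie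
between those of `p` and `p'` (included) and are contained in `𝒲(t (j + 1), xc (j + 1))`. -/
def lengthM (j : ℕ) (s s' p p' : ℕ) : ℝ :=
  ∑ᶠ C ∈ {C | C ∈ S.partition j s s' ∧
      (Precedes (S.partClass j s s' p) C ∨ S.partClass j s s' p = C) ∧
      (Precedes C (S.partClass j s s' p') ∨ C = S.partClass j s s' p') ∧
      C ⊆ {q | q ∈ S.waves ∧
        S.position (S.t (j + 1)) q = (S.xc (j + 1) : WithTop ℝ)}},
    S.strength C

open Classical in
/-- The quantity `π(t j, s, s')[p, p']`, for waves `s < s'` which at time `t j` have already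
interacted and are divided. -/
def piWeight : ℕ → ℕ → ℕ → ℕ → ℕ → ℝ
  | 0, _, _, _, _ => 0
  | j + 1, s, s', p, p' =>
    if S.AlreadyInteracted j s s' ∧ S.Divided j s s' then
      if S.Transversal j then
        piWeight j s s' p p' +
          2 * normD3 f * S.vStrength (j + 1) * S.lengthM j s s' p p'
      else piWeight j s s' p p'
    else 0

end WavefrontSolution

end

end TriangularSystem

/-! Let `φ s` be the slope of the effective flux across the segment of the wave `s`. By telescoping,
the mean of `φ` over an interval of positive waves is its Rankine-Hugoniot speed. Hence the
left-hand side is `ε²` times the sum of `φ s - φ s'` over all pairs `(s, s')` in `L × R`, and the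
two kinds of pairs are treated separately.

For pairs that have never interacted, `φ s - φ s'` is at most the oscillation of the derivative of
the effective flux over `L ∪ R`, that is, at most the bound on its second derivative times `|L| +
|R|`.

For pairs that have already interacted the bound is proved in the mean and not pointwise. Let `C`
and `C'` be the elements of the partition of `(s, s')` that contain `s` and `s'`. Waves of one
element have shared their position ever since the last meeting, so all pairs of `C × C'` have the
same last meeting and the same partition (`LastMeet.of_partRel`, `LastMeet.partRel_congr`). The
rectangles `C × C'` therefore decompose the set of these pairs, and over one rectangle the mean of
`φ p - φ p'` is the difference of the Rankine-Hugoniot speeds of `C` and `C'`.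

The core is `LastMeet.rhSpeed_sub_le`: this difference is at most the weight. The proof is by
induction on collision times. At the last meeting both elements come from one Riemann problem, whose
speeds increase from left to right, so the difference is nonpositive. Between consecutive collision
times three things happen. Cancellation: since `s` and `s'` survive, so do all waves between them,
hence `C` can only be cut on its left and `C'` only on its right. By the min-max formula for slopes
of convex envelopes (`IsGCM.saddle_left`, `envSlope_le_add`) this lowers the speeds in `C` and
raises those in `C'`. Splitting: a new element has as Rankine-Hugoniot speed the entropic speed of
its waves in the old one. Change of flux: the difference of speeds grows at most by the oscillation,
over the hull of `C` and `C'`, of the change of the derivative of the effective flux. Positive waves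
are faster than `-1`, so `v` changes along them only at transversal interactions (`v_along_wave`).
The oscillation is then bounded by the increment of the weight.

All this relies on the invariant `WaveProfile`: at each collision time the surviving waves, in their
order, compose the profile `w`. Its preservation amounts to the fact that the waves removed at a
collision cancel each other. Envelopes of piecewise affine functions are handled through greatest
convex minorants of integer sequences. -/

open Set MeasureTheory
namespace TriangularSystem
noncomputable section

/-! ### Discrete greatest convex minorants -/

/-- `E` is the greatest convex minorant of the sequence `G` on the integers of `[m, n]`. -/
structure IsGCM (G E : ℤ → ℝ) (m n : ℤ) : Prop where
  conv : ∀ k, m < k → k < n → E k - E (k - 1) ≤ E (k + 1) - E k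
  le : ∀ k, m ≤ k → k ≤ n → E k ≤ G k
  left : E m = G m
  right : E n = G n
  contact : ∀ k, m < k → k < n → E k = G k ∨ E k - E (k - 1) = E (k + 1) - E k
  max : ∀ α β : ℝ, (∀ k : ℤ, m ≤ k → k ≤ n → α + β * k ≤ G k) →
    ∀ k : ℤ, m ≤ k → k ≤ n → α + β * k ≤ E k

/-- Gift wrapping from the left end: among the chords starting at `m` take one of least slope `σ`,
follow it to its end `l`, and continue with the minorant on `[l, n]` given by induction on the
length. -/
theorem exists_isGCM (G : ℤ → ℝ) (m n : ℤ) (hmn : m ≤ n) : ∃ E, IsGCM G E m n := by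
  obtain ⟨d, hd⟩ : ∃ d : ℕ, (n - m).toNat = d := ⟨_, rfl⟩
  induction d using Nat.strong_induction_on generalizing m with
  | _ d ih =>
  rcases hmn.eq_or_lt with rfl | hlt
  · exact ⟨G, ⟨fun k h1 h2 => by omega, fun k _ _ => le_rfl, rfl, rfl,
      fun k h1 h2 => by omega, fun α β h => h⟩⟩
  obtain ⟨l, hl, hmin⟩ := Finset.exists_min_image (Finset.Ioc m n)
    (fun l => (G l - G m) / ((l : ℝ) - m)) ⟨n, by simpa using hlt⟩
  rw [Finset.mem_Ioc] at hl
  set σ := (G l - G m) / ((l : ℝ) - m) with hσ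
  have hlm : (0 : ℝ) < l - m := by
    have : (m : ℝ) < l := by exact_mod_cast hl.1
    linarith
  have hGl : G l - G m = σ * (l - m) := by rw [hσ]; field_simp
  have hG : ∀ k, m ≤ k → k ≤ n → G m + σ * (k - m) ≤ G k := by
    intro k h1 h2
    rcases h1.eq_or_lt with rfl | h1
    · simp
    · have h3 := hmin k (Finset.mem_Ioc.2 ⟨h1, h2⟩)
      have : (0 : ℝ) < k - m := by
        have : (m : ℝ) < k := by exact_mod_cast h1
        linarith
      rw [le_div_iff₀ this] at h3
      linarith
  obtain ⟨E', hE'⟩ := ih (n - l).toNat (by omega) l hl.2 rfl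
  -- The line of slope `σ` through `(l, G l)` lies below `G`, hence below `E'` by maximality. So the
  -- first slope of `E'` after `l` is at least `σ`, which is convexity at the junction.
  have hE'σ : ∀ k, l ≤ k → k ≤ n → G l + σ * (k - l) ≤ E' k := by
    intro k h1 h2
    have := hE'.max (G l - σ * l) σ (fun i hi1 hi2 => by
      have := hG i (by omega) hi2; linarith) k h1 h2
    linarith
  have key : ∀ k, l ≤ k → (if k ≤ l then G m + σ * (k - m) else E' k) = E' k := by
    intro k hk
    split_ifs with h
    · have : k = l := le_antisymm h hk
      subst this
      rw [hE'.left]; linarith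
    · rfl
  refine ⟨fun k => if k ≤ l then G m + σ * (k - m) else E' k, ?_, ?_, ?_, ?_, ?_, ?_⟩
  · intro k h1 h2
    rcases lt_trichotomy k l with h | h | h
    · simp only [h.le, show k - 1 ≤ l by omega, show k + 1 ≤ l by omega, if_true]
      push_cast; linarith
    · have h3 := hE'σ (k + 1) (by omega) (by omega)
      subst h
      simp only [show k - 1 ≤ k by omega, show ¬ (k + 1 ≤ k) by omega, le_refl, if_true, if_false]
      push_cast at h3 ⊢
      linarith
    · simp only [key k (by omega), key (k - 1) (by omega), key (k + 1) (by omega)]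
      exact hE'.conv k h h2
  · intro k h1 h2
    split_ifs with h
    · exact hG k h1 h2
    · exact hE'.le k (by omega) h2
  · simp [hl.1.le]
  · exact (key n hl.2).trans hE'.right
  · intro k h1 h2
    rcases lt_trichotomy k l with h | h | h
    · right
      simp only [h.le, show k - 1 ≤ l by omega, show k + 1 ≤ l by omega, if_true]
      push_cast; linarith
    · left
      simp only [key k (by omega)]
      rw [h, hE'.left]
    · simp only [key k (by omega), key (k - 1) (by omega), key (k + 1) (by omega)]
      exact hE'.contact k h h2
  · intro α β h k h1 h2
    split_ifs with hk
    · have ha := h m le_rfl hmn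
      have hb := h l hl.1.le hl.2
      have h3 : (0 : ℝ) ≤ k - m := by
        have : (m : ℝ) ≤ k := by exact_mod_cast h1
        linarith
      have h4 : (0 : ℝ) ≤ l - k := by
        have : (k : ℝ) ≤ l := by exact_mod_cast hk
        linarith
      have h5 : (α + β * k - (G m + σ * (k - m))) * (l - m) ≤ 0 := by
        have e : (α + β * k - (G m + σ * (k - m))) * (l - m) =
            (α + β * m - G m) * (l - k) + (α + β * l - (G m + σ * (l - m))) * (k - m) := by ring
        rw [e]
        nlinarith
      nlinarith
    · exact hE'.max α β (fun i hi1 hi2 => h i (by omega) hi2) k (by omega) h2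

theorem le_sub_of_forall_slope_ge {E : ℤ → ℝ} {a b : ℤ} {c : ℝ} (hab : a ≤ b)
    (h : ∀ i, a < i → i ≤ b → c ≤ E i - E (i - 1)) : c * (b - a) ≤ E b - E a := by
  induction b, hab using Int.leInduction with
  | base => simp
  | succ b hab ih =>
    have h1 := ih fun i h1 h2 => h i h1 (by omega)
    have h2 := h (b + 1) (by omega) le_rfl
    rw [add_sub_cancel_right] at h2
    push_cast
    linarith

theorem sub_le_of_forall_slope_le {E : ℤ → ℝ} {a b : ℤ} {c : ℝ} (hab : a ≤ b)
    (h : ∀ i, a < i → i ≤ b → E i - E (i - 1) ≤ c) : E b - E a ≤ c * (b - a) := by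
  have := le_sub_of_forall_slope_ge (E := fun i => - E i) (c := -c) hab
    fun i h1 h2 => by linarith [h i h1 h2]
  linarith

theorem sub_eq_of_forall_slope_eq {E : ℤ → ℝ} {a b : ℤ} {c : ℝ} (hab : a ≤ b)
    (h : ∀ i, a < i → i ≤ b → E i - E (i - 1) = c) : E b - E a = c * (b - a) :=
  le_antisymm (sub_le_of_forall_slope_le hab fun i h1 h2 => (h i h1 h2).le)
    (le_sub_of_forall_slope_ge hab fun i h1 h2 => (h i h1 h2).ge)

namespace IsGCM

variable {G E : ℤ → ℝ} {m n : ℤ}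

theorem slope_mono (h : IsGCM G E m n) {i k : ℤ} (hi : m < i) (hik : i ≤ k) (hk : k ≤ n) :
    E i - E (i - 1) ≤ E k - E (k - 1) := by
  induction k, hik using Int.leInduction with
  | base => exact le_rfl
  | succ k hik ih =>
    have h1 := ih (by omega)
    have h2 := h.conv k (by omega) (by omega)
    rw [add_sub_cancel_right]
    linarith

/-- Slopes are nondecreasing, so the cells with the slope of the cell `k` are consecutive; where
this run ends the slope changes, and `contact` forces `E = G` there. The cell `i` is `[i - 1, i]`,
so the left end of the run is one less than its least index. -/
theorem class_bounds (h : IsGCM G E m n) {k : ℤ} (hmk : m < k) (hkn : k ≤ n) :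
    ∃ a b, m ≤ a ∧ a < k ∧ k ≤ b ∧ b ≤ n ∧ E a = G a ∧ E b = G b ∧
      (∀ i, m < i → i ≤ n → (E i - E (i - 1) = E k - E (k - 1) ↔ a < i ∧ i ≤ b)) := by
  obtain ⟨b, ⟨hb1, hb2, hb3⟩, hb⟩ := Int.exists_greatest_of_bdd
    (P := fun i => k ≤ i ∧ i ≤ n ∧ E i - E (i - 1) = E k - E (k - 1))
    ⟨n, fun z hz => hz.2.1⟩ ⟨k, le_rfl, hkn, rfl⟩
  obtain ⟨a, ⟨ha1, ha2, ha3⟩, ha⟩ := Int.exists_least_of_bdd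
    (P := fun i => m < i ∧ i ≤ k ∧ E i - E (i - 1) = E k - E (k - 1))
    ⟨m, fun z hz => hz.1.le⟩ ⟨k, hmk, le_rfl, rfl⟩
  refine ⟨a - 1, b, by omega, by omega, hb1, hb2, ?_, ?_, ?_⟩
  · rcases (show m ≤ a - 1 by omega).eq_or_lt with h1 | h1
    · rw [← h1]; exact h.left
    · rcases h.contact (a - 1) h1 (by omega) with h2 | h2
      · exact h2
      · have := ha (a - 1) ⟨h1, by omega, by rw [h2]; rw [sub_add_cancel]; exact ha3⟩
        omega
  · rcases hb2.eq_or_lt with h1 | h1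
    · rw [h1]; exact h.right
    · rcases h.contact b (by omega) h1 with h2 | h2
      · exact h2
      · have := hb (b + 1) ⟨by omega, by omega, by rw [add_sub_cancel_right, ← h2]; exact hb3⟩
        omega
  · intro i hi1 hi2
    constructor
    · intro hi
      constructor
      · by_contra hc
        have := ha i ⟨hi1, by omega, hi⟩
        omega
      · by_contra hc
        have := hb i ⟨by omega, hi2, hi⟩
        omega
    · rintro ⟨h1, h2⟩
      have e1 := h.slope_mono ha1 (show a ≤ i by omega) hi2
      have e2 := h.slope_mono hi1 h2 hb2
      linarith

/-- Take for `a` the left end of the class of `k`: `E` touches `G` there, and all later slopes are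
at least that of `k`. With `saddle_right` this is a min-max formula: the slope at `k` is the maximum
over `a < k` of the minimum over `l ≥ k` of the chord slopes of `G`. It compares slopes of minorants
on different intervals without comparing the minorants. -/
theorem saddle_left (h : IsGCM G E m n) {k : ℤ} (hmk : m < k) (hkn : k ≤ n) :
    ∃ a, m ≤ a ∧ a < k ∧ ∀ l, k ≤ l → l ≤ n → (E k - E (k - 1)) * (l - a) ≤ G l - G a := by
  obtain ⟨a, b, h1, h2, h3, h4, h5, h6, h7⟩ := h.class_bounds hmk hkn
  refine ⟨a, h1, h2, fun l hl1 hl2 => ?_⟩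
  have := le_sub_of_forall_slope_ge (E := E) (a := a) (b := l) (c := E k - E (k - 1)) (by omega)
    (fun i hi1 hi2 => by
      rcases le_total i b with hib | hib
      · exact ((h7 i (by omega) (by omega)).2 ⟨hi1, hib⟩).ge
      · exact h.slope_mono hmk (by omega) (by omega))
  have := h.le l (by omega) hl2
  linarith

theorem saddle_right (h : IsGCM G E m n) {k : ℤ} (hmk : m < k) (hkn : k ≤ n) :
    ∃ b, k ≤ b ∧ b ≤ n ∧ ∀ a, m ≤ a → a < k → G b - G a ≤ (E k - E (k - 1)) * (b - a) := by
  obtain ⟨a, b, h1, h2, h3, h4, h5, h6, h7⟩ := h.class_bounds hmk hkn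
  refine ⟨b, h3, h4, fun l hl1 hl2 => ?_⟩
  have := sub_le_of_forall_slope_le (E := E) (a := l) (b := b) (c := E k - E (k - 1)) (by omega)
    (fun i hi1 hi2 => by
      rcases le_total k i with hib | hib
      · exact ((h7 i (by omega) (by omega)).2 ⟨by omega, hi2⟩).le
      · exact h.slope_mono (by omega) hib hkn)
  have := h.le l (by omega) (by omega)
  linarith

theorem restrict (h : IsGCM G E m n) {a b : ℤ} (hma : m ≤ a) (hab : a ≤ b) (hbn : b ≤ n)
    (ha : E a = G a) (hb : E b = G b) : IsGCM G E a b where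
  conv k h1 h2 := h.conv k (by omega) (by omega)
  le k h1 h2 := h.le k (by omega) (by omega)
  left := ha
  right := hb
  contact k h1 h2 := h.contact k (by omega) (by omega)
  max α β hαβ k h1 h2 := by
    rcases h1.eq_or_lt with rfl | h1
    · rw [ha]; exact hαβ _ le_rfl hab
    obtain ⟨a', b', e1, e2, e3, e4, e5, e6, e7⟩ := h.class_bounds (show m < k by omega)
      (show k ≤ n by omega)
    set c := E k - E (k - 1) with hc
    -- The affine piece of `E` through the cell `k` is clipped to `[a, b]`: `p` is the larger of the
    -- left ends, `q` the smaller of the right ends. Both are contact points and `E` is affine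
    -- between them.
    obtain ⟨p, hp1, hp2, hp3⟩ : ∃ p, p < k ∧ (p = a ∨ p = a') ∧ a ≤ p ∧ a' ≤ p := by
      rcases le_total a a' with hh | hh
      · exact ⟨a', e2, Or.inr rfl, hh, le_rfl⟩
      · exact ⟨a, h1, Or.inl rfl, le_rfl, hh⟩
    obtain ⟨q, hq1, hq2, hq3⟩ : ∃ q, k ≤ q ∧ (q = b ∨ q = b') ∧ q ≤ b ∧ q ≤ b' := by
      rcases le_total b b' with hh | hh
      · exact ⟨b, h2, Or.inl rfl, le_rfl, hh⟩
      · exact ⟨b', e3, Or.inr rfl, hh, le_rfl⟩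
    have hpE : α + β * p ≤ E p := by
      have : E p = G p := by rcases hp2 with rfl | rfl <;> assumption
      rw [this]; exact hαβ p hp3.1 (by omega)
    have hqE : α + β * q ≤ E q := by
      have : E q = G q := by rcases hq2 with rfl | rfl <;> assumption
      rw [this]; exact hαβ q (by omega) hq3.1
    have s1 := sub_eq_of_forall_slope_eq (E := E) (a := p) (b := k) (c := c) hp1.le
      fun i hi1 hi2 => (e7 i (by omega) (by omega)).2 ⟨by omega, by omega⟩
    have s2 := sub_eq_of_forall_slope_eq (E := E) (a := k) (b := q) (c := c) hq1
      fun i hi1 hi2 => (e7 i (by omega) (by omega)).2 ⟨by omega, by omega⟩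
    have hkp : (0 : ℝ) < k - p := by
      have : (p : ℝ) < k := by exact_mod_cast hp1
      linarith
    have hqk : (0 : ℝ) ≤ q - k := by
      have : (k : ℝ) ≤ q := by exact_mod_cast hq1
      linarith
    nlinarith

/-- A support line of the convex sequence `E` at the cell `k`. -/
theorem support (h : IsGCM G E m n) {k : ℤ} (hmk : m < k) (hkn : k ≤ n) {i : ℤ} (hmi : m ≤ i)
    (hin : i ≤ n) : E (k - 1) + (E k - E (k - 1)) * (i - (k - 1)) ≤ E i := by
  rcases le_or_gt k i with hk | hk
  · have := le_sub_of_forall_slope_ge (E := E) (a := k - 1) (b := i) (c := E k - E (k - 1))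
      (by omega) fun l h1 h2 => h.slope_mono hmk (by omega) (by omega)
    push_cast at this
    linarith
  · have := sub_le_of_forall_slope_le (E := E) (a := i) (b := k - 1) (c := E k - E (k - 1))
      (by omega) fun l h1 h2 => h.slope_mono (by omega) (by omega) (by omega)
    push_cast at this
    linarith

/-- Two cells which are not divided in a smaller interval are not divided in a bigger one. -/
theorem slope_eq_of_subset {E' : ℤ → ℝ} {m' n' : ℤ} (h : IsGCM G E m n) (h' : IsGCM G E' m' n')
    (hm : m' ≤ m) (hn : n ≤ n') {p q : ℤ} (hp : m < p) (hpq : p ≤ q) (hq : q ≤ n)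
    (heq : E p - E (p - 1) = E q - E (q - 1)) : E' p - E' (p - 1) = E' q - E' (q - 1) := by
  by_contra hne
  obtain ⟨a, b, e1, e2, e3, e4, e5, e6, e7⟩ := h'.class_bounds (show m' < p by omega)
    (show p ≤ n' by omega)
  have hbq : b < q := by
    by_contra hc
    exact hne ((e7 q (by omega) (by omega)).2 ⟨by omega, by omega⟩).symm
  -- The support lines of `E'` lie below `G`, hence below `E` by maximality of `E` on the smaller
  -- interval.
  have hle : ∀ i, m ≤ i → i ≤ n → E' i ≤ E i := by
    intro i h1 h2
    obtain ⟨k, hk1, hk2, hk3⟩ : ∃ k, m' < k ∧ k ≤ n' ∧ (i = k ∨ i = k - 1) := by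
      rcases (show m' ≤ i by omega).eq_or_lt with hi | hi
      · exact ⟨i + 1, by omega, by omega, by omega⟩
      · exact ⟨i, hi, by omega, Or.inl rfl⟩
    have := h.max (E' (k - 1) - (E' k - E' (k - 1)) * (k - 1)) (E' k - E' (k - 1))
      (fun l hl1 hl2 => by
        have e1 := h'.support hk1 hk2 (i := l) (by omega) (by omega)
        have e2 := h'.le l (by omega) (by omega)
        linarith) i h1 h2
    rcases hk3 with rfl | rfl
    · linarith
    · push_cast at this; linarith
  -- At `b` one has `E' = G`, so `E` and `E'` agree there, while `E' ≤ E` at the neighbours. Since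
  -- `E` is straight at `b`, the convex `E'` must be straight too, but `b` is the end of the class
  -- of `p`.
  have hb := h.le b (by omega) (by omega)
  have hb' := hle b (by omega) (by omega)
  have hbE : E b = E' b := by linarith
  have h1 := hle (b - 1) (by omega) (by omega)
  have h2 := hle (b + 1) (by omega) (by omega)
  have s1 := h.slope_mono (show m < p by omega) e3 (show b ≤ n by omega)
  have s2 := h.slope_mono (show m < b + 1 by omega) (show b + 1 ≤ q by omega) hq
  have s3 := h.conv b (by omega) (by omega)
  have s4 := h'.conv b (by omega) (by omega)
  have s5 : E' (b + 1) - E' b ≠ E' b - E' (b - 1) := by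
    intro hc
    have hb1 := (e7 b (by omega) (by omega)).2 ⟨by omega, le_rfl⟩
    have := (e7 (b + 1) (by omega) (by omega)).1 (by rw [add_sub_cancel_right, hc, hb1])
    omega
  rw [add_sub_cancel_right] at s2
  apply s5
  linarith

end IsGCM

/-! ### Convex envelopes of piecewise affine functions on a grid -/

theorem interp_eq_affine (ε : ℝ) (hε : 0 < ε) (g : ℝ → ℝ) (k : ℤ) {u : ℝ}
    (h1 : (k - 1 : ℝ) * ε ≤ u) (h2 : u ≤ k * ε) :
    interp ε g u = g ((k - 1 : ℝ) * ε) +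
      (g (k * ε) - g ((k - 1 : ℝ) * ε)) * (u / ε - (k - 1)) := by
  unfold interp
  -- At the right end of the cell the floor is already `k` and not `k - 1`.
  rcases h2.eq_or_lt with rfl | h2
  · have e : (k : ℝ) * ε / ε = k := by field_simp
    rw [e, Int.floor_intCast]
    simp
  · have : ⌊u / ε⌋ = k - 1 := by
      rw [Int.floor_eq_iff]
      push_cast
      rw [le_div_iff₀ hε, div_lt_iff₀ hε]
      exact ⟨h1, by linarith⟩
    rw [this]
    push_cast
    rw [sub_add_cancel]
    field_simp

theorem exists_cell (ε : ℝ) (hε : 0 < ε) {m n : ℤ} (hmn : m < n) {u : ℝ}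
    (hu : u ∈ Icc ((m : ℝ) * ε) (n * ε)) :
    ∃ k : ℤ, m < k ∧ k ≤ n ∧ (k - 1 : ℝ) * ε ≤ u ∧ u ≤ k * ε := by
  rcases hu.1.eq_or_lt with h | h
  · refine ⟨m + 1, by omega, by omega, ?_, ?_⟩
    · push_cast; rw [add_sub_cancel_right]; exact h.le
    · push_cast; nlinarith
  · refine ⟨⌈u / ε⌉, Int.lt_ceil.2 ?_, Int.ceil_le.2 ?_, ?_, ?_⟩
    · rwa [lt_div_iff₀ hε]
    · rw [div_le_iff₀ hε]; exact hu.2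
    · have := Int.ceil_lt_add_one (u / ε)
      rw [← le_div_iff₀ hε]; linarith
    · rw [← div_le_iff₀ hε]; exact Int.le_ceil _

theorem affine_mem_of_cell {ε : ℝ} (hε : 0 < ε) {k : ℤ} {u : ℝ} (h1 : (k - 1 : ℝ) * ε ≤ u)
    (h2 : u ≤ k * ε) : 0 ≤ u / ε - (k - 1) ∧ u / ε - (k - 1) ≤ 1 := by
  rw [← le_div_iff₀ hε] at h1
  rw [← div_le_iff₀ hε] at h2
  constructor <;> linarith

/-- The convex envelope of a piecewise affine function is the piecewise affine extension of the
greatest convex minorant of its values on the grid. -/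
theorem convEnv_interp_eq {ε : ℝ} (hε : 0 < ε) {g : ℝ → ℝ} {E : ℤ → ℝ} {m n : ℤ}
    (h : IsGCM (fun k => g (k * ε)) E m n) {k : ℤ} (hmk : m < k) (hkn : k ≤ n) {u : ℝ}
    (h1 : (k - 1 : ℝ) * ε ≤ u) (h2 : u ≤ k * ε) :
    convEnv (interp ε g) (m * ε) (n * ε) u = E (k - 1) + (E k - E (k - 1)) * (u / ε - (k - 1)) := by
  -- `interp` reads its function only at grid points, where the rounding is exact; so `P` is the
  -- piecewise affine extension of `E`.
  set P : ℝ → ℝ := fun x => interp ε (fun y => E (round (y / ε))) x with hP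
  have hPcell : ∀ (i : ℤ) (x : ℝ), (i - 1 : ℝ) * ε ≤ x → x ≤ i * ε →
      P x = E (i - 1) + (E i - E (i - 1)) * (x / ε - (i - 1)) := by
    intro i x hx1 hx2
    have e1 : ((i : ℝ) - 1) * ε / ε = ((i - 1 : ℤ) : ℝ) := by push_cast; field_simp
    have e2 : (i : ℝ) * ε / ε = (i : ℝ) := by field_simp
    simp only [hP]
    rw [interp_eq_affine ε hε _ i hx1 hx2, e1, e2, round_intCast, round_intCast]
  have hmn : m < n := by omega
  have hsupp : ∀ i, m < i → i ≤ n → ∀ x ∈ Icc ((m : ℝ) * ε) (n * ε),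
      E (i - 1) + (E i - E (i - 1)) * (x / ε - (i - 1)) ≤ P x := by
    intro i hi1 hi2 x hx
    obtain ⟨l, hl1, hl2, hl3, hl4⟩ := exists_cell ε hε hmn hx
    rw [hPcell l x hl3 hl4]
    have s1 := h.support hi1 hi2 (i := l) (by omega) hl2
    have s2 := h.support hi1 hi2 (i := l - 1) (by omega) (by omega)
    obtain ⟨c1, c2⟩ := affine_mem_of_cell hε hl3 hl4
    push_cast at s2
    set y := x / ε
    nlinarith
  -- By `hsupp`, `P` dominates each of its affine pieces, and it equals one of them at the convex
  -- combination.
  have hconv : ConvexOn ℝ (Icc ((m : ℝ) * ε) (n * ε)) P := by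
    refine ⟨convex_Icc _ _, fun x hx y hy a b ha hb hab => ?_⟩
    have hz := (convex_Icc ((m : ℝ) * ε) (n * ε)) hx hy ha hb hab
    obtain ⟨l, hl1, hl2, hl3, hl4⟩ := exists_cell ε hε hmn hz
    rw [hPcell l _ hl3 hl4]
    have s1 := mul_le_mul_of_nonneg_left (hsupp l hl1 hl2 x hx) ha
    have s2 := mul_le_mul_of_nonneg_left (hsupp l hl1 hl2 y hy) hb
    simp only [smul_eq_mul]
    have hb' : b = 1 - a := by linarith
    subst hb'
    have : E (l - 1) + (E l - E (l - 1)) * ((a * x + (1 - a) * y) / ε - (l - 1)) =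
      a * (E (l - 1) + (E l - E (l - 1)) * (x / ε - (l - 1))) +
      (1 - a) * (E (l - 1) + (E l - E (l - 1)) * (y / ε - (l - 1))) := by ring
    linarith
  have hle : ∀ x ∈ Icc ((m : ℝ) * ε) (n * ε), P x ≤ interp ε g x := by
    intro x hx
    obtain ⟨l, hl1, hl2, hl3, hl4⟩ := exists_cell ε hε hmn hx
    rw [hPcell l x hl3 hl4, interp_eq_affine ε hε g l hl3 hl4]
    have s1 := h.le l (by omega) hl2
    have s2 := h.le (l - 1) (by omega) (by omega)
    obtain ⟨c1, c2⟩ := affine_mem_of_cell hε hl3 hl4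
    push_cast at s2
    set y := x / ε
    nlinarith
  have hu : u ∈ Icc ((m : ℝ) * ε) (n * ε) := by
    have e1 : (m : ℝ) ≤ k - 1 := by
      have : m ≤ k - 1 := by omega
      exact_mod_cast this
    have e2 : (k : ℝ) ≤ n := by exact_mod_cast hkn
    constructor <;> nlinarith
  rw [← hPcell k u h1 h2]
  refine IsGreatest.csSup_eq ⟨⟨P, hconv, hle, rfl⟩, ?_⟩
  rintro _ ⟨q, hq, hqg, rfl⟩
  -- Maximality of `P`: a convex competitor is below `g = E` at the two ends of the class of `k`,
  -- and `E` is affine between them, so the competitor is below `P` at `u`.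
  obtain ⟨a, b, e1, e2, e3, e4, e5, e6, e7⟩ := h.class_bounds hmk hkn
  have hgrid : ∀ i : ℤ, m ≤ i → i ≤ n → q (i * ε) ≤ g (i * ε) := by
    intro i h1 h2
    have hm : ((i : ℝ) * ε) ∈ Icc ((m : ℝ) * ε) (n * ε) := by
      have e1 : (m : ℝ) ≤ i := by exact_mod_cast h1
      have e2 : (i : ℝ) ≤ n := by exact_mod_cast h2
      constructor <;> nlinarith
    refine (hqg _ hm).trans_eq ?_
    rw [interp_eq_affine ε hε g i (by nlinarith) le_rfl]
    have : (i : ℝ) * ε / ε = i := by field_simp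
    rw [this]; ring
  have hqa := hgrid a e1 (by omega)
  have hqb := hgrid b (by omega) e4
  rw [← e5] at hqa
  rw [← e6] at hqb
  have sa := sub_eq_of_forall_slope_eq (E := E) (a := a) (b := k - 1) (c := E k - E (k - 1))
    (by omega) fun i hi1 hi2 => (e7 i (by omega) (by omega)).2 ⟨by omega, by omega⟩
  have sb := sub_eq_of_forall_slope_eq (E := E) (a := k - 1) (b := b) (c := E k - E (k - 1))
    (by omega) fun i hi1 hi2 => (e7 i (by omega) (by omega)).2 ⟨by omega, by omega⟩
  rw [hPcell k u h1 h2]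
  set c := E k - E (k - 1)
  push_cast at sa sb
  have ha' : (a : ℝ) ≤ k - 1 := by
    have : a ≤ k - 1 := by omega
    exact_mod_cast this
  have hb' : (k : ℝ) ≤ b := by exact_mod_cast e3
  have hab : (0 : ℝ) < b - a := by linarith
  obtain ⟨c1, c2⟩ := affine_mem_of_cell hε h1 h2
  have mema : ((a : ℝ) * ε) ∈ Icc ((m : ℝ) * ε) (n * ε) := by
    have e1 : (m : ℝ) ≤ a := by exact_mod_cast e1
    have e2 : (a : ℝ) ≤ n := by exact_mod_cast (show a ≤ n by omega)
    constructor <;> nlinarith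
  have memb : ((b : ℝ) * ε) ∈ Icc ((m : ℝ) * ε) (n * ε) := by
    have e1 : (m : ℝ) ≤ b := by exact_mod_cast (show m ≤ b by omega)
    have e2 : (b : ℝ) ≤ n := by exact_mod_cast (show b ≤ n by omega)
    constructor <;> nlinarith
  have hA : 0 ≤ (b - u / ε) / (b - a) := div_nonneg (by linarith) hab.le
  have hB : 0 ≤ (u / ε - a) / (b - a) := div_nonneg (by linarith) hab.le
  have hcv := hq.2 mema memb hA hB (by field_simp; ring)
  have hpt : ((b - u / ε) / (b - a)) • (a * ε) + ((u / ε - a) / (b - a)) • (b * ε) = u := by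
    simp only [smul_eq_mul]
    field_simp
    ring
  rw [hpt] at hcv
  simp only [smul_eq_mul] at hcv
  refine hcv.trans ?_
  have t1 := mul_le_mul_of_nonneg_left hqa hA
  have t2 := mul_le_mul_of_nonneg_left hqb hB
  have t3 : (b - u / ε) / (b - a) * E a + (u / ε - a) / (b - a) * E b =
      E (k - 1) + c * (u / ε - (k - 1)) := by
    have f1 : E a = E (k - 1) - c * (k - 1 - a) := by linarith
    have f2 : E b = E (k - 1) + c * (b - (k - 1)) := by linarith
    rw [f1, f2]
    field_simp
    ring
  linarith

/-! ### Slopes of envelopes: dependence on the interval and on the function -/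

/-- The slope, on the cell `((k - 1) ε, k ε)`, of the convex envelope on `[m ε, n ε]` of the
piecewise affine interpolation of `g`. -/
def envSlope (ε : ℝ) (g : ℝ → ℝ) (m n k : ℤ) : ℝ :=
  deriv (convEnv (interp ε g) (m * ε) (n * ε)) (k * ε - ε / 2)

theorem envSlope_eq {ε : ℝ} (hε : 0 < ε) {g : ℝ → ℝ} {E : ℤ → ℝ} {m n : ℤ}
    (h : IsGCM (fun k => g (k * ε)) E m n) {k : ℤ} (hmk : m < k) (hkn : k ≤ n) :
    envSlope ε g m n k = (E k - E (k - 1)) / ε := by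
  have hev : convEnv (interp ε g) (m * ε) (n * ε) =ᶠ[nhds (k * ε - ε / 2)]
      fun u => E (k - 1) + (E k - E (k - 1)) * (u / ε - (k - 1)) := by
    filter_upwards [Ioo_mem_nhds (show ((k : ℝ) - 1) * ε < k * ε - ε / 2 by linarith)
      (show k * ε - ε / 2 < k * ε by linarith)] with u hu
    exact convEnv_interp_eq hε h hmk hkn hu.1.le hu.2.le
  rw [envSlope, hev.deriv_eq]
  have : HasDerivAt (fun u : ℝ => E (k - 1) + (E k - E (k - 1)) * (u / ε - (k - 1)))
      ((E k - E (k - 1)) * (1 / ε)) (k * ε - ε / 2) :=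
    ((((hasDerivAt_id _).div_const ε).sub_const _).const_mul _).const_add _
  rw [this.deriv]
  ring

section
variable {ε : ℝ} (hε : 0 < ε) (g : ℝ → ℝ) {m n : ℤ}
include hε

theorem envSlope_mono {i k : ℤ} (hi : m < i) (hik : i ≤ k) (hk : k ≤ n) :
    envSlope ε g m n i ≤ envSlope ε g m n k := by
  obtain ⟨E, hE⟩ := exists_isGCM (fun k => g (k * ε)) m n (by omega)
  rw [envSlope_eq hε hE hi (by omega), envSlope_eq hε hE (by omega) hk]
  have := hE.slope_mono hi hik hk
  gcongr

theorem envSlope_class {k : ℤ} (hmk : m < k) (hkn : k ≤ n) :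
    ∃ a b, m ≤ a ∧ a < k ∧ k ≤ b ∧ b ≤ n ∧
      (∀ i, m < i → i ≤ n → (envSlope ε g m n i = envSlope ε g m n k ↔ a < i ∧ i ≤ b)) ∧
      g (b * ε) - g (a * ε) = envSlope ε g m n k * (b * ε - a * ε) ∧
      ∀ i, a < i → i ≤ b → envSlope ε g a b i = envSlope ε g m n k := by
  obtain ⟨E, hE⟩ := exists_isGCM (fun k => g (k * ε)) m n (by omega)
  obtain ⟨a, b, h1, h2, h3, h4, h5, h6, h7⟩ := hE.class_bounds hmk hkn
  refine ⟨a, b, h1, h2, h3, h4, ?_, ?_, ?_⟩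
  · intro i hi1 hi2
    rw [envSlope_eq hε hE hi1 hi2, envSlope_eq hε hE hmk hkn, ← h7 i hi1 hi2,
      div_left_inj' hε.ne']
  · rw [envSlope_eq hε hE hmk hkn]
    rw [← h5, ← h6, sub_eq_of_forall_slope_eq (E := E) (c := E k - E (k - 1)) (by omega)
      fun i hi1 hi2 => (h7 i (by omega) (by omega)).2 ⟨hi1, hi2⟩]
    field_simp
  · intro i hi1 hi2
    rw [envSlope_eq hε (hE.restrict h1 (by omega) h4 h5 h6) hi1 hi2, envSlope_eq hε hE hmk hkn,
      (h7 i (by omega) (by omega)).2 ⟨hi1, hi2⟩]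

theorem envSlope_eq_of_subset {m' n' : ℤ} (hm : m' ≤ m) (hn : n ≤ n') {p q : ℤ} (hp : m < p)
    (hpq : p ≤ q) (hq : q ≤ n) (heq : envSlope ε g m n p = envSlope ε g m n q) :
    envSlope ε g m' n' p = envSlope ε g m' n' q := by
  obtain ⟨E, hE⟩ := exists_isGCM (fun k => g (k * ε)) m n (by omega)
  obtain ⟨E', hE'⟩ := exists_isGCM (fun k => g (k * ε)) m' n' (by omega)
  rw [envSlope_eq hε hE hp (by omega), envSlope_eq hε hE (by omega) hq,
    div_left_inj' hε.ne'] at heq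
  rw [envSlope_eq hε hE' (by omega) (by omega), envSlope_eq hε hE' (by omega) (by omega),
    hE.slope_eq_of_subset hE' hm hn hp hpq hq heq]

/-- A saddle point `a` for `g` and a saddle point `b` for `g'` give one chord on the common range,
which the slope for `g` does not exceed and the slope for `g'` dominates up to `c`. With `g = g'`
and `c = 0`: cutting the interval on the left or prolonging it on the right lowers the slopes. -/
theorem envSlope_le_add {g' : ℝ → ℝ} {m' n' k : ℤ} {c : ℝ} (hm : m' ≤ m) (hn : n' ≤ n)
    (hmk : m < k) (hkn : k ≤ n')
    (hc : ∀ a b : ℤ, m ≤ a → a ≤ b → b ≤ n' →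
      (g (b * ε) - g' (b * ε)) - (g (a * ε) - g' (a * ε)) ≤ c * (b * ε - a * ε)) :
    envSlope ε g m n k ≤ envSlope ε g' m' n' k + c := by
  obtain ⟨E, hE⟩ := exists_isGCM (fun k => g (k * ε)) m n (by omega)
  obtain ⟨E', hE'⟩ := exists_isGCM (fun k => g' (k * ε)) m' n' (by omega)
  rw [envSlope_eq hε hE hmk (by omega), envSlope_eq hε hE' (by omega) hkn]
  obtain ⟨a, ha1, ha2, ha3⟩ := hE.saddle_left hmk (by omega)
  obtain ⟨b, hb1, hb2, hb3⟩ := hE'.saddle_right (show m' < k by omega) hkn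
  have h1 := ha3 b hb1 (by omega)
  have h2 := hb3 a (by omega) ha2
  have h3 := hc a b ha1 (by omega) hb2
  have hab : (0 : ℝ) < b - a := by
    have : (a : ℝ) < b := by exact_mod_cast (show a < b by omega)
    linarith
  rw [div_add' _ _ _ hε.ne']
  gcongr
  have : (E k - E (k - 1)) * (b - a) ≤ (E' k - E' (k - 1) + c * ε) * (b - a) := by linarith
  exact le_of_mul_le_mul_right this hab

end

/-! ### From convex to concave envelopes -/

theorem interp_neg (ε : ℝ) (g : ℝ → ℝ) (u : ℝ) : interp ε (-g) u = -interp ε g u := by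
  simp only [interp, Pi.neg_apply]; ring

theorem concEnv_eq_neg_convEnv (g : ℝ → ℝ) (a b u : ℝ) :
    concEnv g a b u = -convEnv (-g) a b u := by
  -- The real infimum is by definition minus the supremum of the opposite set, so no boundedness is
  -- needed.
  rw [concEnv, Real.sInf_def, convEnv]
  congr 2
  ext y
  simp only [Set.mem_neg, mem_ofPred_eq]
  constructor
  · rintro ⟨h, h1, h2, h3⟩
    exact ⟨-h, h1.neg, fun z hz => neg_le_neg (h2 z hz), by rw [Pi.neg_apply, ← h3, neg_neg]⟩
  · rintro ⟨h, h1, h2, h3⟩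
    exact ⟨-h, h1.neg, fun z hz => le_neg_of_le_neg (h2 z hz), by rw [Pi.neg_apply, ← h3]⟩

/-- The segment of a negative wave with right state `k ε` lies to the right of that state, so as a
cell labelled by its right end it has index `k + 1`. -/
theorem deriv_concEnv_interp (ε : ℝ) (g : ℝ → ℝ) (m n k : ℤ) :
    deriv (concEnv (interp ε g) (m * ε) (n * ε)) (k * ε + ε / 2) =
      -envSlope ε (-g) m n (k + 1) := by
  have h1 : concEnv (interp ε g) (m * ε) (n * ε) =
      fun u => -convEnv (interp ε (-g)) (m * ε) (n * ε) u := by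
    ext u
    rw [concEnv_eq_neg_convEnv]
    congr 2
    ext z
    rw [interp_neg, Pi.neg_apply]
  rw [h1, deriv.fun_neg, envSlope]
  congr 2
  push_cast; ring

/-! ### Derivatives of the flux -/

theorem norm_iteratedFDeriv_fderiv_apply_le {h : ℝ × ℝ → ℝ} {N : WithTop ℕ∞} {n : ℕ}
    (hh : ContDiff ℝ N h) (hn : (n + 1 : WithTop ℕ∞) ≤ N) (e : ℝ × ℝ) (he : ‖e‖ ≤ 1) (p : ℝ × ℝ) :
    ‖iteratedFDeriv ℝ n (fun q => fderiv ℝ h q e) p‖ ≤ ‖iteratedFDeriv ℝ (n + 1) h p‖ := by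
  have h1 : ContDiff ℝ n (fderiv ℝ h) := hh.fderiv_right hn
  have h2 := norm_iteratedFDeriv_clm_apply_const (c := e) (h1.contDiffAt (x := p)) le_rfl
  rw [norm_iteratedFDeriv_fderiv] at h2
  exact h2.trans (mul_le_of_le_one_left (norm_nonneg _) he)

theorem hasDerivAt_fst_slice {h : ℝ × ℝ → ℝ} (hh : Differentiable ℝ h) (w v : ℝ) :
    HasDerivAt (fun w' => h (w', v)) (fderiv ℝ h (w, v) (1, 0)) w :=
  ((hh (w, v)).hasFDerivAt).comp_hasDerivAt w ((hasDerivAt_id w).prodMk (hasDerivAt_const w v))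

theorem hasDerivAt_snd_slice {h : ℝ × ℝ → ℝ} (hh : Differentiable ℝ h) (w v : ℝ) :
    HasDerivAt (fun v' => h (w, v')) (fderiv ℝ h (w, v) (0, 1)) v :=
  ((hh (w, v)).hasFDerivAt).comp_hasDerivAt v ((hasDerivAt_const v w).prodMk (hasDerivAt_id v))

section
variable {f : ℝ → ℝ → ℝ} (hf : IsAdmissibleFlux f)
include hf

/-- The partial derivatives are iterated Fréchet derivatives evaluated on the unit vectors `(1, 0)`
and `(0, 1)`, hence bounded by the assumed bounds. Boundedness is what makes the suprema `normD2`
and `normD3` genuine upper bounds. -/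
theorem IsAdmissibleFlux.exists_derivs : ∃ g1 g2 g3 : ℝ × ℝ → ℝ,
    Continuous g1 ∧ (∀ w v, HasDerivAt (fun w' => f w' v) (g1 (w, v)) w) ∧
    (∀ w v, HasDerivAt (fun w' => g1 (w', v)) (g2 (w, v)) w) ∧
    (∀ w v, HasDerivAt (fun v' => g2 (w, v')) (g3 (w, v)) v) ∧
    (∃ C, ∀ p, |g2 p| ≤ C) ∧ (∃ C, ∀ p, |g3 p| ≤ C) := by
  obtain ⟨h0, hb⟩ := hf
  set g : ℝ × ℝ → ℝ := fun p => f p.1 p.2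
  have h1 : ContDiff ℝ 2 (fun q => fderiv ℝ g q (1, 0)) :=
    (h0.fderiv_right (m := 2) (by norm_num)).clm_apply contDiff_const
  have h2 : ContDiff ℝ 1 (fun q => fderiv ℝ (fun q => fderiv ℝ g q (1, 0)) q (1, 0)) :=
    (h1.fderiv_right (m := 1) (by norm_num)).clm_apply contDiff_const
  have e1 : ‖((1, 0) : ℝ × ℝ)‖ ≤ 1 := by simp
  have e2 : ‖((0, 1) : ℝ × ℝ)‖ ≤ 1 := by simp
  refine ⟨fun q => fderiv ℝ g q (1, 0),
    fun q => fderiv ℝ (fun q => fderiv ℝ g q (1, 0)) q (1, 0), fun p => fderiv ℝ (fun q => fderiv ℝ (fun q => fderiv ℝ g q (1, 0)) q (1, 0)) p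
    (0, 1), h1.continuous, fun w v => hasDerivAt_fst_slice (h0.differentiable (by norm_num)) w v,
    fun w v => hasDerivAt_fst_slice (h1.differentiable (by norm_num)) w v,
    fun w v => hasDerivAt_snd_slice (h2.differentiable (by norm_num)) w v, ?_, ?_⟩
  · obtain ⟨C, hC⟩ := hb 2 (by norm_num)
    refine ⟨C, fun p => ?_⟩
    have a1 := norm_iteratedFDeriv_fderiv_apply_le (n := 0) h1 (by norm_num) (1, 0) e1 p
    have a2 := norm_iteratedFDeriv_fderiv_apply_le (n := 1) h0 (by norm_num) (1, 0) e1 p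
    rw [norm_iteratedFDeriv_zero, Real.norm_eq_abs] at a1
    exact a1.trans (a2.trans (hC p))
  · obtain ⟨C, hC⟩ := hb 3 (by norm_num)
    refine ⟨C, fun p => ?_⟩
    have a1 := norm_iteratedFDeriv_fderiv_apply_le (n := 0) h2 (by norm_num) (0, 1) e2 p
    have a2 := norm_iteratedFDeriv_fderiv_apply_le (n := 1) h1 (by norm_num) (1, 0) e1 p
    have a3 := norm_iteratedFDeriv_fderiv_apply_le (n := 2) h0 (by norm_num) (1, 0) e1 p
    rw [norm_iteratedFDeriv_zero, Real.norm_eq_abs] at a1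
    exact a1.trans (a2.trans (a3.trans (hC p)))

theorem IsAdmissibleFlux.hasDerivAt_deriv (w v : ℝ) :
    HasDerivAt (deriv fun w' => f w' v) (fww f w v) w := by
  obtain ⟨g1, g2, g3, -, h1, h2, -⟩ := hf.exists_derivs
  have e : (deriv fun w' => f w' v) = fun w => g1 (w, v) := funext fun w => (h1 w v).deriv
  have : fww f w v = g2 (w, v) := by
    rw [fww, iteratedDeriv_succ, iteratedDeriv_one, e, (h2 w v).deriv]
  rw [this, e]
  exact h2 w v

theorem IsAdmissibleFlux.differentiable (v : ℝ) : Differentiable ℝ fun w => f w v := by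
  obtain ⟨g1, g2, g3, -, h1, -⟩ := hf.exists_derivs
  exact fun w => (h1 w v).differentiableAt

theorem IsAdmissibleFlux.abs_fww_le (w v : ℝ) : |fww f w v| ≤ normD2 f := by
  obtain ⟨g1, g2, g3, -, h1, h2, -, ⟨C, hC⟩, -⟩ := hf.exists_derivs
  refine le_ciSup (f := fun p : ℝ × ℝ => |fww f p.1 p.2|) ⟨C, ?_⟩ (w, v)
  rintro _ ⟨⟨w, v⟩, rfl⟩
  have e : (deriv fun w' => f w' v) = fun w => g1 (w, v) := funext fun w => (h1 w v).deriv
  have : fww f w v = g2 (w, v) := by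
    rw [fww, iteratedDeriv_succ, iteratedDeriv_one, e, (h2 w v).deriv]
  simp only [this]
  exact hC _

theorem IsAdmissibleFlux.abs_fww_sub_le (w v v' : ℝ) :
    |fww f w v' - fww f w v| ≤ normD3 f * |v' - v| := by
  obtain ⟨g1, g2, g3, -, h1, h2, h3, -, ⟨C, hC⟩⟩ := hf.exists_derivs
  have e (v) : (deriv fun w' => f w' v) = fun w => g1 (w, v) := funext fun w => (h1 w v).deriv
  have ew (w v) : fww f w v = g2 (w, v) := by
    rw [fww, iteratedDeriv_succ, iteratedDeriv_one, e, (h2 w v).deriv]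
  have hd (w v) : HasDerivAt (fun v' => fww f w v') (fwwv f w v) v := by
    have : (fun v' => fww f w v') = fun v' => g2 (w, v') := funext fun v => ew w v
    rw [fwwv, this, (h3 w v).deriv]
    exact h3 w v
  have hle (w v) : |fwwv f w v| ≤ normD3 f := by
    refine le_ciSup (f := fun p : ℝ × ℝ => |fwwv f p.1 p.2|) ⟨C, ?_⟩ (w, v)
    rintro _ ⟨⟨w, v⟩, rfl⟩
    have : (fun v' => fww f w v') = fun v' => g2 (w, v') := funext fun v => ew w v
    simp only [fwwv, this, (h3 w v).deriv]
    exact hC _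
  have := Convex.norm_image_sub_le_of_norm_deriv_le (f := fun v' => fww f w v') (s := univ)
    (x := v) (y := v') (C := normD3 f) (fun x _ => (hd w x).differentiableAt)
    (fun x _ => by rw [(hd w x).deriv]; exact hle w x) convex_univ (mem_univ _) (mem_univ _)
  simpa only [Real.norm_eq_abs] using this

theorem IsAdmissibleFlux.lipschitzWith_deriv (v : ℝ) :
    LipschitzWith (normD2 f).toNNReal (deriv fun w => f w v) := by
  refine lipschitzWith_of_nnnorm_deriv_le
    (fun w => (hf.hasDerivAt_deriv w v).differentiableAt) fun w => ?_
  rw [(hf.hasDerivAt_deriv w v).deriv, ← NNReal.coe_le_coe, Real.coe_toNNReal']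
  exact (hf.abs_fww_le w v).trans (le_max_left _ _)

end

theorem normD2_nonneg (f : ℝ → ℝ → ℝ) : 0 ≤ normD2 f := Real.iSup_nonneg fun _ => abs_nonneg _

theorem normD3_nonneg (f : ℝ → ℝ → ℝ) : 0 ≤ normD3 f := Real.iSup_nonneg fun _ => abs_nonneg _

/-! ### Lipschitz functions with a.e. bounded derivative -/

/-- A Lipschitz function is absolutely continuous, so its increment is the integral of its
derivative, dominated by a sum of multiples of indicators. Almost everywhere bounds suffice, which
is all that effective fluxes provide. -/
theorem abs_sub_le_sum_of_ae_deriv_bound {ι : Type*} {δ : ℝ → ℝ} {K : NNReal}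
    (hδ : LipschitzWith K δ) (D : Finset ι) (a b : ι → ℝ) (c : ι → ℝ)
    (hab : ∀ q ∈ D, a q ≤ b q) (hc : ∀ q ∈ D, 0 ≤ c q)
    (hbd : ∀ q ∈ D, ∀ᵐ x ∂(volume : Measure ℝ), x ∈ Ioc (a q) (b q) → |deriv δ x| ≤ c q)
    {u u' : ℝ} (huu : u ≤ u') (hcov : Ioc u u' ⊆ ⋃ q ∈ D, Ioc (a q) (b q)) :
    |δ u' - δ u| ≤ ∑ q ∈ D, c q * (b q - a q) := by
  have hac : AbsolutelyContinuousOnInterval δ u u' :=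
    (hδ.lipschitzOnWith (s := uIcc u u')).absolutelyContinuousOnInterval
  rw [← hac.integral_deriv_eq_sub]
  set B : ℝ → ℝ := fun x => ∑ q ∈ D, (Ioc (a q) (b q)).indicator (fun _ => c q) x with hB
  have hBi (q) : Integrable ((Ioc (a q) (b q)).indicator fun _ => c q) (volume : Measure ℝ) :=
    (integrable_indicator_iff measurableSet_Ioc).2 (integrableOn_const measure_Ioc_lt_top.ne)
  have hBint : Integrable B (volume : Measure ℝ) := integrable_finsetSum D fun q _ => hBi q
  have hB0 : ∀ x, 0 ≤ B x := fun x =>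
    Finset.sum_nonneg fun q hq => indicator_nonneg (fun _ _ => hc q hq) x
  have h1 := intervalIntegral.norm_integral_le_of_norm_le (μ := volume) (f := deriv δ) (g := B)
    huu (by
      have := (ae_ball_iff D.countable_toSet).2 hbd
      filter_upwards [this] with x hx hxu
      obtain ⟨q, hq, hxq⟩ := mem_iUnion₂.1 (hcov hxu)
      refine (hx q hq hxq).trans ?_
      have := Finset.single_le_sum (f := fun q => (Ioc (a q) (b q)).indicator (fun _ => c q) x)
        (fun q hq => indicator_nonneg (fun _ _ => hc q hq) x) hq
      simpa only [indicator_of_mem hxq] using this) hBint.intervalIntegrable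
  rw [Real.norm_eq_abs] at h1
  refine h1.trans ?_
  rw [intervalIntegral.integral_of_le huu]
  refine (setIntegral_le_integral hBint (Filter.Eventually.of_forall hB0)).trans_eq ?_
  rw [integral_finsetSum D fun q _ => hBi q]
  refine Finset.sum_congr rfl fun q hq => ?_
  rw [integral_indicator measurableSet_Ioc, setIntegral_const, Real.volume_real_Ioc_of_le (hab q hq),
    smul_eq_mul, mul_comm]

/-! ### Existence of functions with prescribed second derivative on grid cells -/

theorem exists_primitive_of_continuous {h : ℝ → ℝ} (hh : Continuous h) :
    ∃ F : ℝ → ℝ, ContDiff ℝ 1 F ∧ deriv F = h := by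
  have hd : deriv (fun u => ∫ x in (0 : ℝ)..u, h x) = h :=
    funext fun b => hh.deriv_integral h 0 b
  refine ⟨fun u => ∫ x in (0 : ℝ)..u, h x, contDiff_one_iff_deriv.2 ⟨fun x => ?_, ?_⟩, hd⟩
  · exact (intervalIntegral.integral_hasDerivAt_right (hh.intervalIntegrable _ _)
      (hh.stronglyMeasurableAtFilter _ _) hh.continuousAt).differentiableAt
  · rw [hd]; exact hh

/-- The derivative of `F` is the sum over `q` of `∂f/∂w (·, v q)` composed with the clamping onto
the cell of `q`. Each term is constant off its own cell, so on the cell of `s` only the term of `s`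
varies. This gives existence of effective fluxes, without which `NotDividedEff` could never hold. -/
theorem exists_piecewise_flux {f : ℝ → ℝ → ℝ} (hf : IsAdmissibleFlux f) {ι : Type*} (D : Finset ι)
    (κ : ι → ℤ) (hκ : InjOn κ D) (v : ι → ℝ) {ε : ℝ} (hε : 0 < ε) :
    ∃ F : ℝ → ℝ, ContDiff ℝ 1 F ∧ (∃ K, LipschitzWith K (deriv F)) ∧
      ∀ s ∈ D, ∀ᵐ u ∂(volume : Measure ℝ), u ∈ Ioc (κ s * ε - ε) (κ s * ε) →
        HasDerivAt (deriv F) (fww f u (v s)) u := by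
  classical
  set cl : ι → ℝ → ℝ := fun q u => max (κ q * ε - ε) (min (κ q * ε) u) with hcl
  set h : ℝ → ℝ := fun u => ∑ q ∈ D, deriv (fun w => f w (v q)) (cl q u) with hh
  have hlip (q) : LipschitzWith (normD2 f).toNNReal
      (fun u => deriv (fun w => f w (v q)) (cl q u)) := by
    have : LipschitzWith 1 (cl q) := (LipschitzWith.id.const_min _).const_max _
    have := (hf.lipschitzWith_deriv (v q)).comp this
    rwa [mul_one] at this
  have hLip : ∃ K, LipschitzWith K h := by
    clear_value h
    subst hh
    clear hκ
    induction D using Finset.induction_on with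
    | empty => exact ⟨0, by simp⟩
    | insert q D hq ih =>
      obtain ⟨K, hK⟩ := ih
      refine ⟨(normD2 f).toNNReal + K, ?_⟩
      · simp only [Finset.sum_insert hq]
        exact (hlip q).add hK
  obtain ⟨F, hF1, hF2⟩ := exists_primitive_of_continuous hLip.choose_spec.continuous
  refine ⟨F, hF1, by rw [hF2]; exact hLip, fun s hs => ?_⟩
  rw [hF2]
  -- The clamping may have a corner at the right end of the cell; this point is negligible.
  have hne : ∀ᵐ u ∂(volume : Measure ℝ), u ≠ κ s * ε := by
    simp [ae_iff]
  filter_upwards [hne] with u hu hus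
  have hus' : u < κ s * ε := lt_of_le_of_ne hus.2 hu
  have key : ∀ q ∈ D, HasDerivAt (fun u => deriv (fun w => f w (v q)) (cl q u))
      (if q = s then fww f u (v s) else 0) u := by
    intro q hq
    split_ifs with hqs
    · subst hqs
      have hev : (fun u => deriv (fun w => f w (v q)) (cl q u)) =ᶠ[nhds u]
          deriv (fun w => f w (v q)) := by
        filter_upwards [Ioo_mem_nhds hus.1 hus'] with x hx
        simp only [hcl]
        rw [min_eq_right hx.2.le, max_eq_right hx.1.le]
      exact (hf.hasDerivAt_deriv u (v q)).congr_of_eventuallyEq hev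
    · have hne : κ q ≠ κ s := fun h => hqs (hκ hq hs h)
      rcases lt_or_gt_of_ne hne with hlt | hlt
      · have e : (κ q : ℝ) * ε ≤ κ s * ε - ε := by
          have : (κ q : ℝ) + 1 ≤ κ s := by exact_mod_cast hlt
          nlinarith
        have hev : (fun u => deriv (fun w => f w (v q)) (cl q u)) =ᶠ[nhds u]
            fun _ => deriv (fun w => f w (v q)) (κ q * ε) := by
          filter_upwards [Ioo_mem_nhds hus.1 hus'] with x hx
          simp only [hcl]
          rw [min_eq_left (by linarith [hx.1]), max_eq_right (by linarith)]
        exact (hasDerivAt_const u _).congr_of_eventuallyEq hev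
      · have e : (κ s : ℝ) * ε ≤ κ q * ε - ε := by
          have : (κ s : ℝ) + 1 ≤ κ q := by exact_mod_cast hlt
          nlinarith
        have hev : (fun u => deriv (fun w => f w (v q)) (cl q u)) =ᶠ[nhds u]
            fun _ => deriv (fun w => f w (v q)) (κ q * ε - ε) := by
          filter_upwards [Ioo_mem_nhds hus.1 hus'] with x hx
          simp only [hcl]
          rw [min_eq_right (by linarith [hx.2]), max_eq_left (by linarith [hx.2])]
        exact (hasDerivAt_const u _).congr_of_eventuallyEq hev
  have := HasDerivAt.fun_sum key
  rwa [Finset.sum_ite_eq' D s, if_pos hs] at this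

/-! ### Step functions -/

/-- The sum of the jumps `c s` at the points `p s ≤ x`, `s ∈ A`. -/
def stepSum {ι : Type*} (A : Finset ι) (p c : ι → ℝ) (x : ℝ) : ℝ := ∑ s ∈ A with p s ≤ x, c s

theorem eventually_stepSum_left {ι : Type*} (A : Finset ι) (p c : ι → ℝ) (x : ℝ) :
    ∀ᶠ y in nhdsWithin x (Iio x), stepSum A p c y = ∑ s ∈ A with p s < x, c s := by
  have h : ∀ᶠ y in nhdsWithin x (Iio x), ∀ s ∈ A, p s < x → p s ≤ y := by
    rw [Filter.eventually_all_finset]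
    intro s _
    by_cases hs : p s < x
    · filter_upwards [nhdsWithin_le_nhds (Ioi_mem_nhds hs)] with y hy _ using le_of_lt hy
    · exact Filter.Eventually.of_forall fun y h => absurd h hs
  filter_upwards [h, self_mem_nhdsWithin] with y hy hyx
  refine Finset.sum_congr (Finset.filter_congr fun s hs => ?_) fun _ _ => rfl
  exact ⟨fun h => h.trans_lt hyx, hy s hs⟩

theorem eventually_stepSum_right {ι : Type*} (A : Finset ι) (p c : ι → ℝ) (x : ℝ) :
    ∀ᶠ y in nhdsWithin x (Ici x), stepSum A p c y = stepSum A p c x := by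
  have h : ∀ᶠ y in nhdsWithin x (Ici x), ∀ s ∈ A, p s ≤ y → p s ≤ x := by
    rw [Filter.eventually_all_finset]
    intro s _
    by_cases hs : p s ≤ x
    · exact Filter.Eventually.of_forall fun _ _ => hs
    · filter_upwards [nhdsWithin_le_nhds (Iio_mem_nhds (not_le.1 hs))] with y hy h
      exact absurd h (not_le.2 hy)
  filter_upwards [h, self_mem_nhdsWithin] with y hy hyx
  refine Finset.sum_congr (Finset.filter_congr fun s hs => ?_) fun _ _ => rfl
  exact ⟨hy s hs, fun h => h.trans hyx⟩

theorem leftLim_stepSum {ι : Type*} (A : Finset ι) (p c : ι → ℝ) (x : ℝ) :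
    Function.leftLim (stepSum A p c) x = ∑ s ∈ A with p s < x, c s :=
  leftLim_eq_of_tendsto (tendsto_const_nhds.congr'
    ((eventually_stepSum_left A p c x).mono fun _ h => h.symm))

theorem stepSum_eq_left_add {ι : Type*} (A : Finset ι) (p c : ι → ℝ) (x : ℝ) :
    stepSum A p c x = ∑ s ∈ A with p s < x, c s + ∑ s ∈ A with p s = x, c s := by
  classical
  rw [stepSum, ← Finset.sum_union]
  · refine Finset.sum_congr ?_ fun _ _ => rfl
    ext s
    simp only [Finset.mem_filter, Finset.mem_union, le_iff_lt_or_eq]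
    tauto
  · rw [Finset.disjoint_filter]
    intro s _ h
    exact h.ne

/-- A grid datum is a finite sum of jumps. -/
theorem IsGridDatum.exists_jumps {ε : ℝ} (hε : 0 < ε) {u : ℝ → ℝ} (hu : IsGridDatum ε u) :
    ∃ (D : Finset ℝ) (J : ℝ → ℤ), (∀ y ∈ D, J y ≠ 0) ∧
      u = stepSum D (fun y => y) fun y => ε * J y := by
  classical
  obtain ⟨h1, h2, h3, h4⟩ := hu
  choose m hm using h1
  have hmu : ∀ x, (m x : ℝ) = u x / ε := fun x => by rw [hm]; field_simp
  -- `u / ε` is integer valued, so it is constant on an interval where it is continuous.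
  have hconst : ∀ a b, a ≤ b → (∀ x ∈ Ioc a b, ContinuousAt u x) → m a = m b := by
    intro a b hab hc
    have hcu : ContinuousOn u (Icc a b) := by
      intro x hx
      rcases hx.1.eq_or_lt with rfl | h
      · exact (h3 a).mono Icc_subset_Ici_self
      · exact (hc x ⟨h, hx.2⟩).continuousWithinAt
    have hcm : ContinuousOn m (Icc a b) := by
      rw [Int.isClosedEmbedding_coe_real.isInducing.continuousOn_iff]
      exact (hcu.div_const ε).congr fun x _ => hmu x
    exact isPreconnected_Icc.constant hcm ⟨le_rfl, hab⟩ ⟨hab, le_rfl⟩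
  have hleft : ∀ y, ∃ c : ℤ, ∀ᶠ x in nhdsWithin y (Iio y), m x = c := by
    intro y
    have hfin : ∀ᶠ x in nhdsWithin y (Iio y), ∀ z ∈ h4.toFinset, z < y → z < x := by
      rw [Filter.eventually_all_finset]
      intro z _
      by_cases hz : z < y
      · filter_upwards [nhdsWithin_le_nhds (Ioi_mem_nhds hz)] with x hx _ using hx
      · exact Filter.Eventually.of_forall fun _ h => absurd h hz
    obtain ⟨a, ha1, ha2⟩ := (hfin.and self_mem_nhdsWithin).exists
    refine ⟨m a, ?_⟩
    filter_upwards [nhdsWithin_le_nhds (Ioi_mem_nhds ha2), self_mem_nhdsWithin] with x hx hxy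
    refine (hconst a x hx.le fun z hz => ?_).symm
    by_contra hc
    have := ha1 z (by simpa using hc) (hz.2.trans_lt hxy)
    exact absurd hz.1 (not_lt.2 this.le)
  have hright : ∀ y, ∀ᶠ x in nhdsWithin y (Ici y), m x = m y := by
    intro y
    have hcm : ContinuousWithinAt m (Ici y) y := by
      rw [Int.isClosedEmbedding_coe_real.isInducing.continuousWithinAt_iff]
      exact ((h3 y).div_const ε).congr (fun x _ => hmu x) (hmu y)
    exact hcm.eventually (IsOpen.mem_nhds (isOpen_discrete {m y}) rfl)
  choose c hc using hleft
  set D0 := h4.toFinset with hD0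
  set J : ℝ → ℤ := fun y => m y - c y with hJ
  have hJ0 : ∀ y, y ∉ D0 → J y = 0 := by
    intro y hy
    have hcu : ContinuousAt u y := by
      by_contra hc; exact hy (by simpa [hD0] using hc)
    have hcm : ContinuousAt m y := by
      rw [Int.isClosedEmbedding_coe_real.isInducing.continuousAt_iff]
      exact (hcu.div_const ε).congr (Filter.Eventually.of_forall fun x => (hmu x).symm)
    have h5 : ∀ᶠ x in nhds y, m x = m y :=
      hcm.eventually (IsOpen.mem_nhds (isOpen_discrete {m y}) rfl)
    obtain ⟨x, hx1, hx2⟩ := ((hc y).and (nhdsWithin_le_nhds h5)).exists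
    simp only [hJ]; omega
  -- Subtracting all jumps leaves a locally constant function, hence a constant; it vanishes far to
  -- the left because the support is compact.
  set d : ℝ → ℝ := fun x => m x - stepSum D0 (fun y => y) (fun y => (J y : ℝ)) x with hd
  have hloc : IsLocallyConstant d := by
    rw [IsLocallyConstant.iff_eventually_eq]
    intro y
    have hu : nhds y = nhdsWithin y (Iio y) ⊔ nhdsWithin y (Ici y) := by
      rw [← nhdsWithin_union, Iio_union_Ici, nhdsWithin_univ]
    rw [hu, Filter.eventually_sup]
    constructor
    · filter_upwards [hc y, eventually_stepSum_left D0 (fun y => y) (fun y => (J y : ℝ)) y]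
        with x hx1 hx2
      simp only [hd, hx1, hx2, stepSum_eq_left_add D0 (fun y => y) (fun y => (J y : ℝ)) y]
      have : ∑ s ∈ D0 with s = y, (J s : ℝ) = J y := by
        rw [Finset.sum_filter, Finset.sum_ite_eq' D0 y]
        split_ifs with h
        · rfl
        · rw [hJ0 y h]; simp
      rw [this]
      simp only [hJ]; push_cast; ring
    · filter_upwards [hright y, eventually_stepSum_right D0 (fun y => y) (fun y => (J y : ℝ)) y]
        with x hx1 hx2
      simp only [hd, hx1, hx2]
  obtain ⟨R, hR⟩ := h2.isBounded.subset_ball 0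
  have hzero : ∀ x, d x = 0 := by
    intro x
    obtain ⟨M, hM⟩ := D0.finite_toSet.bddBelow
    set z := min (-|R|) (M - 1) with hz
    rw [hloc.apply_eq_of_preconnectedSpace x z]
    have hz1 : u z = 0 := by
      by_contra hne
      have := hR (subset_tsupport u hne)
      rw [Metric.mem_ball, dist_zero_right, Real.norm_eq_abs] at this
      have h1 : z ≤ -|R| := min_le_left _ _
      have h2 := neg_le_abs z
      have h3 := le_abs_self R
      linarith
    have hz2 : stepSum D0 (fun y => y) (fun y => (J y : ℝ)) z = 0 := by
      rw [stepSum, Finset.filter_false_of_mem, Finset.sum_empty]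
      intro y hy
      have h1 : z ≤ M - 1 := min_le_right _ _
      have h2 := hM hy
      linarith
    simp only [hd, hz2, hmu, hz1]
    simp
  refine ⟨D0.filter fun y => J y ≠ 0, J, fun y hy => (Finset.mem_filter.1 hy).2, ?_⟩
  ext x
  have := hzero x
  simp only [hd] at this
  rw [hm x, show (m x : ℝ) = stepSum D0 (fun y => y) (fun y => (J y : ℝ)) x by linarith, stepSum,
    stepSum, Finset.sum_mul, Finset.filter_filter]
  rw [← Finset.sum_filter_add_sum_filter_not (D0.filter fun y => y ≤ x) fun y => J y ≠ 0,
    Finset.filter_filter, Finset.filter_filter]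
  rw [Finset.sum_eq_zero (s := Finset.filter (fun a => a ≤ x ∧ ¬J a ≠ 0) D0), add_zero]
  · refine Finset.sum_congr (Finset.filter_congr fun y _ => by tauto) fun y _ => mul_comm _ _
  · intro y hy
    have := (Finset.mem_filter.1 hy).2.2
    rw [not_not] at this
    simp [this]

theorem stepSum_mono {ι : Type*} (A : Finset ι) (p : ι → ℝ) {c : ι → ℝ} (hc : ∀ s ∈ A, 0 ≤ c s) :
    Monotone (stepSum A p c) := fun _ _ hxy =>
  Finset.sum_le_sum_of_subset_of_nonneg
    (Finset.monotone_filter_right A fun _ _ h => le_trans h hxy)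
    fun s hs _ => hc s (Finset.mem_filter.1 hs).1

theorem abs_stepSum_sub_le {ι : Type*} (A : Finset ι) (p c : ι → ℝ) {x y : ℝ} (hxy : x ≤ y) :
    |stepSum A p c y - stepSum A p c x| ≤
      stepSum A p (fun s => |c s|) y - stepSum A p (fun s => |c s|) x := by
  classical
  have h (c : ι → ℝ) : stepSum A p c y - stepSum A p c x =
      ∑ s ∈ (A.filter fun s => p s ≤ y) \ (A.filter fun s => p s ≤ x), c s := by
    rw [stepSum, stepSum, ← Finset.sum_sdiff (Finset.monotone_filter_right A
      fun s _ h => le_trans h hxy), add_sub_cancel_right]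
  rw [h, h]
  exact Finset.abs_sum_le_sum_abs _ _

theorem eVariationOn_stepSum_le {ι : Type*} (A : Finset ι) (p c : ι → ℝ) (s : Set ℝ) (M : ℝ)
    (hM : ∀ x ∈ s, stepSum A p (fun s => |c s|) x ≤ M) :
    eVariationOn (stepSum A p c) s ≤ ENNReal.ofReal M := by
  set V := stepSum A p fun s => |c s| with hV
  have hmono : Monotone V := stepSum_mono A p fun s _ => abs_nonneg _
  refine iSup_le fun ⟨n, q, hq, hqs⟩ => ?_
  simp only
  have h1 : ∀ i ∈ Finset.range n, edist (stepSum A p c (q (i + 1))) (stepSum A p c (q i)) ≤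
      ENNReal.ofReal (V (q (i + 1)) - V (q i)) := by
    intro i _
    rw [edist_dist, Real.dist_eq]
    exact ENNReal.ofReal_le_ofReal (abs_stepSum_sub_le A p c (hq (Nat.le_succ i)))
  refine (Finset.sum_le_sum h1).trans ?_
  rw [← ENNReal.ofReal_sum_of_nonneg fun i _ => sub_nonneg.2 (hmono (hq (Nat.le_succ i))),
    Finset.sum_range_sub fun i => V (q i)]
  refine ENNReal.ofReal_le_ofReal ?_
  have h2 := hM _ (hqs n)
  have h3 : 0 ≤ V (q 0) := Finset.sum_nonneg fun s _ => abs_nonneg _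
  linarith

/-- Induction on the number of jumps in `(-∞, x]`: the last jump `y` contributes `|c y|` on a short
interval `[a, y]` without other jumps, and the rest is the variation on `(-∞, a]`. -/
theorem le_eVariationOn_stepSum (D : Finset ℝ) (c : ℝ → ℝ) (x : ℝ) :
    ENNReal.ofReal (stepSum D (fun y => y) (fun y => |c y|) x) ≤
      eVariationOn (stepSum D (fun y => y) c) (Iic x) := by
  classical
  obtain ⟨n, hn⟩ : ∃ n, (D.filter fun y => y ≤ x).card = n := ⟨_, rfl⟩
  induction n using Nat.strong_induction_on generalizing x with
  | _ n ih =>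
  rcases (D.filter fun y => y ≤ x).eq_empty_or_nonempty with h | h
  · simp [stepSum, h]
  obtain ⟨y, hy, hmax⟩ := Finset.exists_max_image _ (fun y => y) h
  rw [Finset.mem_filter] at hy
  have hVy : stepSum D (fun y => y) (fun y => |c y|) x =
      stepSum D (fun y => y) (fun y => |c y|) y := by
    refine Finset.sum_congr (Finset.filter_congr fun z hz => ⟨fun h => ?_, fun h => h.trans hy.2⟩)
      fun _ _ => rfl
    exact hmax z (Finset.mem_filter.2 ⟨hz, h⟩)
  have e1 := eventually_stepSum_left D (fun y => y) (fun y => |c y|) y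
  have e2 := eventually_stepSum_left D (fun y => y) c y
  obtain ⟨a, ⟨ha1, ha2⟩, hay⟩ := ((e1.and e2).and self_mem_nhdsWithin).exists
  replace hay : a < y := hay
  have hcard : (D.filter fun z => z ≤ a).card < n := by
    rw [← hn]
    refine Finset.card_lt_card (Finset.ssubset_iff_subset_ne.2 ⟨?_, fun h => ?_⟩)
    · exact Finset.monotone_filter_right D fun z _ h => h.trans (hay.le.trans hy.2)
    · have : y ∈ D.filter fun z => z ≤ a := by rw [h]; exact Finset.mem_filter.2 hy
      exact absurd (Finset.mem_filter.1 this).2 (not_le.2 hay)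
  have h1 := ih _ hcard a rfl
  have hs (c : ℝ → ℝ) : ∑ z ∈ D with z = y, c z = c y := by
    rw [Finset.sum_filter, Finset.sum_ite_eq' D y, if_pos hy.1]
  have hu : edist (stepSum D (fun y => y) c a) (stepSum D (fun y => y) c y) =
      ENNReal.ofReal |c y| := by
    rw [edist_dist, Real.dist_eq, stepSum_eq_left_add D _ c y, ha2, hs]
    simp
  rw [hVy, stepSum_eq_left_add D (fun y => y) (fun y => |c y|) y, hs fun y => |c y|,
    ENNReal.ofReal_add (Finset.sum_nonneg fun _ _ => abs_nonneg _) (abs_nonneg _), ← ha1, ← hu]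
  refine (add_le_add h1 (eVariationOn.edist_le _ (s := Icc a y) ⟨le_rfl, hay.le⟩
    ⟨hay.le, le_rfl⟩)).trans ?_
  refine (eVariationOn.add_le_union _ fun z hz z' hz' => ?_).trans (eVariationOn.mono _ ?_)
  · exact le_trans hz hz'.1
  · rintro z (hz | hz)
    · exact le_trans hz (hay.le.trans hy.2)
    · exact hz.2.trans hy.2

theorem eVariationOn_stepSum_Iic (D : Finset ℝ) (c : ℝ → ℝ) (x : ℝ) :
    eVariationOn (stepSum D (fun y => y) c) (Iic x) =
      ENNReal.ofReal (stepSum D (fun y => y) (fun y => |c y|) x) :=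
  le_antisymm (eVariationOn_stepSum_le D _ c _ _ fun _ hy =>
    stepSum_mono D _ (fun _ _ => abs_nonneg _) hy) (le_eVariationOn_stepSum D c x)

theorem eVariationOn_stepSum_univ (D : Finset ℝ) (c : ℝ → ℝ) :
    eVariationOn (stepSum D (fun y => y) c) univ = ENNReal.ofReal (∑ y ∈ D, |c y|) := by
  refine le_antisymm (eVariationOn_stepSum_le D _ c _ _ fun x _ => ?_) ?_
  · exact Finset.sum_le_sum_of_subset_of_nonneg (Finset.filter_subset _ _)
      fun _ _ _ => abs_nonneg _
  · obtain ⟨M, hM⟩ := D.finite_toSet.bddAbove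
    refine le_trans ?_ (eVariationOn.mono _ (subset_univ (Iic M)))
    rw [eVariationOn_stepSum_Iic, stepSum, Finset.filter_true_of_mem]
    exact fun y hy => hM hy

/-! ### Waves of the initial datum -/

namespace WavefrontSolution

variable {f : ℝ → ℝ → ℝ} {ε : ℝ} (S : WavefrontSolution f ε)

/-- The waves which have not been removed at time `t k`. -/
def alive (k : ℕ) : Finset ℕ := S.waves.filter fun s => S.pos k s ≠ ⊤

/-- The position at time `t k` of a wave which has not been removed. -/
def px (k s : ℕ) : ℝ := (S.pos k s).untopD 0

/-- The waves at time `t k` compose the profile `w (t k)`. -/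
structure WaveProfile (k : ℕ) : Prop where
  mono : ∀ s ∈ S.alive k, ∀ s' ∈ S.alive k, s < s' → S.px k s ≤ S.px k s'
  w_eq : S.w (S.t k) = stepSum (S.alive k) (S.px k) fun s => ε * S.sgn s
  what_eq : ∀ s ∈ S.alive k, S.what s = ε * ∑ p ∈ S.alive k with p ≤ s, S.sgn p
  sgn_eq : ∀ s ∈ S.alive k, ∀ s' ∈ S.alive k, S.px k s = S.px k s' → S.sgn s = S.sgn s'

theorem alive_zero : S.alive 0 = S.waves := by
  rw [alive, Finset.filter_true_of_mem]
  intro s _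
  simp [pos]

theorem px_zero (s : ℕ) : S.px 0 s = S.x0 s := by simp [px, pos]

/-- Description of the initial waves: a wave `s` starts from a jump `y` of the initial datum, and
the number of elementary jumps in `(-∞, y)` and `(-∞, y]` is less than `s` and at least `s`,
respectively. -/
theorem exists_initial_jumps (hε : 0 < ε) : ∃ (D : Finset ℝ) (J : ℝ → ℤ),
    S.w 0 = stepSum D (fun y => y) (fun y => ε * J y) ∧
    S.waves = Finset.Icc 1 (∑ y ∈ D, (J y).natAbs) ∧
    ∀ s ∈ S.waves, S.x0 s ∈ D ∧
      ∑ y ∈ D with y < S.x0 s, (J y).natAbs < s ∧ s ≤ ∑ y ∈ D with y ≤ S.x0 s, (J y).natAbs ∧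
      S.sgn s = Real.sign (J (S.x0 s)) ∧ J (S.x0 s) ≠ 0 ∧
      S.what s = ε * (∑ y ∈ D with y < S.x0 s, (J y : ℝ) +
        S.sgn s * (s - (∑ y ∈ D with y < S.x0 s, (J y).natAbs : ℕ))) := by
  classical
  obtain ⟨D, J, hJ, hw⟩ := S.w_init.exists_jumps hε
  have habs (y : ℝ) : |ε * (J y : ℝ)| = ε * ((J y).natAbs : ℕ) := by
    rw [abs_mul, abs_of_pos hε, Nat.cast_natAbs, Int.cast_abs]
  have hvar : S.variation0 = stepSum D (fun y => y) fun y => ε * ((J y).natAbs : ℕ) := by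
    ext x
    rw [variation0, hw, eVariationOn_stepSum_Iic, stepSum, ENNReal.toReal_ofReal
      (Finset.sum_nonneg fun _ _ => abs_nonneg _)]
    simp only [habs, stepSum]
  have hvar' (x : ℝ) : S.variation0 x = ε * (∑ y ∈ D with y ≤ x, (J y).natAbs : ℕ) := by
    rw [hvar, stepSum, Nat.cast_sum, Finset.mul_sum]
  have hwaves : S.waves = Finset.Icc 1 (∑ y ∈ D, (J y).natAbs) := by
    rw [waves, hw, eVariationOn_stepSum_univ, ENNReal.toReal_ofReal
      (Finset.sum_nonneg fun _ _ => abs_nonneg _)]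
    simp only [habs]
    rw [← Finset.mul_sum, mul_div_cancel_left₀ _ hε.ne', ← Nat.cast_sum, Nat.floor_natCast]
  refine ⟨D, J, hw, hwaves, fun s hs => ?_⟩
  rw [hwaves, Finset.mem_Icc] at hs
  have hne : (D.filter fun y => s ≤ ∑ z ∈ D with z ≤ y, (J z).natAbs).Nonempty := by
    have hD : D.Nonempty := by
      rw [Finset.nonempty_iff_ne_empty]
      rintro rfl
      simp at hs; omega
    refine ⟨D.max' hD, Finset.mem_filter.2 ⟨D.max'_mem hD, ?_⟩⟩
    rw [Finset.filter_true_of_mem fun z hz => D.le_max' z hz]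
    exact hs.2
  obtain ⟨y, hy, hmin⟩ := Finset.exists_min_image _ (fun y => y) hne
  rw [Finset.mem_filter] at hy
  have hNmono : ∀ x x' : ℝ, x ≤ x' → ∑ z ∈ D with z ≤ x, (J z).natAbs ≤
      ∑ z ∈ D with z ≤ x', (J z).natAbs := fun x x' h =>
    Finset.sum_le_sum_of_subset (Finset.monotone_filter_right D fun z _ hz => le_trans hz h)
  -- The minimality of `y`, in a form serving twice: an initial segment of `D` carrying at least `s`
  -- elementary jumps contains `y`. With `z ≤ x` it gives `x0 s = y`, with `z < y` the strict lower
  -- bound for `s`.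
  have hlast : ∀ (P : Finset ℝ), P ⊆ D → P.Nonempty → (∀ z ∈ P, ∀ z' ∈ D, z' ≤ z → z' ∈ P) →
      s ≤ ∑ z ∈ P, (J z).natAbs → y ∈ P := by
    intro P hPD hP hdown hsP
    have hmax := P.max'_mem hP
    have e : (D.filter fun z => z ≤ P.max' hP) = P := by
      ext z
      rw [Finset.mem_filter]
      exact ⟨fun h => hdown _ hmax z h.1 h.2, fun h => ⟨hPD h, P.le_max' z h⟩⟩
    have := hmin (P.max' hP) (Finset.mem_filter.2 ⟨hPD hmax, by rw [e]; exact hsP⟩)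
    exact hdown _ hmax y hy.1 this
  have hx0 : S.x0 s = y := by
    have e : {x | ε * s ≤ S.variation0 x} = Ici y := by
      ext x
      rw [Set.mem_ofPred_eq, hvar', mul_le_mul_iff_right₀ hε, Nat.cast_le, mem_Ici]
      refine ⟨fun h => ?_, fun h => hy.2.trans (hNmono _ _ h)⟩
      have hne : (D.filter fun z => z ≤ x).Nonempty := by
        rw [Finset.nonempty_iff_ne_empty]
        intro h0
        rw [h0] at h
        simp at h; omega
      have := hlast _ (Finset.filter_subset _ D) hne (fun z hz z' hz' hzz => Finset.mem_filter.2
        ⟨hz', hzz.trans (Finset.mem_filter.1 hz).2⟩) h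
      exact (Finset.mem_filter.1 this).2
    rw [x0, e, csInf_Ici]
  have hlt : ∑ z ∈ D with z < y, (J z).natAbs < s := by
    by_contra hc
    rw [not_lt] at hc
    have hne : (D.filter fun z => z < y).Nonempty := by
      rw [Finset.nonempty_iff_ne_empty]
      intro h0
      rw [h0] at hc
      simp at hc; omega
    have := hlast _ (Finset.filter_subset _ D) hne (fun z hz z' hz' hzz => Finset.mem_filter.2
      ⟨hz', hzz.trans_lt (Finset.mem_filter.1 hz).2⟩) hc
    exact lt_irrefl _ (Finset.mem_filter.1 this).2
  have hjump : S.w 0 y - Function.leftLim (S.w 0) y = ε * J y := by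
    rw [hw, leftLim_stepSum, stepSum_eq_left_add, add_sub_cancel_left, Finset.sum_filter,
      Finset.sum_ite_eq' D y, if_pos hy.1]
  have hsgn : S.sgn s = Real.sign (J y) := by
    rw [sgn, hx0, hjump]
    rcases lt_trichotomy (J y : ℝ) 0 with h | h | h
    · rw [Real.sign_of_neg h, Real.sign_of_neg (mul_neg_of_pos_of_neg hε h)]
    · rw [h, mul_zero]
    · rw [Real.sign_of_pos h, Real.sign_of_pos (mul_pos hε h)]
  rw [hx0]
  refine ⟨hy.1, hlt, hy.2, hsgn, hJ y hy.1, ?_⟩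
  rw [what, hx0, hw, leftLim_stepSum, hvar, leftLim_stepSum, Nat.cast_sum, ← Finset.mul_sum,
    ← Finset.mul_sum]
  ring

theorem sgn_cases (hε : 0 < ε) {s : ℕ} (hs : s ∈ S.waves) : S.sgn s = 1 ∨ S.sgn s = -1 := by
  obtain ⟨D, J, -, -, h⟩ := S.exists_initial_jumps hε
  obtain ⟨-, -, -, h1, h2, -⟩ := h s hs
  rw [h1]
  rcases lt_or_gt_of_ne h2 with h | h
  · exact Or.inr (Real.sign_of_neg (by exact_mod_cast h))
  · exact Or.inl (Real.sign_of_pos (by exact_mod_cast h))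

/-- The waves starting at a jump `y` are the consecutive integers between the numbers of elementary
jumps in `(-∞, y)` and in `(-∞, y]`, and they all have the sign of `J y`. Their signs therefore sum
to `J y`, and sums over waves become sums over jumps. -/
theorem waveProfile_zero (hε : 0 < ε) : S.WaveProfile 0 := by
  classical
  obtain ⟨D, J, hw, hwaves, h⟩ := S.exists_initial_jumps hε
  have hmono : ∀ s ∈ S.waves, ∀ s' ∈ S.waves, s < s' → S.x0 s ≤ S.x0 s' := by
    intro s hs s' hs' hss
    by_contra hc
    rw [not_le] at hc
    have h1 := (h s hs).2.1
    have h2 := (h s' hs').2.2.1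
    have : ∑ y ∈ D with y ≤ S.x0 s', (J y).natAbs ≤ ∑ y ∈ D with y < S.x0 s, (J y).natAbs :=
      Finset.sum_le_sum_of_subset (Finset.monotone_filter_right D fun z _ hz => lt_of_le_of_lt hz hc)
    omega
  have hfib : ∀ y ∈ D, ∀ s ∈ S.waves, S.x0 s = y ↔
      ∑ z ∈ D with z < y, (J z).natAbs < s ∧ s ≤ ∑ z ∈ D with z ≤ y, (J z).natAbs := by
    intro y hy s hs
    constructor
    · rintro rfl
      exact ⟨(h s hs).2.1, (h s hs).2.2.1⟩
    · rintro ⟨h1, h2⟩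
      have h3 := (h s hs).2.1
      have h4 := (h s hs).2.2.1
      rcases lt_trichotomy (S.x0 s) y with hlt | heq | hgt
      · have : ∑ z ∈ D with z ≤ S.x0 s, (J z).natAbs ≤ ∑ z ∈ D with z < y, (J z).natAbs :=
          Finset.sum_le_sum_of_subset
            (Finset.monotone_filter_right D fun z _ hz => lt_of_le_of_lt hz hlt)
        omega
      · exact heq
      · have : ∑ z ∈ D with z ≤ y, (J z).natAbs ≤ ∑ z ∈ D with z < S.x0 s, (J z).natAbs :=
          Finset.sum_le_sum_of_subset
            (Finset.monotone_filter_right D fun z _ hz => lt_of_le_of_lt hz hgt)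
        omega
  have hsplit : ∀ y ∈ D, ∑ z ∈ D with z ≤ y, (J z).natAbs =
      ∑ z ∈ D with z < y, (J z).natAbs + (J y).natAbs := by
    intro y hy
    have e : (D.filter fun z => z ≤ y) = insert y (D.filter fun z => z < y) := by
      ext z
      simp only [Finset.mem_filter, Finset.mem_insert, le_iff_lt_or_eq]
      constructor
      · tauto
      · rintro (rfl | h)
        · exact ⟨hy, Or.inr rfl⟩
        · exact ⟨h.1, Or.inl h.2⟩
    rw [e, Finset.sum_insert (by simp), add_comm]
  have hcell : ∀ y ∈ D, ∑ s ∈ S.waves with S.x0 s = y, S.sgn s = J y := by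
    intro y hy
    have e : (S.waves.filter fun s => S.x0 s = y) =
        Finset.Ioc (∑ z ∈ D with z < y, (J z).natAbs) (∑ z ∈ D with z ≤ y, (J z).natAbs) := by
      ext s
      rw [Finset.mem_filter, Finset.mem_Ioc]
      constructor
      · rintro ⟨h1, h2⟩
        exact (hfib y hy s h1).1 h2
      · intro h1
        have hs : s ∈ S.waves := by
          rw [hwaves, Finset.mem_Icc]
          refine ⟨by omega, h1.2.trans (Finset.sum_le_sum_of_subset (Finset.filter_subset _ _))⟩
        exact ⟨hs, (hfib y hy s hs).2 h1⟩
    have e2 : ∀ s ∈ S.waves.filter fun s => S.x0 s = y, S.sgn s = Real.sign (J y) := by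
      intro s hs
      rw [Finset.mem_filter] at hs
      rw [(h s hs.1).2.2.2.1, hs.2]
    rw [Finset.sum_congr rfl e2, Finset.sum_const, e, Nat.card_Ioc, hsplit y hy,
      Nat.add_sub_cancel_left, nsmul_eq_mul, Nat.cast_natAbs, Int.cast_abs]
    rcases lt_trichotomy (J y : ℝ) 0 with h | h | h
    · rw [Real.sign_of_neg h, abs_of_neg h]; ring
    · rw [h]; simp
    · rw [Real.sign_of_pos h, abs_of_pos h]; ring
  have hsum : ∀ P : ℝ → Prop, [DecidablePred P] →
      ∑ s ∈ S.waves with P (S.x0 s), S.sgn s = ∑ y ∈ D with P y, (J y : ℝ) := by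
    intro P _
    rw [← Finset.sum_fiberwise_of_maps_to (t := D.filter P) (g := S.x0)
      (fun s hs => Finset.mem_filter.2
        ⟨(h s (Finset.mem_filter.1 hs).1).1, (Finset.mem_filter.1 hs).2⟩)]
    refine Finset.sum_congr rfl fun y hy => ?_
    rw [Finset.mem_filter] at hy
    rw [← hcell y hy.1, Finset.filter_filter]
    refine Finset.sum_congr (Finset.filter_congr fun s _ => ⟨fun h => h.2, fun h => ⟨?_, h⟩⟩)
      fun _ _ => rfl
    rw [h]; exact hy.2
  refine ⟨?_, ?_, ?_, ?_⟩
  · intro s hs s' hs' hss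
    rw [alive_zero] at hs hs'
    rw [px_zero, px_zero]
    exact hmono s hs s' hs' hss
  · rw [S.t_zero, hw, alive_zero]
    ext x
    rw [stepSum, stepSum, ← Finset.mul_sum, ← Finset.mul_sum]
    simp only [px_zero]
    rw [hsum fun y => y ≤ x]
  · intro s hs
    rw [alive_zero] at hs ⊢
    obtain ⟨h1, h2, h3, h4, h5, h6⟩ := h s hs
    rw [h6, ← hsum fun y => y < S.x0 s]
    congr 1
    have e : (S.waves.filter fun p => p ≤ s) = (S.waves.filter fun p => S.x0 p < S.x0 s) ∪
        Finset.Ioc (∑ z ∈ D with z < S.x0 s, (J z).natAbs) s := by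
      ext p
      rw [Finset.mem_filter, Finset.mem_union, Finset.mem_filter, Finset.mem_Ioc]
      constructor
      · rintro ⟨hp, hps⟩
        have hle : S.x0 p ≤ S.x0 s := by
          rcases hps.eq_or_lt with rfl | h
          · exact le_rfl
          · exact hmono p hp s hs h
        rcases hle.lt_or_eq with hlt | heq
        · exact Or.inl ⟨hp, hlt⟩
        · exact Or.inr ⟨((hfib _ h1 p hp).1 heq).1, hps⟩
      · rintro (⟨hp, hlt⟩ | ⟨h7, h8⟩)
        · refine ⟨hp, ?_⟩
          by_contra hc
          exact absurd hlt (not_lt.2 (hmono s hs p hp (not_le.1 hc)))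
        · refine ⟨?_, h8⟩
          rw [hwaves, Finset.mem_Icc] at hs ⊢
          omega
    have hin : ∀ p ∈ Finset.Ioc (∑ z ∈ D with z < S.x0 s, (J z).natAbs) s,
        p ∈ S.waves ∧ S.x0 p = S.x0 s := by
      intro p hp
      rw [Finset.mem_Ioc] at hp
      have hp' : p ∈ S.waves := by
        rw [hwaves, Finset.mem_Icc] at hs ⊢
        omega
      exact ⟨hp', (hfib _ h1 p hp').2 ⟨hp.1, by omega⟩⟩
    rw [e, Finset.sum_union]
    · congr 1
      rw [Finset.sum_congr rfl fun p hp => show S.sgn p = S.sgn s by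
        rw [sgn, sgn, (hin p hp).2], Finset.sum_const, Nat.card_Ioc, nsmul_eq_mul,
        Nat.cast_sub h2.le]
      ring
    · rw [Finset.disjoint_left]
      intro p hp hp'
      exact absurd (hin p hp').2 (Finset.mem_filter.1 hp).2.ne
  · intro s _ s' _ hss
    rw [px_zero, px_zero] at hss
    rw [sgn, sgn, hss]

/-- The states of a wave are bounded by the bounds of the initial datum. -/
theorem abs_what_le (hε : 0 < ε) {r : ℝ} (hr : ∀ x, |S.w 0 x| ≤ r) {s : ℕ} (hs : s ∈ S.waves) :
    |S.what s| ≤ r ∧ |S.what s - ε * S.sgn s| ≤ r := by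
  classical
  obtain ⟨D, J, hw, hwaves, h⟩ := S.exists_initial_jumps hε
  obtain ⟨h1, h2, h3, h4, h5, h6⟩ := h s hs
  set y := S.x0 s
  have hl : |ε * ∑ y' ∈ D with y' < y, (J y' : ℝ)| ≤ r := by
    obtain ⟨a, ha⟩ := (eventually_stepSum_left D (fun y => y) (fun y => ε * (J y : ℝ)) y).exists
    rw [Finset.mul_sum, ← ha, ← hw]
    exact hr a
  have hr' : |ε * (∑ y' ∈ D with y' < y, (J y' : ℝ) + J y)| ≤ r := by
    have := hr y
    rw [hw, stepSum_eq_left_add, Finset.sum_filter (fun a => a = y), Finset.sum_ite_eq' D y,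
      if_pos h1, ← Finset.mul_sum, ← mul_add] at this
    exact this
  have hsplit : ∑ z ∈ D with z ≤ y, (J z).natAbs =
      ∑ z ∈ D with z < y, (J z).natAbs + (J y).natAbs := by
    have e : (D.filter fun z => z ≤ y) = insert y (D.filter fun z => z < y) := by
      ext z
      simp only [Finset.mem_filter, Finset.mem_insert, le_iff_lt_or_eq]
      constructor
      · tauto
      · rintro (rfl | h)
        · exact ⟨h1, Or.inr rfl⟩
        · exact ⟨h.1, Or.inl h.2⟩
    rw [e, Finset.sum_insert (by simp), add_comm]
  set N := ∑ z ∈ D with z < y, (J z).natAbs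
  rw [hsplit] at h3
  have e1 : (N : ℝ) + 1 ≤ s := by exact_mod_cast h2
  have e2 : (s : ℝ) ≤ N + ((J y).natAbs : ℕ) := by exact_mod_cast h3
  rw [Nat.cast_natAbs, Int.cast_abs] at e2
  rw [h6]
  set W := ∑ y' ∈ D with y' < y, (J y' : ℝ)
  rw [abs_le] at hl hr' ⊢
  rw [abs_le]
  have hsn : S.sgn s = 1 ∧ |(J y : ℝ)| = J y ∨ S.sgn s = -1 ∧ |(J y : ℝ)| = -J y := by
    rw [h4]
    rcases lt_or_gt_of_ne h5 with h | h
    · have h : (J y : ℝ) < 0 := by exact_mod_cast h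
      exact Or.inr ⟨Real.sign_of_neg h, abs_of_neg h⟩
    · have h : 0 < (J y : ℝ) := by exact_mod_cast h
      exact Or.inl ⟨Real.sign_of_pos h, abs_of_pos h⟩
  rcases hsn with ⟨e3, e4⟩ | ⟨e3, e4⟩ <;> rw [e3] <;> rw [e4] at e2 <;>
    refine ⟨⟨?_, ?_⟩, ?_, ?_⟩ <;> nlinarith

/-- A change of the values of `v` reveals a jump. -/
theorem exists_jump_of_v_ne (hε : 0 < ε) {a b : ℝ} (hab : a ≤ b) (hne : S.v 0 a ≠ S.v 0 b) :
    ∃ y ∈ Ioc a b, Function.leftLim (S.v 0) y ≠ S.v 0 y := by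
  classical
  obtain ⟨D, J, hJ, hv⟩ := S.v_init.exists_jumps hε
  by_contra hc
  push Not at hc
  apply hne
  rw [hv]
  refine Finset.sum_congr (Finset.filter_congr fun y hy =>
    ⟨fun h => h.trans hab, fun h => ?_⟩) fun _ _ => rfl
  by_contra hay
  have := hc y ⟨not_le.1 hay, h⟩
  rw [hv, leftLim_stepSum, stepSum_eq_left_add, Finset.sum_filter (fun a => a = y),
    Finset.sum_ite_eq' D y, if_pos hy] at this
  have h1 : ε * (J y : ℝ) ≠ 0 := mul_ne_zero hε.ne' (by exact_mod_cast hJ y hy)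
  apply h1
  linarith

theorem eventually_v_left (hε : 0 < ε) (y : ℝ) :
    ∀ᶠ x in nhdsWithin y (Iio y), S.v 0 x = Function.leftLim (S.v 0) y := by
  obtain ⟨D, J, hJ, hv⟩ := S.v_init.exists_jumps hε
  rw [hv, leftLim_stepSum]
  exact eventually_stepSum_left D _ _ y

end WavefrontSolution

namespace WavefrontSolution

variable {f : ℝ → ℝ → ℝ} {ε : ℝ} (S : WavefrontSolution f ε)

/-! ### Tiles: sets of waves whose segments are consecutive grid cells -/

open Classical in
/-- The sign of a wave as an integer. -/
def isgn (s : ℕ) : ℤ := if 0 < S.sgn s then 1 else -1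

/-- The right state of a wave in units of `ε`. -/
def kap (s : ℕ) : ℤ := ⌊S.what s / ε⌋

theorem isgn_cast (hε : 0 < ε) {s : ℕ} (hs : s ∈ S.waves) : (S.isgn s : ℝ) = S.sgn s := by
  rcases S.sgn_cases hε hs with h | h <;> rw [isgn, h] <;> norm_num

theorem isgn_cases (s : ℕ) : S.isgn s = 1 ∨ S.isgn s = -1 := by
  rw [isgn]; split_ifs <;> simp

theorem mem_alive {k s : ℕ} : s ∈ S.alive k ↔ s ∈ S.waves ∧ S.pos k s ≠ ⊤ := Finset.mem_filter

theorem mem_waves_of_alive {k s : ℕ} (h : s ∈ S.alive k) : s ∈ S.waves := (S.mem_alive.1 h).1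

theorem what_eq_of_profile (hε : 0 < ε) {k : ℕ} (hk : S.WaveProfile k) {s : ℕ}
    (hs : s ∈ S.alive k) : S.what s = (∑ p ∈ S.alive k with p ≤ s, S.isgn p : ℤ) * ε := by
  rw [hk.what_eq s hs, mul_comm, Int.cast_sum]
  congr 1
  exact Finset.sum_congr rfl fun p hp =>
    (S.isgn_cast hε (S.mem_waves_of_alive (Finset.mem_filter.1 hp).1)).symm

theorem kap_eq_of_profile (hε : 0 < ε) {k : ℕ} (hk : S.WaveProfile k) {s : ℕ}
    (hs : s ∈ S.alive k) : S.kap s = ∑ p ∈ S.alive k with p ≤ s, S.isgn p := by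
  rw [kap, S.what_eq_of_profile hε hk hs, mul_div_cancel_right₀ _ hε.ne', Int.floor_intCast]

theorem what_eq_kap (hε : 0 < ε) {s : ℕ} (hs : s ∈ S.waves) : S.what s = S.kap s * ε := by
  have h0 := S.waveProfile_zero hε
  rw [← S.alive_zero] at hs
  rw [S.kap_eq_of_profile hε h0 hs, S.what_eq_of_profile hε h0 hs]

/-- The waves of `D` have sign `σ`, and `σ * kap` is a strictly increasing bijection of `D` onto
the integers of `(m, n]`. -/
structure IsTile (σ : ℤ) (D : Set ℕ) (m n : ℤ) : Prop where
  mem_waves : ∀ s ∈ D, s ∈ S.waves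
  isgn_eq : ∀ s ∈ D, S.isgn s = σ
  mono : StrictMonoOn (fun s => σ * S.kap s) D
  image : (fun s => σ * S.kap s) '' D = Ioc m n
  lt : m < n

/-- `g` is a constant plus the rank in `D`; surjectivity onto the interval is a count of elements.
-/
theorem strictMonoOn_and_image_of_rank (D : Finset ℕ) (g : ℕ → ℤ) (c : ℤ)
    (hg : ∀ s ∈ D, g s = c + (D.filter fun p => p ≤ s).card) :
    StrictMonoOn g D ∧ g '' D = Ioc c (c + D.card) := by
  have hmono : StrictMonoOn g D := by
    intro s hs s' hs' hss
    rw [hg s hs, hg s' hs']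
    have : (D.filter fun p => p ≤ s).card < (D.filter fun p => p ≤ s').card := by
      refine Finset.card_lt_card (Finset.ssubset_iff_subset_ne.2 ⟨?_, fun h => ?_⟩)
      · exact Finset.monotone_filter_right D fun p _ hp => le_trans hp hss.le
      · have h1 : s' ∈ D.filter fun p => p ≤ s := by
          rw [h]; exact Finset.mem_filter.2 ⟨hs', le_rfl⟩
        exact absurd (Finset.mem_filter.1 h1).2 (not_le.2 hss)
    omega
  refine ⟨hmono, ?_⟩
  have hsub : D.image g ⊆ Finset.Ioc c (c + D.card) := by
    intro i hi
    obtain ⟨s, hs, rfl⟩ := Finset.mem_image.1 hi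
    rw [Finset.mem_Ioc, hg s hs]
    have h1 : 0 < (D.filter fun p => p ≤ s).card :=
      Finset.card_pos.2 ⟨s, Finset.mem_filter.2 ⟨hs, le_rfl⟩⟩
    have h2 := Finset.card_filter_le D fun p => p ≤ s
    omega
  have h := Finset.eq_of_subset_of_card_le hsub (by
    rw [Int.card_Ioc, Finset.card_image_of_injOn hmono.injOn]; omega)
  rw [← Finset.coe_image, h, Finset.coe_Ioc]

/-- The waves of a homogeneous interval of waves form a tile. -/
theorem exists_isTile (hε : 0 < ε) {k : ℕ} (hk : S.WaveProfile k) {σ : ℤ} (hσ : σ = 1 ∨ σ = -1)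
    {D : Finset ℕ} (hD : D ⊆ S.alive k) (hne : D.Nonempty) (hsgn : ∀ s ∈ D, S.isgn s = σ)
    (hconv : ∀ a ∈ D, ∀ b ∈ D, ∀ q ∈ S.alive k, a ≤ q → q ≤ b → q ∈ D) :
    ∃ m n, S.IsTile σ D m n ∧ n = m + D.card ∧
      m = σ * ∑ p ∈ S.alive k with ∀ d ∈ D, p < d, S.isgn p := by
  classical
  set c := ∑ p ∈ S.alive k with ∀ d ∈ D, p < d, S.isgn p with hc
  have hσ2 : σ * σ = 1 := by rcases hσ with rfl | rfl <;> norm_num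
  have hg : ∀ s ∈ D, σ * S.kap s = σ * c + (D.filter fun p => p ≤ s).card := by
    intro s hs
    rw [S.kap_eq_of_profile hε hk (hD hs)]
    -- The waves up to `s` are those preceding all of `D` and those of `D` up to `s`. So `kap s` is
    -- `c` plus `σ` times the rank of `s`; multiplying by `σ` makes it increasing for both signs.
    have e : (S.alive k).filter (fun p => p ≤ s) =
        ((S.alive k).filter fun p => ∀ d ∈ D, p < d) ∪ D.filter fun p => p ≤ s := by
      ext p
      simp only [Finset.mem_filter, Finset.mem_union]
      constructor
      · rintro ⟨hp, hps⟩
        by_cases h : ∀ d ∈ D, p < d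
        · exact Or.inl ⟨hp, h⟩
        · push Not at h
          obtain ⟨d, hd, hdp⟩ := h
          exact Or.inr ⟨hconv d hd s hs p hp hdp hps, hps⟩
      · rintro (⟨hp, h⟩ | ⟨hp, h⟩)
        · exact ⟨hp, (h s hs).le⟩
        · exact ⟨hD hp, h⟩
    rw [e, Finset.sum_union, mul_add]
    · congr 1
      rw [Finset.sum_congr rfl fun p hp => hsgn p (Finset.mem_filter.1 hp).1, Finset.sum_const,
        nsmul_eq_mul, mul_left_comm, hσ2, mul_one]
    · rw [Finset.disjoint_left]
      intro p hp hp'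
      exact lt_irrefl p ((Finset.mem_filter.1 hp).2 p (Finset.mem_filter.1 hp').1)
  obtain ⟨h1, h2⟩ := strictMonoOn_and_image_of_rank D _ _ hg
  have := hne.card_pos
  exact ⟨σ * c, σ * c + D.card,
    ⟨fun s hs => S.mem_waves_of_alive (hD hs), hsgn, h1, h2, by omega⟩, rfl, rfl⟩

section
variable {S}
variable {D : Set ℕ} {m n : ℤ}

theorem IsTile.sgn_eq {σ : ℤ} (h : S.IsTile σ D m n) (hε : 0 < ε) {s : ℕ} (hs : s ∈ D) :
    S.sgn s = σ := by
  rw [← S.isgn_cast hε (h.mem_waves s hs), h.isgn_eq s hs]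

theorem IsTile.mem_Ioc {σ : ℤ} (h : S.IsTile σ D m n) {s : ℕ} (hs : s ∈ D) :
    m < σ * S.kap s ∧ σ * S.kap s ≤ n := by
  have : σ * S.kap s ∈ Ioc m n := by rw [← h.image]; exact ⟨s, hs, rfl⟩
  exact this

theorem IsTile.exists_mem {σ : ℤ} (h : S.IsTile σ D m n) {i : ℤ} (h1 : m < i) (h2 : i ≤ n) :
    ∃ s ∈ D, σ * S.kap s = i := by
  have : i ∈ (fun s => σ * S.kap s) '' D := by rw [h.image]; exact ⟨h1, h2⟩
  exact this

theorem IsTile.finite {σ : ℤ} (h : S.IsTile σ D m n) : D.Finite :=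
  S.waves.finite_toSet.subset h.mem_waves

theorem iUnion_Ioc_cells (hε : 0 < ε) (m n : ℤ) :
    ⋃ i ∈ Ioc m n, Ioc ((i : ℝ) * ε - ε) (i * ε) = Ioc ((m : ℝ) * ε) (n * ε) := by
  ext u
  simp only [mem_iUnion, exists_prop, mem_Ioc]
  constructor
  · rintro ⟨i, ⟨h1, h2⟩, h3, h4⟩
    have e1 : (m : ℝ) + 1 ≤ i := by exact_mod_cast h1
    have e2 : (i : ℝ) ≤ n := by exact_mod_cast h2
    constructor <;> nlinarith
  · rintro ⟨h1, h2⟩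
    refine ⟨⌈u / ε⌉, ⟨Int.lt_ceil.2 ((lt_div_iff₀ hε).2 h1), Int.ceil_le.2
      ((div_le_iff₀ hε).2 h2)⟩, ?_, ?_⟩
    · have := Int.ceil_lt_add_one (u / ε)
      have := mul_lt_mul_of_pos_right this hε
      rw [add_mul, div_mul_cancel₀ _ hε.ne'] at this
      linarith
    · rw [← div_le_iff₀ hε]; exact Int.le_ceil _

theorem iUnion_Ico_cells (hε : 0 < ε) (m n : ℤ) :
    ⋃ i ∈ Ioc m n, Ico ((-i : ℝ) * ε) (-i * ε + ε) = Ico ((-n : ℝ) * ε) (-m * ε) := by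
  have h := iUnion_Ioc_cells hε m n
  ext u
  have hu := Set.ext_iff.1 h (-u)
  simp only [mem_iUnion, exists_prop, mem_Ioc, mem_Ico] at hu ⊢
  constructor
  · rintro ⟨i, hi, h3, h4⟩
    have := hu.1 ⟨i, hi, by linarith, by linarith⟩
    constructor <;> linarith
  · rintro ⟨h3, h4⟩
    obtain ⟨i, hi, h5, h6⟩ := hu.2 ⟨by linarith, by linarith⟩
    exact ⟨i, hi, by linarith, by linarith⟩

theorem IsTile.seg_eq (h : S.IsTile 1 D m n) (hε : 0 < ε) {s : ℕ} (hs : s ∈ D) :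
    S.seg s = Ioc ((S.kap s : ℝ) * ε - ε) (S.kap s * ε) := by
  rw [seg, if_pos (by rw [h.sgn_eq hε hs]; norm_num), S.what_eq_kap hε (h.mem_waves s hs)]

theorem IsTile.span_pos (h : S.IsTile 1 D m n) (hε : 0 < ε) :
    S.span D = Ioc ((m : ℝ) * ε) (n * ε) := by
  rw [← iUnion_Ioc_cells hε, ← h.image, biUnion_image, span]
  refine iUnion₂_congr fun s hs => ?_
  rw [h.seg_eq hε hs, one_mul]

theorem IsTile.span_neg (h : S.IsTile (-1) D m n) (hε : 0 < ε) :
    S.span D = Ico ((-n : ℝ) * ε) (-m * ε) := by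
  rw [← iUnion_Ico_cells hε, ← h.image, biUnion_image, span]
  refine iUnion₂_congr fun s hs => ?_
  rw [seg, if_neg (by rw [h.sgn_eq hε hs]; norm_num), S.what_eq_kap hε (h.mem_waves s hs)]
  push_cast
  simp only [neg_mul, one_mul, neg_neg]

theorem IsTile.bounds_lt {σ : ℤ} (h : S.IsTile σ D m n) (hε : 0 < ε) : (m : ℝ) * ε < n * ε :=
  mul_lt_mul_of_pos_right (by exact_mod_cast h.lt) hε

theorem IsTile.rhSpeed_eq (h : S.IsTile 1 D m n) (hε : 0 < ε) (g : ℝ → ℝ) :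
    rhSpeed g (S.span D) = (g (n * ε) - g (m * ε)) / (n * ε - m * ε) := by
  rw [rhSpeed, h.span_pos hε, csSup_Ioc (h.bounds_lt hε), csInf_Ioc (h.bounds_lt hε)]

theorem IsTile.entSpeed_pos (h : S.IsTile 1 D m n) (hε : 0 < ε) (g : ℝ → ℝ) {s : ℕ} (hs : s ∈ D) :
    S.entSpeed g D s = envSlope ε g m n (S.kap s) := by
  rw [entSpeed, if_pos (by rw [h.sgn_eq hε hs]; norm_num), h.span_pos hε,
    csSup_Ioc (h.bounds_lt hε), csInf_Ioc (h.bounds_lt hε), S.what_eq_kap hε (h.mem_waves s hs),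
    envSlope]

theorem IsTile.entSpeed_neg (h : S.IsTile (-1) D m n) (hε : 0 < ε) (g : ℝ → ℝ) {s : ℕ}
    (hs : s ∈ D) : S.entSpeed g D s = -envSlope ε (-g) (-n) (-m) (S.kap s + 1) := by
  have hlt : (-n : ℝ) * ε < -m * ε := by linarith [h.bounds_lt hε]
  rw [entSpeed, if_neg (by rw [h.sgn_eq hε hs]; norm_num), h.span_neg hε,
    csSup_Ico hlt, csInf_Ico hlt, S.what_eq_kap hε (h.mem_waves s hs), ← deriv_concEnv_interp]
  push_cast
  rfl

theorem IsTile.entSpeed_mono {σ : ℤ} (hσ : σ = 1 ∨ σ = -1) (h : S.IsTile σ D m n) (hε : 0 < ε)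
    (g : ℝ → ℝ) {s s' : ℕ} (hs : s ∈ D) (hs' : s' ∈ D) (hss : s ≤ s') :
    S.entSpeed g D s ≤ S.entSpeed g D s' := by
  have h1 := h.mem_Ioc hs
  have h2 := h.mem_Ioc hs'
  have h3 := h.mono.monotoneOn hs hs' hss
  rcases hσ with rfl | rfl
  · rw [h.entSpeed_pos hε g hs, h.entSpeed_pos hε g hs']
    exact envSlope_mono hε g (by omega) (by omega) (by omega)
  · rw [h.entSpeed_neg hε g hs, h.entSpeed_neg hε g hs', neg_le_neg_iff]
    exact envSlope_mono hε (-g) (by omega) (by omega) (by omega)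

/-- The cells of the Riemann problem composed of the waves of a tile. -/
theorem IsTile.cells_eq {σ : ℤ} (hσ : σ = 1 ∨ σ = -1) (h : S.IsTile σ D m n) (hε : 0 < ε) :
    cells ε ((σ * m : ℤ) * ε) ((σ * n : ℤ) * ε) = S.kap '' D := by
  ext i
  simp only [cells, Set.mem_ofPred_eq, mul_lt_mul_iff_left₀ hε, mul_le_mul_iff_left₀ hε,
    Int.cast_lt, Int.cast_le]
  have hlt := h.lt
  constructor
  · intro hi
    obtain ⟨s, hs, hsi⟩ := h.exists_mem (i := σ * i) (by rcases hσ with rfl | rfl <;> omega)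
      (by rcases hσ with rfl | rfl <;> omega)
    exact ⟨s, hs, by rcases hσ with rfl | rfl <;> omega⟩
  · rintro ⟨s, hs, rfl⟩
    have := h.mem_Ioc hs
    rcases hσ with rfl | rfl <;> omega

theorem IsTile.cellSpeed_eq {σ : ℤ} (hσ : σ = 1 ∨ σ = -1) (h : S.IsTile σ D m n) (hε : 0 < ε)
    (g : ℝ → ℝ) {s : ℕ} (hs : s ∈ D) :
    cellSpeed ε g ((σ * m : ℤ) * ε) ((σ * n : ℤ) * ε) (S.kap s) = S.entSpeed g D s := by
  have hlt := h.bounds_lt hε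
  rcases hσ with rfl | rfl
  · rw [h.entSpeed_pos hε g hs, cellSpeed, one_mul, one_mul, if_pos hlt, envSlope]
  · rw [h.entSpeed_neg hε g hs, cellSpeed, ← deriv_concEnv_interp, if_neg]
    · simp only [neg_mul, one_mul]
    · push_cast; linarith

theorem IsTile.sign_eq {σ : ℤ} (hσ : σ = 1 ∨ σ = -1) (h : S.IsTile σ D m n) (hε : 0 < ε) :
    Real.sign ((σ * n : ℤ) * ε - (σ * m : ℤ) * ε) = σ := by
  have hlt := h.bounds_lt hε
  rcases hσ with rfl | rfl
  · rw [Real.sign_of_pos (by push_cast; linarith)]; norm_num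
  · rw [Real.sign_of_neg (by push_cast; linarith)]; norm_num

end

end WavefrontSolution

namespace WavefrontSolution

variable {f : ℝ → ℝ → ℝ} {ε : ℝ} (S : WavefrontSolution f ε)

/-! ### Waves at a point and Riemann problems -/

/-- The waves at the point `y` at time `t k`. -/
def wavesAt (k : ℕ) (y : ℝ) : Finset ℕ := (S.alive k).filter fun s => S.px k s = y

theorem mem_wavesAt {k s : ℕ} {y : ℝ} : s ∈ S.wavesAt k y ↔ s ∈ S.alive k ∧ S.px k s = y :=
  Finset.mem_filter

theorem pos_eq_px {k s : ℕ} (h : s ∈ S.alive k) : S.pos k s = (S.px k s : WithTop ℝ) := by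
  obtain ⟨a, ha⟩ := WithTop.ne_top_iff_exists.1 (S.mem_alive.1 h).2
  rw [px, ← ha]; rfl

theorem speed_eq_entSpeed {k s : ℕ} (h : s ∈ S.alive k) :
    S.speed k s = S.entSpeed (fun u => f u (S.v (S.t k) (S.px k s))) (S.wavesAt k (S.px k s)) s := by
  rw [speed, speedOf]
  congr 1
  ext p
  rw [Set.mem_ofPred_eq, Finset.mem_coe, mem_wavesAt, mem_alive, S.pos_eq_px h]
  constructor
  · rintro ⟨h1, h2⟩
    refine ⟨⟨h1, by rw [h2]; exact WithTop.coe_ne_top⟩, ?_⟩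
    rw [px, h2]; rfl
  · rintro ⟨h1, h2⟩
    exact ⟨h1.1, by rw [S.pos_eq_px (S.mem_alive.2 h1), h2]⟩

variable {S}

/-- The waves at a point form a tile whose end points are the left and right states of `w`. -/
theorem WaveProfile.exists_isTile_wavesAt (hε : 0 < ε) {k : ℕ} (hk : S.WaveProfile k) {y : ℝ}
    (hne : (S.wavesAt k y).Nonempty) : ∃ (σ m n : ℤ), (σ = 1 ∨ σ = -1) ∧
      S.IsTile σ (S.wavesAt k y) m n ∧
      Function.leftLim (S.w (S.t k)) y = (σ * m : ℤ) * ε ∧ S.w (S.t k) y = (σ * n : ℤ) * ε := by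
  obtain ⟨s₀, hs₀⟩ := hne
  have hs₀' := S.mem_wavesAt.1 hs₀
  have hσ := S.isgn_cases s₀
  have hσ2 : S.isgn s₀ * S.isgn s₀ = 1 := by rcases hσ with h | h <;> rw [h] <;> norm_num
  have hsgn : ∀ s ∈ S.wavesAt k y, S.isgn s = S.isgn s₀ := by
    intro s hs
    have hs' := S.mem_wavesAt.1 hs
    rw [isgn, isgn, hk.sgn_eq s hs'.1 s₀ hs₀'.1 (hs'.2.trans hs₀'.2.symm)]
  obtain ⟨m, n, hT, hn, hm⟩ := S.exists_isTile hε hk hσ (D := S.wavesAt k y)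
    (Finset.filter_subset _ _) ⟨s₀, hs₀⟩ hsgn (by
      intro a ha b hb q hq haq hqb
      rw [mem_wavesAt] at ha hb ⊢
      refine ⟨hq, le_antisymm ?_ ?_⟩
      · rcases hqb.eq_or_lt with rfl | h
        · exact hb.2.le
        · exact (hk.mono q hq b hb.1 h).trans hb.2.le
      · rcases haq.eq_or_lt with rfl | h
        · exact ha.2.ge
        · exact ha.2.ge.trans (hk.mono a ha.1 q hq h))
  have hbelow : ((S.alive k).filter fun p => ∀ d ∈ S.wavesAt k y, p < d) =
      (S.alive k).filter fun p => S.px k p < y := by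
    refine Finset.filter_congr fun p hp => ⟨fun h => ?_, fun h d hd => ?_⟩
    · refine lt_of_le_of_ne ((hk.mono p hp s₀ hs₀'.1 (h s₀ hs₀)).trans hs₀'.2.le) fun heq => ?_
      exact lt_irrefl p (h p (S.mem_wavesAt.2 ⟨hp, heq⟩))
    · rw [mem_wavesAt] at hd
      by_contra hc
      rcases (not_lt.1 hc).eq_or_lt with rfl | h'
      · exact h.ne hd.2
      · exact absurd (hd.2 ▸ hk.mono d hd.1 p hp h') (not_le.2 h)
  have hsum : ∀ P : ℕ → Prop, [DecidablePred P] → ∑ s ∈ S.alive k with P s, ε * S.sgn s =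
      (∑ s ∈ S.alive k with P s, S.isgn s : ℤ) * ε := by
    intro P _
    rw [← Finset.mul_sum, mul_comm, Int.cast_sum]
    congr 1
    exact Finset.sum_congr rfl fun p hp =>
      (S.isgn_cast hε (S.mem_waves_of_alive (Finset.mem_filter.1 hp).1)).symm
  rw [hbelow] at hm
  refine ⟨S.isgn s₀, m, n, hσ, hT, ?_, ?_⟩
  · rw [hk.w_eq, leftLim_stepSum, hsum, hm, ← mul_assoc, hσ2, one_mul]
  · rw [hk.w_eq, stepSum_eq_left_add, hsum, hsum, hn, hm, mul_add, ← mul_assoc, hσ2, one_mul]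
    change _ + ((∑ s ∈ S.wavesAt k y, S.isgn s : ℤ) : ℝ) * ε = _
    rw [Finset.sum_congr rfl hsgn, Finset.sum_const, nsmul_eq_mul]
    push_cast; ring

theorem WaveProfile.leftLim_eq_of_empty {k : ℕ} (hk : S.WaveProfile k) {y : ℝ}
    (hne : ¬ (S.wavesAt k y).Nonempty) : Function.leftLim (S.w (S.t k)) y = S.w (S.t k) y := by
  rw [Finset.not_nonempty_iff_eq_empty, wavesAt] at hne
  rw [hk.w_eq, leftLim_stepSum, stepSum_eq_left_add, hne, Finset.sum_empty, add_zero]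

/-- With `exists_wave`, this lets the conditions on fronts in `no_collision` and `collision` be read
as statements about waves. -/
theorem WaveProfile.front_mem (hε : 0 < ε) {k : ℕ} (hk : S.WaveProfile k) {s : ℕ}
    (hs : s ∈ S.alive k) : (⟨.second, S.px k s, S.speed k s⟩ : Front) ∈ S.fronts k := by
  have hs' : s ∈ S.wavesAt k (S.px k s) := S.mem_wavesAt.2 ⟨hs, rfl⟩
  obtain ⟨σ, m, n, hσ, hT, h1, h2⟩ := hk.exists_isTile_wavesAt hε ⟨s, hs'⟩
  change ∃ i ∈ cells ε (Function.leftLim (S.w (S.t k)) (S.px k s)) (S.w (S.t k) (S.px k s)), _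
  rw [h1, h2, hT.cells_eq hσ hε]
  refine ⟨_, ⟨s, hs', rfl⟩, ?_⟩
  simp only
  rw [hT.cellSpeed_eq hσ hε _ hs', ← S.speed_eq_entSpeed hs]

theorem WaveProfile.exists_wave (hε : 0 < ε) {k : ℕ} (hk : S.WaveProfile k) {a : Front}
    (ha : a ∈ S.fronts k) (ha2 : a.family = Family.second) :
    ∃ s ∈ S.alive k, S.px k s = a.start ∧ S.speed k s = a.speed := by
  obtain ⟨fam, y, c⟩ := a
  simp only at ha2
  subst ha2
  change ∃ i ∈ cells ε (Function.leftLim (S.w (S.t k)) y) (S.w (S.t k) y), _ at ha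
  by_cases hne : (S.wavesAt k y).Nonempty
  · obtain ⟨σ, m, n, hσ, hT, h1, h2⟩ := hk.exists_isTile_wavesAt hε hne
    simp only [h1, h2, hT.cells_eq hσ hε] at ha
    obtain ⟨_, ⟨s, hs, rfl⟩, hc⟩ := ha
    rw [hT.cellSpeed_eq hσ hε _ hs] at hc
    have hs' := S.mem_wavesAt.1 hs
    refine ⟨s, hs'.1, hs'.2, ?_⟩
    rw [S.speed_eq_entSpeed hs'.1, hs'.2, hc]
  · obtain ⟨i, hi, -⟩ := ha
    rw [hk.leftLim_eq_of_empty hne] at hi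
    simp only [cells, Set.mem_ofPred_eq] at hi
    rcases hi with hi | hi <;> linarith [hi.1, hi.2]

theorem WaveProfile.speed_mono (hε : 0 < ε) {k : ℕ} (hk : S.WaveProfile k) {s s' : ℕ}
    (hs : s ∈ S.alive k) (hs' : s' ∈ S.alive k) (hp : S.px k s = S.px k s') (hss : s ≤ s') :
    S.speed k s ≤ S.speed k s' := by
  have h1 : s ∈ S.wavesAt k (S.px k s) := S.mem_wavesAt.2 ⟨hs, rfl⟩
  have h2 : s' ∈ S.wavesAt k (S.px k s) := S.mem_wavesAt.2 ⟨hs', hp.symm⟩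
  obtain ⟨σ, m, n, hσ, hT, -⟩ := hk.exists_isTile_wavesAt hε ⟨s, h1⟩
  rw [S.speed_eq_entSpeed hs, S.speed_eq_entSpeed hs', ← hp]
  exact hT.entSpeed_mono hσ hε _ h1 h2 hss

/-- The states `kap` are injective on the tile of waves at `y`, so counting crossed elementary jumps
is counting waves of `y` that have arrived in `(-∞, x]`. -/
theorem WaveProfile.riemannSol_sub (hε : 0 < ε) {k : ℕ} (hk : S.WaveProfile k) (y τ x : ℝ) :
    riemannSol ε (fun u => f u (S.v (S.t k) y)) (Function.leftLim (S.w (S.t k)) y)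
      (S.w (S.t k) y) τ (x - y) - Function.leftLim (S.w (S.t k)) y =
    ∑ s ∈ S.alive k with S.px k s + S.speed k s * τ ≤ x ∧ S.px k s = y, ε * S.sgn s := by
  by_cases hne : (S.wavesAt k y).Nonempty
  · obtain ⟨σ, m, n, hσ, hT, h1, h2⟩ := hk.exists_isTile_wavesAt hε hne
    rw [riemannSol, add_sub_cancel_left, h1, h2, hT.sign_eq hσ hε, hT.cells_eq hσ hε]
    have hset : {i ∈ S.kap '' (S.wavesAt k y : Set ℕ) | cellSpeed ε
          (fun u => f u (S.v (S.t k) y)) ((σ * m : ℤ) * ε) ((σ * n : ℤ) * ε) i * τ ≤ x - y} =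
        S.kap '' ((S.alive k).filter fun s =>
          S.px k s + S.speed k s * τ ≤ x ∧ S.px k s = y : Finset ℕ) := by
      ext i
      constructor
      · rintro ⟨⟨s, hs, rfl⟩, hle⟩
        have hs' := S.mem_wavesAt.1 hs
        rw [hT.cellSpeed_eq hσ hε _ hs, ← hs'.2, ← S.speed_eq_entSpeed hs'.1] at hle
        exact ⟨s, Finset.mem_coe.2 (Finset.mem_filter.2 ⟨hs'.1, by linarith, hs'.2⟩), rfl⟩
      · rintro ⟨s, hs, rfl⟩
        obtain ⟨h3, h4, h5⟩ := Finset.mem_filter.1 (Finset.mem_coe.1 hs)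
        have hs' : s ∈ S.wavesAt k y := S.mem_wavesAt.2 ⟨h3, h5⟩
        refine ⟨⟨s, hs', rfl⟩, ?_⟩
        rw [hT.cellSpeed_eq hσ hε _ hs', ← h5, ← S.speed_eq_entSpeed h3]
        linarith
    have hinj : InjOn S.kap ((S.alive k).filter fun s =>
          S.px k s + S.speed k s * τ ≤ x ∧ S.px k s = y : Finset ℕ) := by
      intro s hs s' hs' hss
      have h3 := Finset.mem_filter.1 (Finset.mem_coe.1 hs)
      have h4 := Finset.mem_filter.1 (Finset.mem_coe.1 hs')
      exact hT.mono.injOn (S.mem_wavesAt.2 ⟨h3.1, h3.2.2⟩) (S.mem_wavesAt.2 ⟨h4.1, h4.2.2⟩)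
        (by simp only [hss])
    rw [hset, hinj.ncard_image, ncard_coe_finset, Finset.sum_congr rfl
      (g := fun _ => ε * (σ : ℝ)), Finset.sum_const, nsmul_eq_mul]
    · ring
    · intro s hs
      rw [Finset.mem_filter] at hs
      rw [hT.sgn_eq hε (S.mem_wavesAt.2 ⟨hs.1, hs.2.2⟩)]
  · rw [riemannSol, hk.leftLim_eq_of_empty hne, sub_self, Real.sign_zero, Finset.sum_eq_zero]
    · ring
    · intro s hs
      rw [Finset.mem_filter] at hs
      exact absurd ⟨s, S.mem_wavesAt.2 ⟨hs.1, hs.2.2⟩⟩ hne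

/-- Up to the next collision the waves move with constant speed. -/
theorem WaveProfile.w_later (hε : 0 < ε) {k : ℕ} (hk : S.WaveProfile k) (hkJ : k ≤ S.J) {τ : ℝ}
    (h1 : S.t k ≤ τ) (h2 : k < S.J → τ ≤ S.t (k + 1)) :
    S.w τ = stepSum (S.alive k) (fun s => S.px k s + S.speed k s * (τ - S.t k))
      fun s => ε * S.sgn s := by
  classical
  ext x
  rw [S.w_eq k hkJ τ h1 h2 x]
  simp only [hk.riemannSol_sub hε]
  rw [finsum_eq_sum_of_support_subset (s := (S.alive k).image (S.px k)), stepSum,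
    ← Finset.sum_fiberwise_of_maps_to (t := (S.alive k).image (S.px k)) (g := S.px k)
      fun s hs => Finset.mem_image_of_mem _ (Finset.mem_filter.1 hs).1]
  · refine Finset.sum_congr rfl fun y _ => ?_
    rw [Finset.filter_filter]
  · intro y hy
    by_contra hc
    apply hy
    refine Finset.sum_eq_zero fun s hs => ?_
    rw [Finset.mem_filter] at hs
    exact absurd (Finset.mem_coe.2 (Finset.mem_image.2 ⟨s, hs.1, hs.2.2⟩)) hc

/-! ### From one collision time to the next one -/

variable (S) in
/-- The point where the wave `s` arrives at time `t (k + 1)`. -/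
def arrival (k s : ℕ) : ℝ := S.px k s + S.speed k s * (S.t (k + 1) - S.t k)

open Classical in
theorem pos_succ_of_alive {k s : ℕ} (h : s ∈ S.alive k) : S.pos (k + 1) s =
    if S.arrival k s = S.xc (k + 1) ∧ ¬ S.Survives (k + 1) s then ⊤
    else (S.arrival k s : WithTop ℝ) := by
  rw [pos, if_neg (S.mem_alive.1 h).2]
  rfl

theorem mem_alive_succ {k s : ℕ} : s ∈ S.alive (k + 1) ↔
    s ∈ S.alive k ∧ ¬ (S.arrival k s = S.xc (k + 1) ∧ ¬ S.Survives (k + 1) s) := by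
  by_cases h : s ∈ S.alive k
  · rw [mem_alive, pos_succ_of_alive h]
    have := S.mem_waves_of_alive h
    split_ifs with h2 <;> simp [h, h2, this]
  · have h' := h
    rw [mem_alive, not_and_not_right] at h'
    simp only [h, false_and, iff_false, mem_alive, not_and_not_right]
    intro hs
    rw [pos, if_pos (h' hs)]

theorem alive_succ_subset {k s : ℕ} (h : s ∈ S.alive (k + 1)) : s ∈ S.alive k :=
  (mem_alive_succ.1 h).1

theorem px_succ {k s : ℕ} (h : s ∈ S.alive (k + 1)) : S.px (k + 1) s = S.arrival k s := by
  rw [px, pos_succ_of_alive (alive_succ_subset h), if_neg (mem_alive_succ.1 h).2]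
  rfl

theorem WaveProfile.front_eq (hε : 0 < ε) {k : ℕ} (hk : S.WaveProfile k) (hkJ : k ≤ S.J) {s s' : ℕ}
    (hs : s ∈ S.alive k) (hs' : s' ∈ S.alive k) {τ : ℝ} (h1 : S.t k < τ)
    (h2 : k < S.J → τ < S.t (k + 1)) (heq : S.px k s + S.speed k s * (τ - S.t k) =
      S.px k s' + S.speed k s' * (τ - S.t k)) :
    S.px k s = S.px k s' ∧ S.speed k s = S.speed k s' := by
  have := S.no_collision k hkJ τ h1 h2 _ (hk.front_mem hε hs) _ (hk.front_mem hε hs') heq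
  rw [Front.mk.injEq] at this
  exact this.2

theorem WaveProfile.arrival_mono (hε : 0 < ε) {k : ℕ} (hk : S.WaveProfile k) (hkJ : k < S.J)
    {s s' : ℕ} (hs : s ∈ S.alive k) (hs' : s' ∈ S.alive k) (hss : s ≤ s') :
    S.arrival k s ≤ S.arrival k s' := by
  have ht := S.t_lt k hkJ
  rcases hss.eq_or_lt with rfl | hlt
  · exact le_rfl
  rcases (hk.mono s hs s' hs' hlt).eq_or_lt with heq | hlt'
  · have := hk.speed_mono hε hs hs' heq hss
    rw [arrival, arrival, heq]
    nlinarith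
  · by_contra hc
    rw [not_le, arrival, arrival] at hc
    set T := S.t (k + 1) - S.t k
    have hT : 0 < T := by simp only [T]; linarith
    have hd : 0 < S.speed k s - S.speed k s' := by nlinarith
    -- If the order were reversed on arrival, the two waves would meet after the time `θ`, strictly
    -- before the next collision time.
    set θ := (S.px k s' - S.px k s) / (S.speed k s - S.speed k s') with hθ
    have e : (S.speed k s - S.speed k s') * θ = S.px k s' - S.px k s := by
      rw [hθ]; field_simp
    have hθ0 : 0 < θ := div_pos (by linarith) hd
    have hθT : θ < T := by
      rw [hθ, div_lt_iff₀ hd]; linarith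
    have := hk.front_eq hε hkJ.le hs hs' (τ := S.t k + θ) (by linarith)
      (fun _ => by simp only [T] at hθT; linarith) (by rw [add_sub_cancel_left]; linarith)
    exact hlt'.ne this.1

/-- At a collision time only the two colliding fronts meet. -/
theorem WaveProfile.exists_collision (hε : 0 < ε) {k : ℕ} (hk : S.WaveProfile k) (hkJ : k < S.J) :
    ∃ a b, S.Collide k a b ∧
      (∀ s ∈ S.alive k, S.arrival k s = S.xc (k + 1) →
        (⟨.second, S.px k s, S.speed k s⟩ : Front) = a ∨
        (⟨.second, S.px k s, S.speed k s⟩ : Front) = b) ∧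
      (∀ s ∈ S.alive k, ∀ s' ∈ S.alive k, S.arrival k s = S.arrival k s' →
        S.arrival k s ≠ S.xc (k + 1) → S.px k s = S.px k s' ∧ S.speed k s = S.speed k s') ∧
      ∀ c d, S.Collide k c d → (c = a ∨ c = b) ∧ (d = a ∨ d = b) := by
  obtain ⟨a, ha, b, hb, hne, hax, hbx, huniq⟩ := S.collision k hkJ
  refine ⟨a, b, ⟨ha, hb, hne, hax, hbx⟩, ?_, ?_, ?_⟩
  · intro s hs hsx
    by_cases hsa : (⟨.second, S.px k s, S.speed k s⟩ : Front) = a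
    · exact Or.inl hsa
    · exact (huniq _ (hk.front_mem hε hs) a ha hsa (Eq.trans hsx hax.symm)).1
  · intro s hs s' hs' heq hnx
    by_contra hc
    have hne' : (⟨.second, S.px k s, S.speed k s⟩ : Front) ≠ ⟨.second, S.px k s', S.speed k s'⟩ := by
      rw [Ne, Front.mk.injEq]
      exact fun h => hc h.2
    have h1 := (huniq _ (hk.front_mem hε hs) _ (hk.front_mem hε hs') hne' heq).1
    have hpos : (⟨.second, S.px k s, S.speed k s⟩ : Front).pos (S.t (k + 1) - S.t k) =
        S.xc (k + 1) := by
      rcases h1 with h1 | h1 <;> rw [h1] <;> assumption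
    exact hnx hpos
  · rintro c d ⟨hc, hd, hcd, hcx, hdx⟩
    exact huniq c hc d hd hcd (hcx.trans hdx.symm)

end WavefrontSolution

/-! ### Cancellation at collisions and preservation of the wave profile -/

namespace WavefrontSolution

variable {f : ℝ → ℝ → ℝ} {ε : ℝ} {S : WavefrontSolution f ε}

variable (S) in
/-- The waves arriving at the collision point `xc (k + 1)`. -/
def arrivals (k : ℕ) : Finset ℕ := (S.alive k).filter fun s => S.arrival k s = S.xc (k + 1)

theorem mem_arrivals {k s : ℕ} :
    s ∈ S.arrivals k ↔ s ∈ S.alive k ∧ S.arrival k s = S.xc (k + 1) := Finset.mem_filter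

theorem WaveProfile.arrivals_ordConnected (hε : 0 < ε) {k : ℕ} (hk : S.WaveProfile k)
    (hkJ : k < S.J) {a b q : ℕ} (ha : a ∈ S.arrivals k) (hb : b ∈ S.arrivals k)
    (hq : q ∈ S.alive k) (haq : a ≤ q) (hqb : q ≤ b) : q ∈ S.arrivals k := by
  rw [mem_arrivals] at ha hb ⊢
  exact ⟨hq, le_antisymm ((hk.arrival_mono hε hkJ hq hb.1 hqb).trans_eq hb.2)
    (ha.2.ge.trans (hk.arrival_mono hε hkJ ha.1 hq haq))⟩

theorem sum_sgn_eq (hε : 0 < ε) {D : Finset ℕ} (hD : ∀ s ∈ D, s ∈ S.waves) :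
    ∑ s ∈ D, ε * S.sgn s = (∑ s ∈ D, S.isgn s : ℤ) * ε := by
  rw [← Finset.mul_sum, mul_comm, Int.cast_sum]
  congr 1
  exact Finset.sum_congr rfl fun p hp => (S.isgn_cast hε (hD p hp)).symm

/-- The sums run over the waves of time `t k`, including those about to be removed: `w` at the
collision time is known first as the limit of the profile carried by them. -/
theorem WaveProfile.states_at_collision (hε : 0 < ε) {k : ℕ} (hk : S.WaveProfile k)
    (hkJ : k < S.J) :
    Function.leftLim (S.w (S.t (k + 1))) (S.xc (k + 1)) =
      (∑ s ∈ S.alive k with S.arrival k s < S.xc (k + 1), S.isgn s : ℤ) * ε ∧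
    S.w (S.t (k + 1)) (S.xc (k + 1)) =
      (∑ s ∈ S.alive k with S.arrival k s < S.xc (k + 1), S.isgn s +
        ∑ s ∈ S.arrivals k, S.isgn s : ℤ) * ε := by
  have hw : S.w (S.t (k + 1)) = stepSum (S.alive k) (S.arrival k) fun s => ε * S.sgn s :=
    hk.w_later hε hkJ.le (S.t_lt k hkJ).le fun _ => le_rfl
  have hsub (P : ℕ → Prop) [DecidablePred P] : ∀ s ∈ (S.alive k).filter P, s ∈ S.waves :=
    fun s hs => S.mem_waves_of_alive (Finset.mem_filter.1 hs).1
  constructor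
  · rw [hw, leftLim_stepSum, sum_sgn_eq hε (hsub _)]
  · rw [hw, stepSum_eq_left_add, sum_sgn_eq hε (hsub _), sum_sgn_eq hε (hsub _), ← add_mul,
      ← Int.cast_add, arrivals]

/-- All states are multiples of `ε`, so the inequality with the gap `ε` becomes a strict inequality
of integers. -/
theorem survives_iff (hε : 0 < ε) {k s : ℕ} (hs : s ∈ S.waves) {A B : ℤ}
    (hA : Function.leftLim (S.w (S.t k)) (S.xc k) = A * ε) (hB : S.w (S.t k) (S.xc k) = B * ε) :
    S.Survives k s ↔ S.isgn s * A < S.isgn s * S.kap s ∧ S.isgn s * S.kap s ≤ S.isgn s * B := by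
  rw [Survives, hA, hB, S.what_eq_kap hε hs, ← S.isgn_cast hε hs]
  have e1 : (S.isgn s : ℝ) * (A * ε) ≤ S.isgn s * (S.kap s * ε) - ε ↔
      S.isgn s * A < S.isgn s * S.kap s := by
    rw [← Int.add_one_le_iff, ← Int.cast_le (R := ℝ)]
    push_cast
    constructor
    · exact fun h => le_of_mul_le_mul_right (by linarith) hε
    · intro h
      have := mul_le_mul_of_nonneg_right h hε.le
      linarith
  have e2 : (S.isgn s : ℝ) * (S.kap s * ε) ≤ S.isgn s * (B * ε) ↔
      S.isgn s * S.kap s ≤ S.isgn s * B := by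
    rw [← Int.cast_le (R := ℝ)]
    push_cast
    constructor
    · exact fun h => le_of_mul_le_mul_right (by linarith) hε
    · intro h
      have := mul_le_mul_of_nonneg_right h hε.le
      linarith
  rw [e1, e2]

/-- If the waves arriving at the collision point have the same sign, all of them survive. -/
theorem WaveProfile.survives_of_homogeneous (hε : 0 < ε) {k : ℕ} (hk : S.WaveProfile k)
    (hkJ : k < S.J) {σ : ℤ} (hσ : σ = 1 ∨ σ = -1) (hsgn : ∀ s ∈ S.arrivals k, S.isgn s = σ)
    {s : ℕ} (hs : s ∈ S.arrivals k) : S.Survives (k + 1) s := by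
  have hσ2 : σ * σ = 1 := by rcases hσ with rfl | rfl <;> norm_num
  obtain ⟨m, n, hT, hn, hm⟩ := S.exists_isTile hε hk hσ (D := S.arrivals k)
    (Finset.filter_subset _ _) ⟨s, hs⟩ hsgn fun a ha b hb q hq h1 h2 =>
      hk.arrivals_ordConnected hε hkJ ha hb hq h1 h2
  have hbelow : ((S.alive k).filter fun p => ∀ d ∈ S.arrivals k, p < d) =
      (S.alive k).filter fun p => S.arrival k p < S.xc (k + 1) := by
    have hs' := mem_arrivals.1 hs
    refine Finset.filter_congr fun p hp => ⟨fun h => ?_, fun h d hd => ?_⟩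
    · refine lt_of_le_of_ne ((hk.arrival_mono hε hkJ hp hs'.1 (h s hs).le).trans hs'.2.le)
        fun heq => ?_
      exact lt_irrefl p (h p (mem_arrivals.2 ⟨hp, heq⟩))
    · rw [mem_arrivals] at hd
      by_contra hc
      exact absurd (hd.2 ▸ hk.arrival_mono hε hkJ hd.1 hp (not_lt.1 hc)) (not_le.2 h)
  rw [hbelow] at hm
  obtain ⟨h1, h2⟩ := hk.states_at_collision hε hkJ
  rw [survives_iff hε (S.mem_waves_of_alive (mem_arrivals.1 hs).1) h1 h2, hsgn s hs,
    Finset.sum_congr rfl hsgn, Finset.sum_const, nsmul_eq_mul, mul_add, mul_left_comm σ _ σ, hσ2,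
    mul_one, ← hm, ← hn]
  exact hT.mem_Ioc hs

/-- The waves removed at a collision cancel each other. -/
theorem WaveProfile.removed (hε : 0 < ε) {k : ℕ} (hk : S.WaveProfile k) (hkJ : k < S.J) :
    ∑ p ∈ S.alive k with p ∉ S.alive (k + 1), S.isgn p = 0 ∧
    (∀ s ∈ S.alive (k + 1), ∑ p ∈ S.alive k with p ∉ S.alive (k + 1) ∧ p ≤ s, S.isgn p = 0) ∧
    ∀ s ∈ S.alive (k + 1), ∀ s' ∈ S.alive (k + 1), S.arrival k s = S.arrival k s' →
      S.isgn s = S.isgn s' := by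
  classical
  obtain ⟨a, b, -, hfront, hother, -⟩ := hk.exists_collision hε hkJ
  have hremoved : ∀ p ∈ S.alive k, p ∉ S.alive (k + 1) → p ∈ S.arrivals k ∧
      ¬ S.Survives (k + 1) p := by
    intro p hp hp'
    rw [mem_alive_succ] at hp'
    have : S.arrival k p = S.xc (k + 1) ∧ ¬ S.Survives (k + 1) p := by
      by_contra hc; exact hp' ⟨hp, hc⟩
    exact ⟨mem_arrivals.2 ⟨hp, this.1⟩, this.2⟩
  have hsgnpx : ∀ s ∈ S.alive k, ∀ s' ∈ S.alive k, S.px k s = S.px k s' → S.isgn s = S.isgn s' := by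
    intro s hs s' hs' h
    rw [isgn, isgn, hk.sgn_eq s hs s' hs' h]
  -- Arriving waves of a single sign all survive, and then nothing is removed.
  by_cases hhom : ∀ s ∈ S.arrivals k, ∀ s' ∈ S.arrivals k, S.isgn s = S.isgn s'
  · have hall : ∀ p ∈ S.alive k, p ∈ S.alive (k + 1) := by
      intro p hp
      by_contra hc
      obtain ⟨h1, h2⟩ := hremoved p hp hc
      exact h2 (hk.survives_of_homogeneous hε hkJ (S.isgn_cases p) (fun s hs => hhom s hs p h1) h1)
    refine ⟨?_, fun s hs => ?_, fun s hs s' hs' heq => ?_⟩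
    · exact Finset.sum_eq_zero fun p hp =>
        absurd (hall p (Finset.mem_filter.1 hp).1) (Finset.mem_filter.1 hp).2
    · exact Finset.sum_eq_zero fun p hp =>
        absurd (hall p (Finset.mem_filter.1 hp).1) (Finset.mem_filter.1 hp).2.1
    · have h1 := alive_succ_subset hs
      have h2 := alive_succ_subset hs'
      by_cases hx : S.arrival k s = S.xc (k + 1)
      · exact hhom s (mem_arrivals.2 ⟨h1, hx⟩) s' (mem_arrivals.2 ⟨h2, heq ▸ hx⟩)
      · exact hsgnpx s h1 s' h2 (hother s h1 s' h2 heq hx).1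
  -- two fronts of opposite sign
  obtain ⟨s₁, s₂, h₁, h₂, hlt, hne⟩ : ∃ s₁ s₂, s₁ ∈ S.arrivals k ∧ s₂ ∈ S.arrivals k ∧
      s₁ < s₂ ∧ S.isgn s₁ ≠ S.isgn s₂ := by
    push Not at hhom
    obtain ⟨s, hs, s', hs', hne⟩ := hhom
    rcases lt_trichotomy s s' with h | rfl | h
    · exact ⟨s, s', hs, hs', h, hne⟩
    · exact absurd rfl hne
    · exact ⟨s', s, hs', hs, h, hne.symm⟩
  set σ := S.isgn s₁ with hσdef
  have hσ : σ = 1 ∨ σ = -1 := S.isgn_cases s₁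
  have hσ2 : σ * σ = 1 := by rcases hσ with h | h <;> rw [h] <;> norm_num
  have hσ' : S.isgn s₂ = -σ := by
    rcases hσ with h | h <;> rcases S.isgn_cases s₂ with h' | h' <;> omega
  have h₁' := mem_arrivals.1 h₁
  have h₂' := mem_arrivals.1 h₂
  have hpx : S.px k s₁ < S.px k s₂ := lt_of_le_of_ne (hk.mono _ h₁'.1 _ h₂'.1 hlt)
    fun h => hne (hsgnpx _ h₁'.1 _ h₂'.1 h)
  have hdich : ∀ s ∈ S.arrivals k, S.px k s = S.px k s₁ ∨ S.px k s = S.px k s₂ := by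
    intro s hs
    have hs' := mem_arrivals.1 hs
    have e0 := hfront s hs'.1 hs'.2
    have e1 := hfront s₁ h₁'.1 h₁'.2
    have e2 := hfront s₂ h₂'.1 h₂'.2
    have aux : ∀ p q c : _, (⟨.second, S.px k p, S.speed k p⟩ : Front) = c →
        (⟨.second, S.px k q, S.speed k q⟩ : Front) = c → S.px k p = S.px k q := by
      intro p q c h h'
      rw [← h', Front.mk.injEq] at h
      exact h.2.1
    rcases e1 with e1 | e1 <;> rcases e2 with e2 | e2
    · exact absurd (aux _ _ _ e1 e2) hpx.ne
    · exact e0.imp (fun e => aux _ _ _ e e1) fun e => aux _ _ _ e e2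
    · exact e0.symm.imp (fun e => aux _ _ _ e e1) fun e => aux _ _ _ e e2
    · exact absurd (aux _ _ _ e1 e2) hpx.ne
  -- By `hdich` the arriving waves are those of two starting points, one for each sign.
  set X₁ := (S.arrivals k).filter fun s => S.px k s = S.px k s₁ with hX₁
  set X₂ := (S.arrivals k).filter fun s => S.px k s = S.px k s₂ with hX₂
  have hX : ∀ s ∈ S.arrivals k, s ∈ X₁ ∨ s ∈ X₂ := fun s hs =>
    (hdich s hs).imp (fun h => Finset.mem_filter.2 ⟨hs, h⟩) fun h => Finset.mem_filter.2 ⟨hs, h⟩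
  have mem₁ : s₁ ∈ X₁ := Finset.mem_filter.2 ⟨h₁, rfl⟩
  have mem₂ : s₂ ∈ X₂ := Finset.mem_filter.2 ⟨h₂, rfl⟩
  have arr₁ : ∀ s ∈ X₁, s ∈ S.arrivals k := fun s hs => (Finset.mem_filter.1 hs).1
  have arr₂ : ∀ s ∈ X₂, s ∈ S.arrivals k := fun s hs => (Finset.mem_filter.1 hs).1
  have al₁ : ∀ s ∈ X₁, s ∈ S.alive k := fun s hs => (mem_arrivals.1 (arr₁ s hs)).1
  have al₂ : ∀ s ∈ X₂, s ∈ S.alive k := fun s hs => (mem_arrivals.1 (arr₂ s hs)).1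
  have sg₁ : ∀ s ∈ X₁, S.isgn s = σ := fun s hs =>
    hsgnpx _ (al₁ s hs) _ h₁'.1 (Finset.mem_filter.1 hs).2
  have sg₂ : ∀ s ∈ X₂, S.isgn s = -σ := fun s hs =>
    (hsgnpx _ (al₂ s hs) _ h₂'.1 (Finset.mem_filter.1 hs).2).trans hσ'
  have h12 : ∀ s ∈ X₁, ∀ s' ∈ X₂, s < s' := by
    intro s hs s' hs'
    by_contra hc
    have e1 := (Finset.mem_filter.1 hs).2
    have e2 := (Finset.mem_filter.1 hs').2
    rcases (not_lt.1 hc).eq_or_lt with rfl | h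
    · exact hpx.ne (e1.symm.trans e2)
    · have := hk.mono _ (al₂ s' hs') _ (al₁ s hs) h
      rw [e1, e2] at this
      exact absurd hpx (not_lt.2 this)
  have hconv₁ : ∀ a ∈ X₁, ∀ b ∈ X₁, ∀ q ∈ S.alive k, a ≤ q → q ≤ b → q ∈ X₁ := by
    intro a ha b hb q hq h1 h2
    refine (hX q (hk.arrivals_ordConnected hε hkJ (arr₁ a ha) (arr₁ b hb) hq h1 h2)).resolve_right
      fun h => absurd (h12 b hb q h) (not_lt.2 h2)
  have hconv₂ : ∀ a ∈ X₂, ∀ b ∈ X₂, ∀ q ∈ S.alive k, a ≤ q → q ≤ b → q ∈ X₂ := by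
    intro a ha b hb q hq h1 h2
    refine (hX q (hk.arrivals_ordConnected hε hkJ (arr₂ a ha) (arr₂ b hb) hq h1 h2)).resolve_left
      fun h => absurd (h12 q h a ha) (not_lt.2 h1)
  obtain ⟨m₁, n₁, hT₁, hn₁, hm₁⟩ := S.exists_isTile hε hk hσ al₁ ⟨s₁, mem₁⟩ sg₁ hconv₁
  obtain ⟨m₂, n₂, hT₂, hn₂, hm₂⟩ := S.exists_isTile hε hk (σ := -σ) (by omega) al₂ ⟨s₂, mem₂⟩
    sg₂ hconv₂
  set A := ∑ s ∈ S.alive k with S.arrival k s < S.xc (k + 1), S.isgn s with hA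
  have hbelow₁ : ((S.alive k).filter fun p => ∀ d ∈ X₁, p < d) =
      (S.alive k).filter fun p => S.arrival k p < S.xc (k + 1) := by
    refine Finset.filter_congr fun p hp => ⟨fun h => ?_, fun h d hd => ?_⟩
    · refine lt_of_le_of_ne ((hk.arrival_mono hε hkJ hp h₁'.1 (h s₁ mem₁).le).trans h₁'.2.le)
        fun heq => ?_
      rcases hX p (mem_arrivals.2 ⟨hp, heq⟩) with h' | h'
      · exact lt_irrefl p (h p h')
      · exact lt_asymm (h s₁ mem₁) (h12 s₁ mem₁ p h')
    · have hd' := mem_arrivals.1 (arr₁ d hd)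
      by_contra hc
      exact absurd (hd'.2 ▸ hk.arrival_mono hε hkJ hd'.1 hp (not_lt.1 hc)) (not_le.2 h)
  have hbelow₂ : ((S.alive k).filter fun p => ∀ d ∈ X₂, p < d) =
      ((S.alive k).filter fun p => S.arrival k p < S.xc (k + 1)) ∪ X₁ := by
    ext p
    rw [Finset.mem_union, Finset.mem_filter, Finset.mem_filter]
    constructor
    · rintro ⟨hp, h⟩
      have hle := (hk.arrival_mono hε hkJ hp h₂'.1 (h s₂ mem₂).le).trans h₂'.2.le
      rcases hle.lt_or_eq with hlt | heq
      · exact Or.inl ⟨hp, hlt⟩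
      · exact Or.inr ((hX p (mem_arrivals.2 ⟨hp, heq⟩)).resolve_right fun h' => lt_irrefl p (h p h'))
    · rintro (⟨hp, h⟩ | hp)
      · refine ⟨hp, fun d hd => ?_⟩
        have hd' := mem_arrivals.1 (arr₂ d hd)
        by_contra hc
        exact absurd (hd'.2 ▸ hk.arrival_mono hε hkJ hd'.1 hp (not_lt.1 hc)) (not_le.2 h)
      · exact ⟨al₁ p hp, fun d hd => h12 p hp d hd⟩
  rw [hbelow₁] at hm₁
  rw [hbelow₂, Finset.sum_union, Finset.sum_congr rfl sg₁, Finset.sum_const, nsmul_eq_mul] at hm₂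
  swap
  · rw [Finset.disjoint_left]
    intro p hp hp'
    exact (Finset.mem_filter.1 hp).2.ne (mem_arrivals.1 (arr₁ p hp')).2
  have hAm : σ * A = m₁ := hm₁.symm
  -- In the coordinate `σ * kap`, the waves of `X₁` climb from `m₁` to `n₁` and those of `X₂`
  -- descend from `n₁` to `-n₂`.
  have hm₂' : m₂ = -n₁ := by
    rw [hm₂, neg_mul, mul_add, mul_left_comm, hσ2, ← hA, hAm, hn₁]; ring
  obtain ⟨hl, hr⟩ := hk.states_at_collision hε hkJ
  have hBsum : ∑ s ∈ S.arrivals k, S.isgn s = σ * X₁.card + -σ * X₂.card := by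
    have e : S.arrivals k = X₁ ∪ X₂ := by
      ext p
      rw [Finset.mem_union]
      exact ⟨hX p, fun h => h.elim (arr₁ p) (arr₂ p)⟩
    rw [e, Finset.sum_union, Finset.sum_congr rfl sg₁, Finset.sum_congr rfl sg₂, Finset.sum_const,
      Finset.sum_const, nsmul_eq_mul, nsmul_eq_mul]
    · ring
    · rw [Finset.disjoint_left]
      exact fun p hp hp' => lt_irrefl p (h12 p hp p hp')
  rw [← hA, hBsum] at hr
  rw [← hA] at hl
  have hB : σ * (A + (σ * X₁.card + -σ * X₂.card)) = -n₂ := by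
    have e : σ * (A + (σ * X₁.card + -σ * X₂.card)) = σ * A + σ * σ * (X₁.card - X₂.card) := by ring
    rw [e, hσ2, hAm, hn₂, hm₂', hn₁]; ring
  have surv₁ : ∀ s ∈ X₁, (S.Survives (k + 1) s ↔ σ * S.kap s ≤ -n₂) := by
    intro s hs
    rw [survives_iff hε (S.mem_waves_of_alive (al₁ s hs)) hl hr, sg₁ s hs, hB, hAm]
    have := hT₁.mem_Ioc hs
    exact ⟨fun h => h.2, fun h => ⟨this.1, h⟩⟩
  have surv₂ : ∀ s ∈ X₂, (S.Survives (k + 1) s ↔ σ * S.kap s < m₁) := by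
    intro s hs
    rw [survives_iff hε (S.mem_waves_of_alive (al₂ s hs)) hl hr, sg₂ s hs]
    have := hT₂.mem_Ioc hs
    simp only [neg_mul] at this hB ⊢
    rw [hB, hAm]
    omega
  have rem₁ : ∀ s ∈ X₁, (s ∉ S.alive (k + 1) ↔ -n₂ < σ * S.kap s) := by
    intro s hs
    have e := mem_arrivals.1 (arr₁ s hs)
    rw [mem_alive_succ, surv₁ s hs]
    simp only [e, true_and, not_not, not_le]
  have rem₂ : ∀ s ∈ X₂, (s ∉ S.alive (k + 1) ↔ m₁ ≤ σ * S.kap s) := by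
    intro s hs
    have e := mem_arrivals.1 (arr₂ s hs)
    rw [mem_alive_succ, surv₂ s hs]
    simp only [e, true_and, not_not, not_lt]
  -- The removed waves of both sides cover the same stretch, from `max m₁ (-n₂)` up to `n₁`, once
  -- upwards and once downwards.
  have hcard₁ : (X₁.filter fun p => p ∉ S.alive (k + 1)).card =
      (Finset.Ioc (max m₁ (-n₂)) n₁).card := by
    rw [← Finset.card_image_of_injOn (f := fun s => σ * S.kap s) (hT₁.mono.injOn.mono fun s hs =>
      Finset.mem_coe.2 (Finset.mem_filter.1 (Finset.mem_coe.1 hs)).1)]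
    congr 1
    ext i
    rw [Finset.mem_image, Finset.mem_Ioc]
    constructor
    · rintro ⟨s, hs, rfl⟩
      rw [Finset.mem_filter] at hs
      have := hT₁.mem_Ioc (Finset.mem_coe.2 hs.1)
      have := (rem₁ s hs.1).1 hs.2
      omega
    · intro hi
      obtain ⟨s, hs, rfl⟩ := hT₁.exists_mem (i := i) (by omega) (by omega)
      exact ⟨s, Finset.mem_filter.2 ⟨hs, (rem₁ s hs).2 (by omega)⟩, rfl⟩
  have hcard₂ : (X₂.filter fun p => p ∉ S.alive (k + 1)).card =
      (Finset.Ioc (-n₁) (-(max m₁ (-n₂)))).card := by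
    rw [← Finset.card_image_of_injOn (f := fun s => -σ * S.kap s) (hT₂.mono.injOn.mono fun s hs =>
      Finset.mem_coe.2 (Finset.mem_filter.1 (Finset.mem_coe.1 hs)).1)]
    congr 1
    ext i
    rw [Finset.mem_image, Finset.mem_Ioc]
    constructor
    · rintro ⟨s, hs, rfl⟩
      rw [Finset.mem_filter] at hs
      have e1 := hT₂.mem_Ioc (Finset.mem_coe.2 hs.1)
      have e2 := (rem₂ s hs.1).1 hs.2
      simp only [neg_mul] at e1 ⊢
      omega
    · intro hi
      obtain ⟨s, hs, rfl⟩ := hT₂.exists_mem (i := i) (by omega) (by omega)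
      refine ⟨s, Finset.mem_filter.2 ⟨hs, (rem₂ s hs).2 ?_⟩, rfl⟩
      simp only [neg_mul] at hi
      omega
  have hsplit : ((S.alive k).filter fun p => p ∉ S.alive (k + 1)) =
      (X₁.filter fun p => p ∉ S.alive (k + 1)) ∪ X₂.filter fun p => p ∉ S.alive (k + 1) := by
    ext p
    simp only [Finset.mem_union, Finset.mem_filter]
    constructor
    · rintro ⟨hp, hp'⟩
      exact (hX p (hremoved p hp hp').1).imp (fun h => ⟨h, hp'⟩) fun h => ⟨h, hp'⟩
    · rintro (⟨hp, hp'⟩ | ⟨hp, hp'⟩)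
      · exact ⟨al₁ p hp, hp'⟩
      · exact ⟨al₂ p hp, hp'⟩
  have hA0 : ∑ p ∈ S.alive k with p ∉ S.alive (k + 1), S.isgn p = 0 := by
    rw [hsplit, Finset.sum_union, Finset.sum_congr rfl fun p hp => sg₁ p (Finset.mem_filter.1 hp).1,
      Finset.sum_congr rfl fun p hp => sg₂ p (Finset.mem_filter.1 hp).1, Finset.sum_const,
      Finset.sum_const, hcard₁, hcard₂, Int.card_Ioc, Int.card_Ioc, nsmul_eq_mul, nsmul_eq_mul]
    · rw [show n₁ - max m₁ (-n₂) = -max m₁ (-n₂) - -n₁ by ring]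
      ring
    · rw [Finset.disjoint_left]
      exact fun p hp hp' => lt_irrefl p
        (h12 p (Finset.mem_filter.1 hp).1 p (Finset.mem_filter.1 hp').1)
  refine ⟨hA0, fun s hs => ?_, fun s hs s' hs' heq => ?_⟩
  · have hsk := alive_succ_subset hs
    -- The removed waves preceding a survivor `s` are none or all. They are all later if `s` arrives
    -- on the left or belongs to `X₁`, since `X₁` loses its last waves; they all precede `s` if it
    -- arrives on the right or belongs to `X₂`, which loses its first waves.
    rcases lt_trichotomy (S.arrival k s) (S.xc (k + 1)) with hlt' | heq | hgt
    · refine Finset.sum_eq_zero fun p hp => ?_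
      obtain ⟨hp1, hp2, hp3⟩ := Finset.mem_filter.1 hp
      have e := (mem_arrivals.1 (hremoved p hp1 hp2).1).2
      have := hk.arrival_mono hε hkJ hp1 hsk hp3
      linarith
    · rcases hX s (mem_arrivals.2 ⟨hsk, heq⟩) with h | h
      · refine Finset.sum_eq_zero fun p hp => ?_
        obtain ⟨hp1, hp2, hp3⟩ := Finset.mem_filter.1 hp
        rcases hX p (hremoved p hp1 hp2).1 with h' | h'
        · have e1 := (rem₁ p h').1 hp2
          have e2 : ¬ (-n₂ < σ * S.kap s) := fun hc => (rem₁ s h).2 hc hs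
          have e3 := hT₁.mono.monotoneOn h' h hp3
          omega
        · exact absurd (h12 s h p h') (not_lt.2 hp3)
      · rw [← hA0]
        refine Finset.sum_congr (Finset.filter_congr fun p hp => ⟨fun h => h.1, fun hp' =>
          ⟨hp', ?_⟩⟩) fun _ _ => rfl
        rcases hX p (hremoved p hp hp').1 with h' | h'
        · exact (h12 p h' s h).le
        · by_contra hc
          have e1 := (rem₂ p h').1 hp'
          have e2 : ¬ (m₁ ≤ σ * S.kap s) := fun hc => (rem₂ s h).2 hc hs
          have e3 := hT₂.mono h h' (not_le.1 hc)
          simp only [neg_mul] at e3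
          omega
    · rw [← hA0]
      refine Finset.sum_congr (Finset.filter_congr fun p hp => ⟨fun h => h.1, fun hp' =>
        ⟨hp', ?_⟩⟩) fun _ _ => rfl
      have e := (mem_arrivals.1 (hremoved p hp hp').1).2
      by_contra hc
      have := hk.arrival_mono hε hkJ hsk hp (not_le.1 hc).le
      linarith
  · have h1 := alive_succ_subset hs
    have h2 := alive_succ_subset hs'
    by_cases hx : S.arrival k s = S.xc (k + 1)
    · have key : ∀ p ∈ X₁, ∀ q ∈ X₂, p ∈ S.alive (k + 1) → q ∈ S.alive (k + 1) → False := by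
        intro p hp q hq hpa hqa
        have e1 : ¬ (-n₂ < σ * S.kap p) := fun hc => (rem₁ p hp).2 hc hpa
        have e2 : ¬ (m₁ ≤ σ * S.kap q) := fun hc => (rem₂ q hq).2 hc hqa
        have e3 := hT₁.mem_Ioc hp
        have e4 := hT₂.mem_Ioc hq
        simp only [neg_mul] at e4
        omega
      rcases hX s (mem_arrivals.2 ⟨h1, hx⟩) with h | h <;>
        rcases hX s' (mem_arrivals.2 ⟨h2, heq ▸ hx⟩) with h' | h'
      · rw [sg₁ s h, sg₁ s' h']
      · exact (key s h s' h' hs hs').elim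
      · exact (key s' h' s h hs' hs).elim
      · rw [sg₂ s h, sg₂ s' h']
    · exact hsgnpx s h1 s' h2 (hother s h1 s' h2 heq hx).1

/-- The removed waves sit at one point and have zero total sign, both altogether and among those
preceding any survivor; so dropping them changes neither `w` nor the formula for the right states.
-/
theorem WaveProfile.succ (hε : 0 < ε) {k : ℕ} (hk : S.WaveProfile k) (hkJ : k < S.J) :
    S.WaveProfile (k + 1) := by
  classical
  obtain ⟨h0, h1, h2⟩ := hk.removed hε hkJ
  have hw : S.w (S.t (k + 1)) = stepSum (S.alive k) (S.arrival k) fun s => ε * S.sgn s :=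
    hk.w_later hε hkJ.le (S.t_lt k hkJ).le fun _ => le_rfl
  have hfilter : ∀ P : ℕ → Prop, [DecidablePred P] →
      ∑ p ∈ S.alive k with P p, S.isgn p = ∑ p ∈ S.alive (k + 1) with P p, S.isgn p +
        ∑ p ∈ S.alive k with p ∉ S.alive (k + 1) ∧ P p, S.isgn p := by
    intro P _
    rw [← Finset.sum_filter_add_sum_filter_not ((S.alive k).filter P) fun p => p ∈ S.alive (k + 1),
      Finset.filter_filter, Finset.filter_filter]
    congr 1
    · refine Finset.sum_congr ?_ fun _ _ => rfl
      ext p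
      simp only [Finset.mem_filter]
      exact ⟨fun h => ⟨h.2.2, h.2.1⟩, fun h => ⟨alive_succ_subset h.1, h.2, h.1⟩⟩
    · exact Finset.sum_congr (Finset.filter_congr fun p _ => and_comm) fun _ _ => rfl
  have hwav (k : ℕ) (P : ℕ → Prop) [DecidablePred P] : ∀ s ∈ (S.alive k).filter P, s ∈ S.waves :=
    fun s hs => S.mem_waves_of_alive (Finset.mem_filter.1 hs).1
  refine ⟨fun s hs s' hs' hss => ?_, ?_, fun s hs => ?_, fun s hs s' hs' heq => ?_⟩
  · rw [px_succ hs, px_succ hs']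
    exact hk.arrival_mono hε hkJ (alive_succ_subset hs) (alive_succ_subset hs') hss.le
  · rw [hw]
    ext x
    have e : ((S.alive (k + 1)).filter fun s => S.px (k + 1) s ≤ x) =
        (S.alive (k + 1)).filter fun s => S.arrival k s ≤ x :=
      Finset.filter_congr fun s hs => by rw [px_succ hs]
    rw [stepSum, stepSum, sum_sgn_eq hε (hwav _ _), sum_sgn_eq hε (hwav _ _), e,
      hfilter fun p => S.arrival k p ≤ x]
    rw [add_eq_left.2]
    have hx : ∀ p ∈ S.alive k, p ∉ S.alive (k + 1) → S.arrival k p = S.xc (k + 1) := by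
      intro p hp hp'
      by_contra hc
      exact hp' (mem_alive_succ.2 ⟨hp, fun h => hc h.1⟩)
    by_cases hxc : S.xc (k + 1) ≤ x
    · rw [← h0]
      refine Finset.sum_congr (Finset.filter_congr fun p hp => ⟨fun h => h.1, fun hp' =>
        ⟨hp', ?_⟩⟩) fun _ _ => rfl
      rwa [hx p hp hp']
    · refine Finset.sum_eq_zero fun p hp => ?_
      obtain ⟨hp1, hp2, hp3⟩ := Finset.mem_filter.1 hp
      rw [hx p hp1 hp2] at hp3
      exact absurd hp3 hxc
  · rw [S.what_eq_of_profile hε hk (alive_succ_subset hs), hfilter fun p => p ≤ s, h1 s hs, add_zero,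
      ← sum_sgn_eq hε (hwav _ _), Finset.mul_sum]
  · rw [px_succ hs, px_succ hs'] at heq
    have := h2 s hs s' hs' heq
    rw [← S.isgn_cast hε (S.mem_waves_of_alive hs), ← S.isgn_cast hε (S.mem_waves_of_alive hs'),
      this]

theorem waveProfile (hε : 0 < ε) {k : ℕ} (hk : k ≤ S.J) : S.WaveProfile k := by
  induction k with
  | zero => exact S.waveProfile_zero hε
  | succ k ih => exact (ih (by omega)).succ hε (by omega)

end WavefrontSolution

namespace WavefrontSolution

variable {f : ℝ → ℝ → ℝ} {ε : ℝ} {S : WavefrontSolution f ε}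

/-! ### Positions of the waves in continuous time -/

theorem t_strictMono {i k : ℕ} (hik : i < k) (hk : k ≤ S.J) : S.t i < S.t k := by
  induction k, hik using Nat.le_induction with
  | base => exact S.t_lt i (by omega)
  | succ k hik ih => exact (ih (by omega)).trans (S.t_lt k (by omega))

theorem t_mono {i k : ℕ} (hik : i ≤ k) (hk : k ≤ S.J) : S.t i ≤ S.t k := by
  rcases hik.eq_or_lt with rfl | h
  · exact le_rfl
  · exact (t_strictMono h hk).le

theorem t_nonneg {k : ℕ} (hk : k ≤ S.J) : 0 ≤ S.t k := S.t_zero ▸ t_mono (Nat.zero_le k) hk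

theorem stage_eq {k : ℕ} (hk : k ≤ S.J) {τ : ℝ} (h1 : S.t k ≤ τ) (h2 : k < S.J → τ < S.t (k + 1)) :
    S.stage τ = k := by
  rw [stage, Nat.findGreatest_eq_iff]
  refine ⟨hk, fun _ => h1, fun n hn hnJ => not_le.2 ?_⟩
  exact (h2 (by omega)).trans_le (t_mono hn hnJ)

theorem stage_t {k : ℕ} (hk : k ≤ S.J) : S.stage (S.t k) = k :=
  stage_eq hk le_rfl fun h => S.t_lt k h

theorem position_t {k : ℕ} (hk : k ≤ S.J) (s : ℕ) : S.position (S.t k) s = S.pos k s := by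
  rw [position, stage_t hk, sub_self, mul_zero, add_zero]
  split_ifs with h
  · exact h.symm
  · obtain ⟨a, ha⟩ := WithTop.ne_top_iff_exists.1 h
    rw [← ha]; rfl

theorem alive_iff {k : ℕ} (hk : k ≤ S.J) {s : ℕ} : S.Alive k s ↔ s ∈ S.alive k := by
  rw [Alive, position_t hk, mem_alive]

theorem alive_of_le {i k : ℕ} (hik : i ≤ k) {s : ℕ} (h : s ∈ S.alive k) : s ∈ S.alive i := by
  induction k, hik using Nat.le_induction with
  | base => exact h
  | succ k hik ih => exact ih (alive_succ_subset h)

theorem pos_eq_iff {k s s' : ℕ} (hs : s ∈ S.alive k) (hs' : s' ∈ S.alive k) :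
    S.pos k s = S.pos k s' ↔ S.px k s = S.px k s' := by
  rw [S.pos_eq_px hs, S.pos_eq_px hs', WithTop.coe_inj]

theorem px_succ_eq_of_joined {k s s' : ℕ} (hs : s ∈ S.alive (k + 1)) (hs' : s' ∈ S.alive (k + 1))
    (h1 : S.px k s = S.px k s') (h2 : S.speed k s = S.speed k s') :
    S.px (k + 1) s = S.px (k + 1) s' := by
  rw [px_succ hs, px_succ hs', arrival, arrival, h1, h2]

/-- If two waves have the same position at time `τ`, they do so at a later collision time. -/
theorem exists_meeting (hε : 0 < ε) {k : ℕ} (hk : k ≤ S.J) {s s' : ℕ} (hs : s ∈ S.alive k)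
    (hs' : s' ∈ S.alive k) {τ : ℝ} (h0 : 0 ≤ τ) (h1 : τ ≤ S.t k)
    (h : S.position τ s = S.position τ s') : ∃ i ≤ k, S.px i s = S.px i s' ∧ τ ≤ S.t i := by
  classical
  obtain ⟨i, hik, hi1, hi2⟩ : ∃ i ≤ k, S.t i ≤ τ ∧ (i < k → τ < S.t (i + 1)) := by
    refine ⟨Nat.findGreatest (fun j => S.t j ≤ τ) k, Nat.findGreatest_le _, ?_, fun hlt => ?_⟩
    · exact Nat.findGreatest_spec (P := fun j => S.t j ≤ τ) (Nat.zero_le k) (by rwa [S.t_zero])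
    · exact not_le.1 (Nat.findGreatest_is_greatest (P := fun j => S.t j ≤ τ) (Nat.lt_succ_self _)
        hlt)
  have hsi := alive_of_le hik hs
  have hsi' := alive_of_le hik hs'
  rcases hi1.eq_or_lt with rfl | hlt
  · rw [position_t (hik.trans hk), position_t (hik.trans hk), pos_eq_iff hsi hsi'] at h
    exact ⟨i, hik, h, le_rfl⟩
  · have hik' : i < k := by
      by_contra hc
      have : i = k := by omega
      subst this
      linarith
    have hst : S.stage τ = i := stage_eq (hik.trans hk) hi1 fun _ => hi2 hik'
    rw [position, position, hst, if_neg (S.mem_alive.1 hsi).2, if_neg (S.mem_alive.1 hsi').2,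
      WithTop.coe_inj] at h
    -- Strictly between collision times, waves at the same place belong to the same front, so they
    -- are still together at the next collision time.
    obtain ⟨e1, e2⟩ := (waveProfile hε (hik.trans hk)).front_eq hε (hik.trans hk) hsi hsi' hlt
      (fun _ => hi2 hik') h
    exact ⟨i + 1, hik', px_succ_eq_of_joined (alive_of_le hik' hs) (alive_of_le hik' hs') e1 e2,
      (hi2 hik').le⟩

/-- Reduces meetings in continuous time to meetings at collision times, on which all inductions run.
-/
theorem alreadyInteracted_iff (hε : 0 < ε) {k : ℕ} (hk : k ≤ S.J) {s s' : ℕ} (hs : s ∈ S.alive k)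
    (hs' : s' ∈ S.alive k) : S.AlreadyInteracted k s s' ↔ ∃ i ≤ k, S.px i s = S.px i s' := by
  constructor
  · rintro ⟨-, -, τ, h0, h1, h⟩
    obtain ⟨i, hi, h2, -⟩ := exists_meeting hε hk hs hs' h0 h1 h
    exact ⟨i, hi, h2⟩
  · rintro ⟨i, hi, h⟩
    refine ⟨(alive_iff hk).2 hs, (alive_iff hk).2 hs', S.t i, t_nonneg (hi.trans hk),
      t_mono hi hk, ?_⟩
    rw [position_t (hi.trans hk), position_t (hi.trans hk),
      pos_eq_iff (alive_of_le hi hs) (alive_of_le hi hs')]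
    exact h

variable (S) in
/-- The waves `s`, `s'`, present at time `t k`, have the same position at time `t i`, and at no
later collision time up to `t k`. -/
structure LastMeet (i k s s' : ℕ) : Prop where
  le_J : k ≤ S.J
  le : i ≤ k
  alive_left : s ∈ S.alive k
  alive_right : s' ∈ S.alive k
  meet : S.px i s = S.px i s'
  later : ∀ l, i < l → l ≤ k → S.px l s ≠ S.px l s'

theorem exists_lastMeet (hε : 0 < ε) {k : ℕ} (hk : k ≤ S.J) {s s' : ℕ}
    (h : S.AlreadyInteracted k s s') : ∃ i, S.LastMeet i k s s' := by
  classical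
  have hs := (alive_iff hk).1 h.1
  have hs' := (alive_iff hk).1 h.2.1
  obtain ⟨i, hi, hm⟩ := (alreadyInteracted_iff hε hk hs hs').1 h
  refine ⟨Nat.findGreatest (fun i => S.px i s = S.px i s') k, hk, Nat.findGreatest_le _, hs, hs',
    Nat.findGreatest_spec (P := fun i => S.px i s = S.px i s') hi hm, fun l h1 h2 =>
    Nat.findGreatest_is_greatest (P := fun i => S.px i s = S.px i s') h1 h2⟩

namespace LastMeet

variable {i k s s' : ℕ}

theorem of_le (h : S.LastMeet i k s s') {l : ℕ} (hil : i ≤ l) (hlk : l ≤ k) :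
    S.LastMeet i l s s' :=
  ⟨hlk.trans h.le_J, hil, alive_of_le hlk h.alive_left, alive_of_le hlk h.alive_right, h.meet,
    fun l' h1 h2 => h.later l' h1 (h2.trans hlk)⟩

theorem alreadyInteracted (h : S.LastMeet i k s s') (hε : 0 < ε) : S.AlreadyInteracted k s s' :=
  (alreadyInteracted_iff hε h.le_J h.alive_left h.alive_right).2 ⟨i, h.le, h.meet⟩

/-- Joined waves would still share their position at time `t (l + 1)`. Hence `piWeight` is not reset
to zero after the last meeting. -/
theorem divided (h : S.LastMeet i k s s') {l : ℕ} (hil : i ≤ l) (hlk : l < k) :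
    S.Divided l s s' := by
  rintro ⟨h1, h2⟩
  have hl := h.of_le hil hlk.le
  rw [position_t hl.le_J, position_t hl.le_J, pos_eq_iff hl.alive_left hl.alive_right] at h1
  exact h.later (l + 1) (by omega) hlk (px_succ_eq_of_joined (alive_of_le hlk h.alive_left)
    (alive_of_le hlk h.alive_right) h1 h2)

theorem lastTime_eq (h : S.LastMeet i k s s') (hε : 0 < ε) : S.lastTime k s s' = S.t i := by
  have hi := h.of_le le_rfl h.le
  refine IsGreatest.csSup_eq ⟨⟨t_nonneg hi.le_J, t_mono h.le h.le_J, ?_⟩, ?_⟩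
  · rw [position_t hi.le_J, position_t hi.le_J, pos_eq_iff hi.alive_left hi.alive_right]
    exact h.meet
  · rintro τ ⟨h0, h1, h2⟩
    obtain ⟨l, hl1, hl2, hl3⟩ := exists_meeting hε h.le_J h.alive_left h.alive_right h0 h1 h2
    refine hl3.trans (t_mono ?_ hi.le_J)
    by_contra hc
    exact h.later l (not_le.1 hc) hl1 hl2

theorem mem_interval (h : S.LastMeet i k s s') (hε : 0 < ε) {p : ℕ} :
    p ∈ S.interval k s s' ↔ p ∈ S.alive k ∧ S.px i p = S.px i s := by
  have hi := h.of_le le_rfl h.le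
  rw [interval, Set.mem_ofPred_eq, h.lastTime_eq hε, position_t hi.le_J, position_t hi.le_J,
    alive_iff h.le_J]
  constructor
  · rintro ⟨h1, h2⟩
    exact ⟨h1, (pos_eq_iff (alive_of_le h.le h1) hi.alive_left).1 h2⟩
  · rintro ⟨h1, h2⟩
    exact ⟨h1, (pos_eq_iff (alive_of_le h.le h1) hi.alive_left).2 h2⟩

theorem partRel_self (h : S.LastMeet i i s s') (hε : 0 < ε) {p p' : ℕ} :
    S.partRel i s s' p p' ↔ p ∈ S.interval i s s' ∧ p' ∈ S.interval i s s' ∧ ¬ S.Divided i p p' := by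
  cases i with
  | zero => rfl
  | succ i => rw [partRel, h.lastTime_eq hε]; simp

theorem partRel_succ (h : S.LastMeet i (k + 1) s s') (hε : 0 < ε) (hik : i ≤ k) {p p' : ℕ} :
    S.partRel (k + 1) s s' p p' ↔ p ∈ S.alive (k + 1) ∧ p' ∈ S.alive (k + 1) ∧
      S.partRel k s s' p p' ∧
      S.NotDividedEff (k + 1) {q | S.partRel k s s' p q ∧ q ∈ S.alive (k + 1)} p p' := by
  have hne : S.t i ≠ S.t (k + 1) := (t_strictMono (by omega) h.le_J).ne
  rw [partRel, h.lastTime_eq hε]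
  simp only [hne, false_and, false_or, ne_eq, not_false_eq_true, true_and, alive_iff h.le_J]

end LastMeet

/-! ### Change of the values of `v` along a wave -/

/-- The speed is the slope of a chord of `f(·, v)` between two states of `[-r, r]`, hence by the
mean value theorem a value of `∂f/∂w` on that range. -/
theorem one_lt_speed (hf : IsAdmissibleFlux f) {r : ℝ}
    (hyp : ∀ w v : ℝ, |w| ≤ r → |v| ≤ r → -1 < deriv (fun w' => f w' v) w)
    (hε : 0 < ε) (hw : ∀ x, |S.w 0 x| ≤ r) (hv : ∀ x, |S.v 0 x| ≤ r) {k : ℕ} (hk : k ≤ S.J) {s : ℕ}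
    (hs : s ∈ S.alive k) (hpos : S.isgn s = 1) : -1 < S.speed k s := by
  have hs' : s ∈ S.wavesAt k (S.px k s) := S.mem_wavesAt.2 ⟨hs, rfl⟩
  obtain ⟨σ, m, n, hσ, hT, -⟩ := (waveProfile hε hk).exists_isTile_wavesAt hε ⟨s, hs'⟩
  have : σ = 1 := by rw [← hT.isgn_eq s hs', hpos]
  subst this
  rw [S.speed_eq_entSpeed hs, hT.entSpeed_pos hε _ hs']
  have hmem := hT.mem_Ioc hs'
  rw [one_mul] at hmem
  set v := S.v (S.t k) (S.px k s) with hvdef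
  have hvr : |v| ≤ r := by rw [hvdef, S.v_eq _ (t_nonneg hk)]; exact hv _
  obtain ⟨a, b, h1, h2, h3, h4, -, h6, -⟩ := envSlope_class hε (fun u => f u v) hmem.1 hmem.2
  have hab : (a : ℝ) * ε < b * ε := mul_lt_mul_of_pos_right
    (by exact_mod_cast (show a < b by omega)) hε
  have hbr : (b : ℝ) * ε ≤ r := by
    obtain ⟨q, hq, hqn⟩ := hT.exists_mem hT.lt le_rfl
    rw [one_mul] at hqn
    have e := (S.abs_what_le hε hw (hT.mem_waves q hq)).1
    rw [S.what_eq_kap hε (hT.mem_waves q hq), hqn] at e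
    have : (b : ℝ) ≤ n := by exact_mod_cast h4
    nlinarith [le_abs_self ((n : ℝ) * ε)]
  have har : -r ≤ (a : ℝ) * ε := by
    obtain ⟨q, hq, hqn⟩ := hT.exists_mem (i := m + 1) (by omega) (by have := hT.lt; omega)
    rw [one_mul] at hqn
    have e := (S.abs_what_le hε hw (hT.mem_waves q hq)).2
    rw [S.what_eq_kap hε (hT.mem_waves q hq), hqn, hT.sgn_eq hε hq] at e
    have h7 : (m : ℝ) ≤ a := by exact_mod_cast h1
    push_cast at e
    rw [abs_le] at e
    nlinarith
  obtain ⟨ξ, hξ, hd⟩ := exists_deriv_eq_slope (fun u => f u v) hab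
    (hf.differentiable v).continuous.continuousOn (hf.differentiable v).differentiableOn
  have := hyp ξ v (abs_le.2 ⟨by linarith [hξ.1], by linarith [hξ.2]⟩) hvr
  rw [hd, h6, mul_div_cancel_right₀ _ (by linarith)] at this
  exact this

theorem leftLim_shift (u : ℝ → ℝ) (c : ℝ) (hu : ∀ y, ∃ l, ∀ᶠ x in nhdsWithin y (Iio y), u x = l)
    (x : ℝ) : Function.leftLim (fun x => u (x + c)) x = Function.leftLim u (x + c) := by
  obtain ⟨l, hl⟩ := hu (x + c)
  have e1 : Function.leftLim u (x + c) = l :=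
    leftLim_eq_of_tendsto (tendsto_const_nhds.congr' (hl.mono fun _ h => h.symm))
  rw [e1]
  refine leftLim_eq_of_tendsto (tendsto_const_nhds.congr' ?_)
  have ht : Filter.Tendsto (fun x => x + c) (nhdsWithin x (Iio x)) (nhdsWithin (x + c) (Iio (x + c))) :=
    ((continuous_add_const c).continuousWithinAt.tendsto_nhdsWithin fun y hy => by
      simpa using hy)
  exact (ht.eventually hl).mono fun _ h => h.symm

theorem leftLim_v (hε : 0 < ε) {τ : ℝ} (hτ : 0 ≤ τ) (x : ℝ) :
    Function.leftLim (S.v τ) x = Function.leftLim (S.v 0) (x + τ) := by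
  rw [show S.v τ = fun x => S.v 0 (x + τ) from funext (S.v_eq τ hτ)]
  exact leftLim_shift _ _ (fun y => ⟨_, S.eventually_v_left hε y⟩) x

/-- The value of `v` along a positive wave changes only at transversal interactions. -/
theorem v_along_wave (hf : IsAdmissibleFlux f) {r : ℝ}
    (hyp : ∀ w v : ℝ, |w| ≤ r → |v| ≤ r → -1 < deriv (fun w' => f w' v) w)
    (hε : 0 < ε) (hw : ∀ x, |S.w 0 x| ≤ r) (hv : ∀ x, |S.v 0 x| ≤ r) {k : ℕ} (hk : k < S.J) {s : ℕ}
    (hs : s ∈ S.alive (k + 1)) (hpos : S.isgn s = 1) :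
    S.v (S.t (k + 1)) (S.px (k + 1) s) = S.v (S.t k) (S.px k s) ∨
    S.Transversal k ∧ S.px (k + 1) s = S.xc (k + 1) ∧
      |S.v (S.t (k + 1)) (S.px (k + 1) s) - S.v (S.t k) (S.px k s)| = S.vStrength (k + 1) := by
  have hsk := alive_succ_subset hs
  have hprof := waveProfile (S := S) hε hk.le
  have hsp := one_lt_speed hf hyp hε hw hv hk.le hsk hpos
  have ht := S.t_lt k hk
  have ht0 := t_nonneg (S := S) hk.le
  have ht1 := t_nonneg (S := S) (show k + 1 ≤ S.J from hk)
  rw [px_succ hs, S.v_eq _ ht1, S.v_eq _ ht0]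
  -- Since `v` depends only on `x + t`, this is the coordinate to follow; along the wave it
  -- increases from `y₁` to `y₂` because the speed exceeds `-1`.
  set y₁ := S.px k s + S.t k with hy₁
  set y₂ := S.arrival k s + S.t (k + 1) with hy₂
  have hy : y₂ - y₁ = (1 + S.speed k s) * (S.t (k + 1) - S.t k) := by
    rw [hy₁, hy₂, arrival]; ring
  have hlt : y₁ < y₂ := by
    have : 0 < (1 + S.speed k s) * (S.t (k + 1) - S.t k) :=
      mul_pos (by linarith) (by linarith)
    linarith
  by_cases heq : S.v 0 y₂ = S.v 0 y₁
  · exact Or.inl heq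
  right
  -- A jump of the initial `v` at `y` is a front of the first family that the wave crosses after the
  -- time `θ`. By `no_collision` this can happen only at the next collision time, which means `y =
  -- y₂`.
  have key : ∀ y ∈ Ioc y₁ y₂, Function.leftLim (S.v 0) y ≠ S.v 0 y →
      y = y₂ ∧ S.arrival k s = S.xc (k + 1) ∧ S.Transversal k := by
    intro y hy' hj
    have hc : (⟨.first, y - S.t k, -1⟩ : Front) ∈ S.fronts k := by
      change Function.leftLim (S.v (S.t k)) (y - S.t k) ≠ S.v (S.t k) (y - S.t k) ∧ _
      rw [leftLim_v hε ht0, S.v_eq _ ht0, sub_add_cancel]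
      exact ⟨hj, rfl⟩
    have hcs := hprof.front_mem hε hsk
    have hne : (⟨.first, y - S.t k, -1⟩ : Front) ≠ ⟨.second, S.px k s, S.speed k s⟩ := by
      rw [Ne, Front.mk.injEq]
      rintro ⟨h, -⟩
      cases h
    set θ := (y - y₁) / (1 + S.speed k s) with hθ
    have hsp' : 0 < 1 + S.speed k s := by linarith
    have hθe : (1 + S.speed k s) * θ = y - y₁ := by rw [hθ]; field_simp
    have hθ0 : 0 < θ := div_pos (by linarith [hy'.1]) hsp'
    have hmeet : (⟨.first, y - S.t k, -1⟩ : Front).pos θ =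
        (⟨.second, S.px k s, S.speed k s⟩ : Front).pos θ := by
      simp only [Front.pos]
      rw [hy₁] at hθe
      linarith
    have hθT : θ = S.t (k + 1) - S.t k := by
      by_contra hne'
      have hθlt : θ < S.t (k + 1) - S.t k := by
        refine lt_of_le_of_ne ?_ hne'
        rw [hθ, div_le_iff₀ hsp']
        linarith [hy'.2]
      refine hne (S.no_collision k hk.le (S.t k + θ) (by linarith) (fun _ => by linarith) _ hc _ hcs
        ?_)
      rw [add_sub_cancel_left]; exact hmeet
    rw [hθT] at hθe hmeet
    obtain ⟨a, ha, b, hb, hab, hax, hbx, huniq⟩ := S.collision k hk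
    have hposx : (⟨.second, S.px k s, S.speed k s⟩ : Front).pos (S.t (k + 1) - S.t k) =
        S.xc (k + 1) := by
      rcases (huniq _ hc _ hcs hne hmeet).2 with h | h <;> rw [h] <;> assumption
    exact ⟨by linarith, hposx, _, _, ⟨hc, hcs, hne, hmeet.trans hposx, hposx⟩, rfl, rfl⟩
  obtain ⟨y, hy', hj⟩ := S.exists_jump_of_v_ne hε hlt.le (Ne.symm heq)
  obtain ⟨-, hx, htr⟩ := key y hy' hj
  refine ⟨htr, hx, ?_⟩
  -- There is no jump strictly between `y₁` and `y₂`, so the value at `y₁` persists up to `y₂`.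
  have hleft : Function.leftLim (S.v 0) y₂ = S.v 0 y₁ := by
    have hnear : ∀ᶠ z in nhdsWithin y₂ (Iio y₂), z ∈ Ioi y₁ :=
      nhdsWithin_le_nhds (Ioi_mem_nhds hlt)
    obtain ⟨z, hz1, hz2, hz3⟩ := ((S.eventually_v_left hε y₂).and
      (hnear.and self_mem_nhdsWithin)).exists
    rw [← hz1]
    by_contra hne
    obtain ⟨y, hy', hj⟩ := S.exists_jump_of_v_ne hε (le_of_lt hz2) (Ne.symm hne)
    have := (key y ⟨hy'.1, hy'.2.trans (le_of_lt hz3)⟩ hj).1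
    have h4 := hy'.2
    rw [this] at h4
    exact absurd h4 (not_le.2 hz3)
  rw [vStrength, leftLim_v hε ht1, S.v_eq _ ht1, ← hx, ← hy₂, hleft]

/-- At a transversal interaction no wave is removed. -/
theorem survives_of_transversal (hε : 0 < ε) {k : ℕ} (hk : k < S.J) (htr : S.Transversal k) {s : ℕ}
    (hs : s ∈ S.alive k) : s ∈ S.alive (k + 1) := by
  have hprof := waveProfile (S := S) hε hk.le
  rw [mem_alive_succ]
  refine ⟨hs, fun ⟨h1, h2⟩ => h2 ?_⟩
  obtain ⟨c, d, hcd, hc, hd⟩ := htr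
  obtain ⟨a, b, hab, hfront, -, huniq⟩ := hprof.exists_collision hε hk
  -- One of the two colliding fronts is of the first family, so all arriving waves belong to the
  -- other one and have the same sign.
  have hfd : ∀ p ∈ S.arrivals k, (⟨.second, S.px k p, S.speed k p⟩ : Front) = d := by
    intro p hp
    obtain ⟨hp1, hp2⟩ := mem_arrivals.1 hp
    have e := hfront p hp1 hp2
    obtain ⟨e1, e2⟩ := huniq c d hcd
    have hne : ∀ x : Front, (⟨.second, S.px k p, S.speed k p⟩ : Front) = x → x ≠ c := by
      rintro x rfl rfl
      cases hc
    have hcd' := hcd.2.2.1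
    rcases e with e | e <;> rcases e1 with e1 | e1 <;> rcases e2 with e2 | e2
    · exact absurd (e1.trans e2.symm) hcd'
    · exact absurd e1.symm (hne _ e)
    · exact e.trans e2.symm
    · exact absurd (e1.trans e2.symm) hcd'
    · exact absurd (e1.trans e2.symm) hcd'
    · exact e.trans e2.symm
    · exact absurd e1.symm (hne _ e)
    · exact absurd (e1.trans e2.symm) hcd'
  have hs' : s ∈ S.arrivals k := mem_arrivals.2 ⟨hs, h1⟩
  refine hprof.survives_of_homogeneous hε hk (S.isgn_cases s) (fun p hp => ?_) hs'
  have e := (hfd p hp).trans (hfd s hs').symm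
  rw [Front.mk.injEq] at e
  rw [isgn, isgn, hprof.sgn_eq p (mem_arrivals.1 hp).1 s hs e.2.1]

end WavefrontSolution

namespace WavefrontSolution

variable {f : ℝ → ℝ → ℝ} {ε : ℝ} {S : WavefrontSolution f ε}

/-! ### Entropic speeds in tiles -/

section
variable {D D' : Set ℕ} {m n m' n' : ℤ}

theorem IsTile.bounds_of_subset (h : S.IsTile 1 D m n) (h' : S.IsTile 1 D' m' n') (hDD : D ⊆ D') :
    m' ≤ m ∧ n ≤ n' := by
  have hlt := h.lt
  obtain ⟨p, hp, hp'⟩ := h.exists_mem (i := m + 1) (by omega) (by omega)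
  obtain ⟨q, hq, hq'⟩ := h.exists_mem (i := n) (by omega) le_rfl
  have e1 := h'.mem_Ioc (hDD hp)
  have e2 := h'.mem_Ioc (hDD hq)
  omega

theorem IsTile.subset_of_bounds (h : S.IsTile 1 D m n) {a b : ℤ} (hma : m ≤ a) (hab : a < b)
    (hbn : b ≤ n) : S.IsTile 1 {q ∈ D | a < S.kap q ∧ S.kap q ≤ b} a b where
  mem_waves s hs := h.mem_waves s hs.1
  isgn_eq s hs := h.isgn_eq s hs.1
  mono := h.mono.mono fun _ hs => hs.1
  image := by
    ext i
    constructor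
    · rintro ⟨s, hs, rfl⟩
      simp only [one_mul]
      exact hs.2
    · rintro ⟨h1, h2⟩
      obtain ⟨s, hs, hsi⟩ := h.exists_mem (i := i) (by omega) (by omega)
      refine ⟨s, ⟨hs, ?_, ?_⟩, hsi⟩ <;> omega
  lt := hab

theorem IsTile.le_iff (h : S.IsTile 1 D m n) {p q : ℕ} (hp : p ∈ D) (hq : q ∈ D) :
    S.kap p ≤ S.kap q ↔ p ≤ q := by
  have := h.mono.le_iff_le hp hq
  simpa only [one_mul] using this

/-- The class of `p` for the entropic speed. -/
theorem IsTile.speed_class (h : S.IsTile 1 D m n) (hε : 0 < ε) (F : ℝ → ℝ) {p : ℕ} (hp : p ∈ D) :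
    ∃ a b, S.IsTile 1 {q ∈ D | S.entSpeed F D q = S.entSpeed F D p} a b ∧
      rhSpeed F (S.span {q ∈ D | S.entSpeed F D q = S.entSpeed F D p}) = S.entSpeed F D p ∧
      ∀ q ∈ D, S.entSpeed F D q = S.entSpeed F D p →
        S.entSpeed F {q ∈ D | S.entSpeed F D q = S.entSpeed F D p} q = S.entSpeed F D p := by
  have hk := h.mem_Ioc hp
  rw [one_mul] at hk
  obtain ⟨a, b, h1, h2, h3, h4, h5, h6, h7⟩ := envSlope_class hε F hk.1 hk.2
  have hset : {q ∈ D | S.entSpeed F D q = S.entSpeed F D p} =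
      {q ∈ D | a < S.kap q ∧ S.kap q ≤ b} := by
    ext q
    simp only [Set.mem_ofPred_eq]
    refine and_congr_right fun hq => ?_
    have hkq := h.mem_Ioc hq
    rw [one_mul] at hkq
    rw [h.entSpeed_pos hε F hq, h.entSpeed_pos hε F hp, h5 _ hkq.1 hkq.2]
  have hT := h.subset_of_bounds h1 (by omega) h4
  rw [hset]
  refine ⟨a, b, hT, ?_, fun q hq hqe => ?_⟩
  · have hab : (a : ℝ) * ε < b * ε := hT.bounds_lt hε
    rw [hT.rhSpeed_eq hε, h6, h.entSpeed_pos hε F hp, mul_div_cancel_right₀]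
    linarith
  · have hq' : q ∈ {q ∈ D | a < S.kap q ∧ S.kap q ≤ b} := by rw [← hset]; exact ⟨hq, hqe⟩
    rw [hT.entSpeed_pos hε F hq', h.entSpeed_pos hε F hp, h7 _ hq'.2.1 hq'.2.2]

theorem IsTile.entSpeed_eq_of_subset (h : S.IsTile 1 D m n) (h' : S.IsTile 1 D' m' n')
    (hε : 0 < ε) (hDD : D ⊆ D') (F : ℝ → ℝ) {p q : ℕ} (hp : p ∈ D) (hq : q ∈ D)
    (heq : S.entSpeed F D p = S.entSpeed F D q) : S.entSpeed F D' p = S.entSpeed F D' q := by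
  obtain ⟨hm, hn⟩ := h.bounds_of_subset h' hDD
  rw [h.entSpeed_pos hε F hp, h.entSpeed_pos hε F hq] at heq
  rw [h'.entSpeed_pos hε F (hDD hp), h'.entSpeed_pos hε F (hDD hq)]
  have hkp := h.mem_Ioc hp
  have hkq := h.mem_Ioc hq
  rw [one_mul] at hkp hkq
  rcases le_total (S.kap p) (S.kap q) with hpq | hpq
  · exact envSlope_eq_of_subset hε F hm hn hkp.1 hpq hkq.2 heq
  · exact (envSlope_eq_of_subset hε F hm hn hkq.1 hpq hkp.2 heq.symm).symm

/-- `D` is `D'` cut on the left and prolonged on the right, which lowers the speed; the change of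
flux costs at most `c`, and the derivatives are compared only on the overlap of the two tiles. -/
theorem IsTile.entSpeed_le_add (h : S.IsTile 1 D m n) (h' : S.IsTile 1 D' m' n')
    (hε : 0 < ε) (hm : m' ≤ m) (hn : n' ≤ n) {F F' : ℝ → ℝ} (hF : Differentiable ℝ F)
    (hF' : Differentiable ℝ F') {c : ℝ}
    (hc : ∀ u ∈ Icc ((m : ℝ) * ε) (n' * ε), deriv F u - deriv F' u ≤ c) {p : ℕ} (hp : p ∈ D)
    (hp' : p ∈ D') : S.entSpeed F D p ≤ S.entSpeed F' D' p + c := by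
  rw [h.entSpeed_pos hε F hp, h'.entSpeed_pos hε F' hp']
  have hkp := h.mem_Ioc hp
  have hkp' := h'.mem_Ioc hp'
  rw [one_mul] at hkp hkp'
  refine envSlope_le_add hε F hm hn hkp.1 hkp'.2 fun a b h1 h2 h3 => ?_
  have ha : (m : ℝ) * ε ≤ a * ε := mul_le_mul_of_nonneg_right (by exact_mod_cast h1) hε.le
  have hb : (b : ℝ) * ε ≤ n' * ε := mul_le_mul_of_nonneg_right (by exact_mod_cast h3) hε.le
  have hab : (a : ℝ) * ε ≤ b * ε := mul_le_mul_of_nonneg_right (by exact_mod_cast h2) hε.le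
  have hd : Differentiable ℝ fun u => F u - F' u := hF.sub hF'
  exact (convex_Icc ((m : ℝ) * ε) (n' * ε)).image_sub_le_mul_sub_of_deriv_le
    (f := fun u => F u - F' u) hd.continuous.continuousOn hd.differentiableOn
    (fun u hu => by
      rw [deriv_fun_sub (hF u) (hF' u)]
      exact hc u (interior_subset hu))
    _ ⟨ha, hab.trans hb⟩ _ ⟨ha.trans hab, hb⟩ hab

/-- The oscillation of a Lipschitz function on the union of the segments of a tile. -/
theorem IsTile.abs_sub_le_sum {A : Finset ℕ} (h : S.IsTile 1 (A : Set ℕ) m n) (hε : 0 < ε)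
    {δ : ℝ → ℝ} {K : NNReal} (hδ : LipschitzWith K δ) (c : ℕ → ℝ) (hc : ∀ q ∈ A, 0 ≤ c q)
    (hbd : ∀ q ∈ A, ∀ᵐ x ∂(volume : Measure ℝ), x ∈ S.seg q → |deriv δ x| ≤ c q) {u u' : ℝ}
    (hu : u ∈ Icc ((m : ℝ) * ε) (n * ε)) (hu' : u' ∈ Icc ((m : ℝ) * ε) (n * ε)) :
    |δ u' - δ u| ≤ ∑ q ∈ A, c q * ε := by
  wlog huu : u ≤ u' generalizing u u'
  · rw [abs_sub_comm]
    exact this hu' hu (le_of_not_ge huu)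
  refine (abs_sub_le_sum_of_ae_deriv_bound hδ A (fun q => (S.kap q : ℝ) * ε - ε)
    (fun q => (S.kap q : ℝ) * ε) c (fun q _ => by linarith) hc (fun q hq => ?_) huu ?_).trans_eq
    (Finset.sum_congr rfl fun q _ => by ring)
  · rw [← h.seg_eq hε hq]
    exact hbd q hq
  · intro x hx
    have : x ∈ S.span A := by
      rw [h.span_pos hε]
      exact ⟨hu.1.trans_lt hx.1, hx.2.trans hu'.2⟩
    rw [span, mem_iUnion₂] at this
    obtain ⟨q, hq, hxq⟩ := this
    rw [h.seg_eq hε hq] at hxq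
    exact mem_iUnion₂.2 ⟨q, hq, hxq⟩

end

/-! ### Homogeneous intervals of positive waves and effective fluxes -/

variable (S) in
/-- The positive homogeneous intervals of waves at time `t k`. -/
structure IsBlock (k : ℕ) (D : Set ℕ) : Prop where
  alive : ∀ s ∈ D, s ∈ S.alive k
  pos : ∀ s ∈ D, S.isgn s = 1
  conv : ∀ a ∈ D, ∀ b ∈ D, ∀ q ∈ S.alive k, a ≤ q → q ≤ b → q ∈ D

theorem IsBlock.finite {k : ℕ} {D : Set ℕ} (h : S.IsBlock k D) : D.Finite :=
  (S.alive k).finite_toSet.subset h.alive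

theorem IsBlock.exists_tile {k : ℕ} {D : Set ℕ} (h : S.IsBlock k D) (hε : 0 < ε) (hk : k ≤ S.J)
    (hne : D.Nonempty) : ∃ m n, S.IsTile 1 D m n ∧ n = m + D.ncard := by
  have hfin := h.finite
  obtain ⟨m, n, hT, hn, -⟩ := S.exists_isTile hε (waveProfile hε hk) (Or.inl rfl)
    (D := hfin.toFinset) (fun s hs => h.alive s (hfin.mem_toFinset.1 hs))
    (hfin.toFinset_nonempty.2 hne) (fun s hs => h.pos s (hfin.mem_toFinset.1 hs))
    (fun a ha b hb q hq h1 h2 => hfin.mem_toFinset.2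
      (h.conv a (hfin.mem_toFinset.1 ha) b (hfin.mem_toFinset.1 hb) q hq h1 h2))
  rw [hfin.coe_toFinset] at hT
  exact ⟨m, n, hT, by rw [hn, ncard_eq_toFinset_card _ hfin]⟩

theorem IsEffectiveFlux.mono {k : ℕ} {M M' : Set ℕ} {F : ℝ → ℝ} (h : S.IsEffectiveFlux k M F)
    (hM : M' ⊆ M) : S.IsEffectiveFlux k M' F :=
  ⟨h.1, h.2.1, fun s hs => h.2.2 s (hM hs)⟩

theorem IsEffectiveFlux.differentiable {k : ℕ} {M : Set ℕ} {F : ℝ → ℝ}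
    (h : S.IsEffectiveFlux k M F) : Differentiable ℝ F := h.1.differentiable one_ne_zero

theorem position_untopD {k : ℕ} (hk : k ≤ S.J) (s : ℕ) :
    (S.position (S.t k) s).untopD 0 = S.px k s := by
  rw [position_t hk, px]

/-- Links effective fluxes to true speeds: where all waves see the same `v`, in particular at one
point, the flux of the Riemann problem is itself effective. -/
theorem isEffectiveFlux_slice (hf : IsAdmissibleFlux f) {k : ℕ} (hk : k ≤ S.J) {M : Set ℕ} {v : ℝ}
    (hv : ∀ s ∈ M, S.v (S.t k) (S.px k s) = v) : S.IsEffectiveFlux k M fun u => f u v := by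
  refine ⟨contDiff_one_iff_deriv.2 ⟨hf.differentiable v, (hf.lipschitzWith_deriv v).continuous⟩,
    ⟨_, hf.lipschitzWith_deriv v⟩, fun s hs => Filter.Eventually.of_forall fun u _ => ?_⟩
  rw [position_untopD hk, hv s hs]
  exact hf.hasDerivAt_deriv u v

theorem IsBlock.exists_isEffectiveFlux (hf : IsAdmissibleFlux f) {k : ℕ} {D : Set ℕ}
    (h : S.IsBlock k D) (hε : 0 < ε) (hk : k ≤ S.J) (hne : D.Nonempty) :
    ∃ F, S.IsEffectiveFlux k D F := by
  obtain ⟨m, n, hT, -⟩ := h.exists_tile hε hk hne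
  have hfin := h.finite
  obtain ⟨F, h1, h2, h3⟩ := exists_piecewise_flux hf hfin.toFinset S.kap (by
    rw [hfin.coe_toFinset]
    intro p hp q hq hpq
    exact hT.mono.injOn hp hq (by simp only [hpq])) (fun s => S.v (S.t k) (S.px k s)) hε
  refine ⟨F, h1, h2, fun s hs => ?_⟩
  rw [hT.seg_eq hε hs, position_untopD hk]
  exact h3 s (hfin.mem_toFinset.2 hs)

/-- Comparison of effective fluxes at two times on a common set of waves. -/
theorem effectiveFlux_compare (hf : IsAdmissibleFlux f) (hε : 0 < ε) {k k' : ℕ} (hk : k ≤ S.J)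
    (hk' : k' ≤ S.J) {A : Finset ℕ} {m n : ℤ} (hT : S.IsTile 1 (A : Set ℕ) m n) {F F' : ℝ → ℝ}
    (hF : S.IsEffectiveFlux k A F) (hF' : S.IsEffectiveFlux k' A F') {u u' : ℝ}
    (hu : u ∈ Icc ((m : ℝ) * ε) (n * ε)) (hu' : u' ∈ Icc ((m : ℝ) * ε) (n * ε)) :
    |(deriv F u' - deriv F' u') - (deriv F u - deriv F' u)| ≤
      ∑ q ∈ A, normD3 f * |S.v (S.t k) (S.px k q) - S.v (S.t k') (S.px k' q)| * ε := by
  obtain ⟨-, ⟨K, hK⟩, h3⟩ := hF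
  obtain ⟨-, ⟨K', hK'⟩, h3'⟩ := hF'
  refine hT.abs_sub_le_sum hε (hK.sub hK') _
    (fun q _ => mul_nonneg (normD3_nonneg f) (abs_nonneg _)) (fun q hq => ?_) hu hu'
  filter_upwards [h3 q hq, h3' q hq] with x hx hx' hxq
  rw [((hx hxq).fun_sub (hx' hxq)).deriv, position_untopD hk, position_untopD hk']
  exact hf.abs_fww_sub_le _ _ _

/-- Two effective fluxes at the same time give the same speeds, up to a constant. -/
theorem effectiveFlux_entSpeed (hf : IsAdmissibleFlux f) (hε : 0 < ε) {k : ℕ} (hk : k ≤ S.J)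
    {D : Set ℕ} {m n : ℤ} (hT : S.IsTile 1 D m n) {F F' : ℝ → ℝ} (hF : S.IsEffectiveFlux k D F)
    (hF' : S.IsEffectiveFlux k D F') :
    ∃ c, ∀ p ∈ D, S.entSpeed F D p = S.entSpeed F' D p + c := by
  have hfin := hT.finite
  obtain ⟨A, rfl⟩ := hfin.exists_finset_coe
  have hlt := hT.bounds_lt hε
  set u₀ := (m : ℝ) * ε
  have key : ∀ u ∈ Icc ((m : ℝ) * ε) (n * ε),
      deriv F u - deriv F' u = deriv F u₀ - deriv F' u₀ := by
    intro u hu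
    have := effectiveFlux_compare hf hε hk hk hT hF hF' (u := u₀) (u' := u) ⟨le_rfl, hlt.le⟩ hu
    simp only [sub_self, abs_zero, mul_zero, zero_mul, Finset.sum_const_zero] at this
    have := abs_nonpos_iff.1 this
    linarith
  refine ⟨deriv F u₀ - deriv F' u₀, fun p hp => le_antisymm ?_ ?_⟩
  · exact hT.entSpeed_le_add hT hε le_rfl le_rfl hF.differentiable hF'.differentiable
      (fun u hu => (key u hu).le) hp hp
  · have := hT.entSpeed_le_add hT hε le_rfl le_rfl hF'.differentiable hF.differentiable
      (c := -(deriv F u₀ - deriv F' u₀)) (fun u hu => by linarith [key u hu]) hp hp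
    linarith

theorem sgn_eq_one_iff (hε : 0 < ε) {s : ℕ} (hs : s ∈ S.waves) : S.sgn s = 1 ↔ S.isgn s = 1 := by
  rw [← S.isgn_cast hε hs]
  exact_mod_cast Iff.rfl

theorem isBlock_homComponent (hε : 0 < ε) {k : ℕ} (hk : k ≤ S.J) {p : ℕ} (hp : p ∈ S.alive k)
    (hpos : S.isgn p = 1) : S.IsBlock k (S.homComponent k p) where
  alive s hs := (alive_iff hk).1 hs.1
  pos s hs := by
    have h1 := (alive_iff hk).1 hs.1
    have := hs.2 s hs.1 (min_le_right _ _) (le_max_right _ _)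
    rw [← sgn_eq_one_iff hε (S.mem_waves_of_alive h1), this,
      sgn_eq_one_iff hε (S.mem_waves_of_alive hp)]
    exact hpos
  conv a ha b hb q hq h1 h2 := by
    refine ⟨(alive_iff hk).2 hq, fun q' hq' h3 h4 => ?_⟩
    rcases le_total p q with h | h
    · rw [min_eq_left h] at h3
      rw [max_eq_right h] at h4
      exact hb.2 q' hq' ((min_le_left _ _).trans h3) (h4.trans (h2.trans (le_max_right _ _)))
    · rw [min_eq_right h] at h3
      rw [max_eq_left h] at h4
      exact ha.2 q' hq' ((min_le_right _ _).trans (h1.trans h3)) (h4.trans (le_max_left _ _))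

theorem IsBlock.subset_homComponent {k : ℕ} {D : Set ℕ} (h : S.IsBlock k D) (hε : 0 < ε)
    (hk : k ≤ S.J) {p : ℕ} (hp : p ∈ D) : D ⊆ S.homComponent k p := by
  intro s hs
  refine ⟨(alive_iff hk).2 (h.alive s hs), fun q hq h1 h2 => ?_⟩
  have hq' := (alive_iff hk).1 hq
  have hqD : q ∈ D := by
    rcases le_total p s with hps | hps
    · rw [min_eq_left hps] at h1
      rw [max_eq_right hps] at h2
      exact h.conv p hp s hs q hq' h1 h2
    · rw [min_eq_right hps] at h1
      rw [max_eq_left hps] at h2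
      exact h.conv s hs p hp q hq' h1 h2
  rw [(sgn_eq_one_iff hε (S.mem_waves_of_alive hq')).2 (h.pos q hqD),
    (sgn_eq_one_iff hε (S.mem_waves_of_alive (h.alive p hp))).2 (h.pos p hp)]

/-- On `D` the derivatives of two effective fluxes differ by a constant, so their speeds do too, and
any effective flux on `D` decides; it need not be one for the whole maximal homogeneous interval. -/
theorem IsBlock.notDividedEff_iff (hf : IsAdmissibleFlux f) {k : ℕ} {D : Set ℕ}
    (h : S.IsBlock k D) (hε : 0 < ε) (hk : k ≤ S.J) {F : ℝ → ℝ} (hF : S.IsEffectiveFlux k D F)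
    {p p' : ℕ} (hp : p ∈ D) (hp' : p' ∈ D) :
    S.NotDividedEff k D p p' ↔ S.entSpeed F D p = S.entSpeed F D p' := by
  obtain ⟨m, n, hT, -⟩ := h.exists_tile hε hk ⟨p, hp⟩
  have hsub := h.subset_homComponent hε hk hp
  constructor
  · rintro ⟨F', hF', heq⟩
    obtain ⟨c, hc⟩ := effectiveFlux_entSpeed hf hε hk hT hF (hF'.mono hsub)
    rw [hc p hp, hc p' hp', heq]
  · intro heq
    obtain ⟨F', hF'⟩ := (isBlock_homComponent hε hk (h.alive p hp)
      (h.pos p hp)).exists_isEffectiveFlux hf hε hk ⟨p, hsub hp⟩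
    obtain ⟨c, hc⟩ := effectiveFlux_entSpeed hf hε hk hT (hF'.mono hsub) hF
    exact ⟨F', hF', by rw [hc p hp, hc p' hp', heq]⟩

end WavefrontSolution

namespace WavefrontSolution

variable {f : ℝ → ℝ → ℝ} {ε : ℝ} {S : WavefrontSolution f ε}

/-! ### Blocks at successive times -/

/-- The waves of a positive homogeneous interval which survive form an interval. -/
theorem IsBlock.survivors_conv {k : ℕ} {D : Set ℕ} (h : S.IsBlock k D) (hε : 0 < ε)
    (hk : k < S.J) {a b q : ℕ} (ha : a ∈ D) (hb : b ∈ D) (ha' : a ∈ S.alive (k + 1))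
    (hb' : b ∈ S.alive (k + 1)) (hq : q ∈ S.alive k) (haq : a ≤ q) (hqb : q ≤ b) :
    q ∈ S.alive (k + 1) := by
  rcases haq.eq_or_lt with rfl | haq
  · exact ha'
  -- The number of waves of `(a, b]` alive at time `t l` equals `kap b - kap a`, which does not
  -- depend on time. So no wave between two survivors is lost.
  have key : ∀ l ≤ S.J, (∀ x ∈ S.alive l, x ∈ S.alive k) → a ∈ S.alive l → b ∈ S.alive l →
      S.kap b - S.kap a = ((S.alive l).filter fun p => a < p ∧ p ≤ b).card := by
    intro l hl hsub hal hbl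
    rw [S.kap_eq_of_profile hε (waveProfile hε hl) hal,
      S.kap_eq_of_profile hε (waveProfile hε hl) hbl, sub_eq_iff_eq_add']
    have e : (S.alive l).filter (fun p => p ≤ b) = ((S.alive l).filter fun p => p ≤ a) ∪
        (S.alive l).filter fun p => a < p ∧ p ≤ b := by
      ext p
      simp only [Finset.mem_filter, Finset.mem_union]
      have : a ≤ b := (haq.trans_le hqb).le
      constructor
      · rintro ⟨h1, h2⟩
        rcases le_or_gt p a with h3 | h3
        · exact Or.inl ⟨h1, h3⟩
        · exact Or.inr ⟨h1, h3, h2⟩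
      · rintro (⟨h1, h2⟩ | ⟨h1, h2, h3⟩)
        · exact ⟨h1, h2.trans this⟩
        · exact ⟨h1, h3⟩
    rw [e, Finset.sum_union]
    · congr 1
      rw [Finset.sum_congr rfl (g := fun _ => 1), Finset.sum_const, nsmul_eq_mul, mul_one]
      intro p hp
      obtain ⟨h1, h2, h3⟩ := Finset.mem_filter.1 hp
      exact h.pos p (h.conv a ha b hb p (hsub p h1) h2.le h3)
    · rw [Finset.disjoint_left]
      intro p h1 h2
      exact absurd (Finset.mem_filter.1 h1).2 (not_le.2 (Finset.mem_filter.1 h2).2.1)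
  have e1 := key k hk.le (fun _ hx => hx) (h.alive a ha) (h.alive b hb)
  have e2 := key (k + 1) hk (fun _ hx => alive_succ_subset hx) ha' hb'
  have hsub : ((S.alive (k + 1)).filter fun p => a < p ∧ p ≤ b) ⊆
      (S.alive k).filter fun p => a < p ∧ p ≤ b :=
    Finset.filter_subset_filter _ fun _ hx => alive_succ_subset hx
  have e3 := Finset.eq_of_subset_of_card_le hsub (by omega)
  have : q ∈ (S.alive k).filter fun p => a < p ∧ p ≤ b :=
    Finset.mem_filter.2 ⟨hq, haq, hqb⟩
  rw [← e3] at this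
  exact (Finset.mem_filter.1 this).1

theorem LastMeet.isBlock_interval {i k s s' : ℕ} (h : S.LastMeet i k s s') (hε : 0 < ε)
    (hpos : S.isgn s = 1) : S.IsBlock k (S.interval k s s') := by
  have hi := h.of_le le_rfl h.le
  have hprof := waveProfile (S := S) hε hi.le_J
  refine ⟨fun p hp => ((h.mem_interval hε).1 hp).1, fun p hp => ?_, fun a ha b hb q hq h1 h2 => ?_⟩
  · obtain ⟨h1, h2⟩ := (h.mem_interval hε).1 hp
    have h1' := alive_of_le h.le h1
    rw [← sgn_eq_one_iff hε (S.mem_waves_of_alive h1'),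
      hprof.sgn_eq p h1' s hi.alive_left h2,
      sgn_eq_one_iff hε (S.mem_waves_of_alive hi.alive_left)]
    exact hpos
  · obtain ⟨h3, h4⟩ := (h.mem_interval hε).1 ha
    obtain ⟨h5, h6⟩ := (h.mem_interval hε).1 hb
    refine (h.mem_interval hε).2 ⟨hq, le_antisymm ?_ ?_⟩
    · rw [← h6]
      rcases h2.eq_or_lt with rfl | h2
      · exact le_rfl
      · exact hprof.mono _ (alive_of_le h.le hq) _ (alive_of_le h.le h5) h2
    · rw [← h4]
      rcases h1.eq_or_lt with rfl | h1
      · exact le_rfl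
      · exact hprof.mono _ (alive_of_le h.le h3) _ (alive_of_le h.le hq) h1

/-! ### Partitions into intervals of waves with the same position -/

variable (S) in
/-- `R` is an equivalence relation on `I`, whose classes are intervals of waves having the same
position at time `t k`. -/
structure IsPartRel (k : ℕ) (I : Set ℕ) (R : ℕ → ℕ → Prop) : Prop where
  refl : ∀ p ∈ I, R p p
  mem : ∀ p p', R p p' → p ∈ I
  symm : ∀ p p', R p p' → R p' p
  trans : ∀ p q p', R p q → R q p' → R p p'
  conv : ∀ p p' q, R p p' → q ∈ S.alive k → p ≤ q → q ≤ p' → R p q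
  px_eq : ∀ p p', R p p' → S.px k p = S.px k p'

namespace IsPartRel

variable {k : ℕ} {I : Set ℕ} {R R₀ : ℕ → ℕ → Prop}

theorem class_eq (h : S.IsPartRel k I R) {p p' : ℕ} (hpp : R p p') : {q | R p q} = {q | R p' q} := by
  ext q
  exact ⟨fun hq => h.trans _ _ _ (h.symm _ _ hpp) hq, fun hq => h.trans _ _ _ hpp hq⟩

theorem class_subset (h : S.IsPartRel k I R) (p : ℕ) : {q | R p q} ⊆ I :=
  fun q hq => h.mem q p (h.symm p q hq)

theorem isBlock_class (h : S.IsPartRel k I R) (hI : S.IsBlock k I) (p : ℕ) :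
    S.IsBlock k {q | R p q} where
  alive q hq := hI.alive q (h.class_subset p hq)
  pos q hq := hI.pos q (h.class_subset p hq)
  conv a ha b hb q hq h1 h2 := h.trans _ _ _ ha
    (h.conv a b q (h.trans _ _ _ (h.symm _ _ ha) hb) hq h1 h2)

/-- Distinct classes are ordered as their elements. -/
theorem lt_of_not_rel (h : S.IsPartRel k I R) (hI : S.IsBlock k I) {p p' : ℕ} (hpp : p ≤ p')
    (hn : ¬ R p p') {a b : ℕ} (ha : R p a) (hb : R p' b) : a < b := by
  have haI := hI.alive a (h.class_subset p ha)
  have hbI := hI.alive b (h.class_subset p' hb)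
  have hpI := hI.alive p (h.mem _ _ ha)
  have hpI' := hI.alive p' (h.mem _ _ hb)
  by_contra hab
  rcases le_total a p' with h1 | h1
  · have hle : b ≤ p' := (not_lt.1 hab).trans h1
    have h2 : R b a := h.conv b p' a (h.symm _ _ hb) haI (not_lt.1 hab) h1
    exact hn (h.trans _ _ _ ha (h.trans _ _ _ (h.symm _ _ h2) (h.symm _ _ hb)))
  · exact hn (h.conv p a p' ha hpI' hpp h1)

variable (hI : S.IsBlock k I) (h₀ : S.IsPartRel k I R₀)
  (hR : ∀ p p', R p p' ↔ R₀ p p' ∧ S.NotDividedEff k {q | R₀ p q} p p')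
include hI h₀ hR

/-- The refinement of a partition by the entropic speeds. -/
theorem refine_iff (hf : IsAdmissibleFlux f) (hε : 0 < ε) (hk : k ≤ S.J) {F : ℝ → ℝ} {p p' : ℕ}
    (hF : S.IsEffectiveFlux k {q | R₀ p q} F) :
    R p p' ↔ R₀ p p' ∧ S.entSpeed F {q | R₀ p q} p = S.entSpeed F {q | R₀ p q} p' := by
  rw [hR]
  refine and_congr_right fun hpp => ?_
  exact (h₀.isBlock_class hI p).notDividedEff_iff hf hε hk hF
    (h₀.refl p (h₀.mem _ _ hpp)) hpp

/-- Within a class the entropic speed is nondecreasing, so its level sets are again intervals of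
waves. -/
theorem refine_isPartRel (hf : IsAdmissibleFlux f) (hε : 0 < ε) (hk : k ≤ S.J) :
    S.IsPartRel k I R := by
  rcases I.eq_empty_or_nonempty with rfl | hne
  · have : ∀ p p', ¬ R p p' := fun p p' h => h₀.mem _ _ ((hR p p').1 h).1
    exact ⟨fun p hp => absurd hp (notMem_empty p), fun p p' h => absurd h (this _ _),
      fun p p' h => absurd h (this _ _), fun p q p' h => absurd h (this _ _),
      fun p q p' h => absurd h (this _ _), fun p p' h => absurd h (this _ _)⟩
  obtain ⟨F, hF⟩ := hI.exists_isEffectiveFlux hf hε hk hne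
  have key : ∀ p p', R p p' ↔ R₀ p p' ∧
      S.entSpeed F {q | R₀ p q} p = S.entSpeed F {q | R₀ p q} p' := fun p p' =>
    refine_iff hI h₀ hR hf hε hk (hF.mono (h₀.class_subset p))
  refine ⟨fun p hp => (key p p).2 ⟨h₀.refl p hp, rfl⟩, fun p p' h => h₀.mem _ _ ((key p p').1 h).1,
    fun p p' h => ?_, fun p q p' h h' => ?_, fun p p' q h hq h1 h2 => ?_,
    fun p p' h => h₀.px_eq _ _ ((key p p').1 h).1⟩
  · obtain ⟨h1, h2⟩ := (key p p').1 h
    exact (key p' p).2 ⟨h₀.symm _ _ h1, by rw [← h₀.class_eq h1, h2]⟩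
  · obtain ⟨h1, h2⟩ := (key p q).1 h
    obtain ⟨h3, h4⟩ := (key q p').1 h'
    exact (key p p').2 ⟨h₀.trans _ _ _ h1 h3, by rw [h2, h₀.class_eq h1, h4]⟩
  · obtain ⟨h3, h4⟩ := (key p p').1 h
    have h5 := h₀.conv p p' q h3 hq h1 h2
    have h6 := h₀.refl p (h₀.mem _ _ h3)
    refine (key p q).2 ⟨h5, ?_⟩
    obtain ⟨m, n, hT, -⟩ := (h₀.isBlock_class hI p).exists_tile hε hk ⟨p, h6⟩
    refine le_antisymm (hT.entSpeed_mono (Or.inl rfl) hε F h6 h5 h1) ?_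
    rw [h4]
    exact hT.entSpeed_mono (Or.inl rfl) hε F h5 h3 h2

/-- The speed of a class of the refined partition. -/
theorem refine_rhSpeed (hf : IsAdmissibleFlux f) (hε : 0 < ε) (hk : k ≤ S.J) {F : ℝ → ℝ} {p : ℕ}
    (hF : S.IsEffectiveFlux k I F) (hp : p ∈ I) :
    rhSpeed F (S.span {q | R p q}) = S.entSpeed F {q | R₀ p q} p ∧
      ∀ q, R p q → S.entSpeed F {q | R p q} q = S.entSpeed F {q | R₀ p q} p := by
  have hp₀ := h₀.refl p hp
  obtain ⟨m, n, hT, -⟩ := (h₀.isBlock_class hI p).exists_tile hε hk ⟨p, hp₀⟩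
  obtain ⟨a, b, -, h2, h3⟩ := hT.speed_class hε F (p := p) hp₀
  have hset : {q | R p q} = {q ∈ {q | R₀ p q} |
      S.entSpeed F {q | R₀ p q} q = S.entSpeed F {q | R₀ p q} p} := by
    ext q
    rw [Set.mem_ofPred_eq, refine_iff hI h₀ hR hf hε hk (hF.mono (h₀.class_subset p))]
    exact and_congr_right fun _ => eq_comm
  rw [hset]
  refine ⟨h2, fun q hq => ?_⟩
  have hq' : q ∈ {q | R p q} := hq
  rw [hset] at hq'
  exact h3 q hq'.1 hq'.2

/-- The waves of a class of the refined partition are joined. -/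
theorem refine_speed_eq (hf : IsAdmissibleFlux f) (hε : 0 < ε) (hk : k ≤ S.J) {p p' : ℕ}
    (hpp : R p p') : S.speed k p = S.speed k p' := by
  have hpp₀ := ((hR p p').1 hpp).1
  have hp₀ := h₀.refl p (h₀.mem _ _ hpp₀)
  have hblk := h₀.isBlock_class hI p
  have hpa := hblk.alive p hp₀
  have hpa' := hblk.alive p' hpp₀
  -- A class lies at one point, so the flux frozen at the value of `v` there is effective on it.
  have hG : S.IsEffectiveFlux k {q | R₀ p q} fun u => f u (S.v (S.t k) (S.px k p)) :=
    isEffectiveFlux_slice hf hk fun q hq => by rw [h₀.px_eq _ _ hq]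
  have heq := ((refine_iff hI h₀ hR hf hε hk hG).1 hpp).2
  obtain ⟨m, n, hT, -⟩ := hblk.exists_tile hε hk ⟨p, hp₀⟩
  have hpw : p ∈ S.wavesAt k (S.px k p) := S.mem_wavesAt.2 ⟨hpa, rfl⟩
  obtain ⟨σ, m', n', hσ, hT', -⟩ := (waveProfile hε hk).exists_isTile_wavesAt hε ⟨p, hpw⟩
  have : σ = 1 := by rw [← hT'.isgn_eq p hpw, hblk.pos p hp₀]
  subst this
  -- Waves not divided within the class are not divided by the larger Riemann problem of all the
  -- waves at the point, which determines the true speeds.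
  have := hT.entSpeed_eq_of_subset hT' hε (fun q hq => S.mem_wavesAt.2
    ⟨hblk.alive q hq, (h₀.px_eq _ _ hq).symm⟩) _ hp₀ hpp₀ heq
  rw [S.speed_eq_entSpeed hpa, S.speed_eq_entSpeed hpa', ← h₀.px_eq _ _ hpp₀]
  exact this

end IsPartRel

end WavefrontSolution

namespace WavefrontSolution

variable {f : ℝ → ℝ → ℝ} {ε : ℝ} {S : WavefrontSolution f ε}

/-! ### The partition attached to a pair of waves -/

namespace LastMeet

variable {i k s s' : ℕ}

theorem not_divided_iff (hk : k ≤ S.J) {p p' : ℕ} (hp : p ∈ S.alive k) (hp' : p' ∈ S.alive k) :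
    ¬ S.Divided k p p' ↔ S.px k p = S.px k p' ∧ S.speed k p = S.speed k p' := by
  rw [Divided, not_not, position_t hk, position_t hk, pos_eq_iff hp hp']

theorem isPartRel_meet (h : S.LastMeet i i s s') (hε : 0 < ε) :
    S.IsPartRel i (S.interval i s s')
      (fun p p' => p ∈ S.interval i s s' ∧ p' ∈ S.interval i s s') where
  refl p hp := ⟨hp, hp⟩
  mem p p' h := h.1
  symm p p' h := h.symm
  trans p q p' h h' := ⟨h.1, h'.2⟩
  conv p p' q hpp hq h1 h2 := by
    refine ⟨hpp.1, ?_⟩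
    have hprof := waveProfile (S := S) hε h.le_J
    obtain ⟨h3, h4⟩ := (h.mem_interval hε).1 hpp.1
    obtain ⟨h5, h6⟩ := (h.mem_interval hε).1 hpp.2
    refine (h.mem_interval hε).2 ⟨hq, le_antisymm ?_ ?_⟩
    · rw [← h6]
      rcases h2.eq_or_lt with rfl | h2
      · exact le_rfl
      · exact hprof.mono _ hq _ h5 h2
    · rw [← h4]
      rcases h1.eq_or_lt with rfl | h1
      · exact le_rfl
      · exact hprof.mono _ h3 _ hq h1
  px_eq p p' hpp := by
    rw [((h.mem_interval hε).1 hpp.1).2, ((h.mem_interval hε).1 hpp.2).2]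

/-- At the meeting time `v` is the same for all waves of the interval, and these are all the waves
at that point. Being joined is then being undivided by an effective flux, which gives the base case
the form of the recursive step. -/
theorem partRel_meet_iff (h : S.LastMeet i i s s') (hf : IsAdmissibleFlux f) (hε : 0 < ε)
    (hpos : S.isgn s = 1) (p p' : ℕ) : S.partRel i s s' p p' ↔
      (p ∈ S.interval i s s' ∧ p' ∈ S.interval i s s') ∧
      S.NotDividedEff i {q | p ∈ S.interval i s s' ∧ q ∈ S.interval i s s'} p p' := by
  rw [h.partRel_self hε, ← and_assoc]
  refine and_congr_right fun hpp => ?_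
  have hI := h.isBlock_interval hε hpos
  have hset : {q | p ∈ S.interval i s s' ∧ q ∈ S.interval i s s'} = S.interval i s s' := by
    ext q; exact ⟨fun h => h.2, fun h => ⟨hpp.1, h⟩⟩
  have hpw : ∀ q, q ∈ S.interval i s s' ↔ q ∈ S.wavesAt i (S.px i s) := fun q => by
    rw [h.mem_interval hε, S.mem_wavesAt]
  have hset' : S.interval i s s' = S.wavesAt i (S.px i s) := Set.ext hpw
  have hpx : ∀ q ∈ S.interval i s s', S.px i q = S.px i s := fun q hq =>
    ((h.mem_interval hε).1 hq).2
  rw [hset, hI.notDividedEff_iff hf hε h.le_J (isEffectiveFlux_slice hf h.le_J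
    (v := S.v (S.t i) (S.px i s)) fun q hq => by rw [hpx q hq]) hpp.1 hpp.2,
    not_divided_iff h.le_J (hI.alive p hpp.1) (hI.alive p' hpp.2),
    S.speed_eq_entSpeed (hI.alive p hpp.1), S.speed_eq_entSpeed (hI.alive p' hpp.2),
    hpx p hpp.1, hpx p' hpp.2, hset']
  exact ⟨fun h => h.2, fun h => ⟨rfl, h⟩⟩

theorem mem_interval_succ (h : S.LastMeet i (k + 1) s s') (hε : 0 < ε) (hik : i ≤ k) {p : ℕ} :
    p ∈ S.interval (k + 1) s s' ↔ p ∈ S.interval k s s' ∧ p ∈ S.alive (k + 1) := by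
  rw [h.mem_interval hε, (h.of_le hik (Nat.le_succ k)).mem_interval hε]
  exact ⟨fun hp => ⟨⟨alive_succ_subset hp.1, hp.2⟩, hp.1⟩, fun hp => ⟨hp.2, hp.1.2⟩⟩

/-- The intermediate partition, restricted to survivors but not yet split. Its classes stay at one
point because their waves had the same speed. -/
theorem isPartRel_succ (h : S.LastMeet i (k + 1) s s') (hε : 0 < ε) (hik : i ≤ k)
    (hP : S.IsPartRel k (S.interval k s s') (S.partRel k s s'))
    (hsp : ∀ p p', S.partRel k s s' p p' → S.speed k p = S.speed k p') :
    S.IsPartRel (k + 1) (S.interval (k + 1) s s')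
      (fun p p' => S.partRel k s s' p p' ∧ p ∈ S.alive (k + 1) ∧ p' ∈ S.alive (k + 1)) where
  refl p hp := by
    obtain ⟨h1, h2⟩ := (h.mem_interval_succ hε hik).1 hp
    exact ⟨hP.refl p h1, h2, h2⟩
  mem p p' hpp := (h.mem_interval_succ hε hik).2 ⟨hP.mem _ _ hpp.1, hpp.2.1⟩
  symm p p' hpp := ⟨hP.symm _ _ hpp.1, hpp.2.2, hpp.2.1⟩
  trans p q p' h1 h2 := ⟨hP.trans _ _ _ h1.1 h2.1, h1.2.1, h2.2.2⟩
  conv p p' q hpp hq h1 h2 := ⟨hP.conv p p' q hpp.1 (alive_succ_subset hq) h1 h2, hpp.2.1, hq⟩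
  px_eq p p' hpp := px_succ_eq_of_joined hpp.2.1 hpp.2.2 (hP.px_eq _ _ hpp.1) (hsp _ _ hpp.1)

theorem partRel_succ_iff (h : S.LastMeet i (k + 1) s s') (hε : 0 < ε) (hik : i ≤ k) (p p' : ℕ) :
    S.partRel (k + 1) s s' p p' ↔
      (S.partRel k s s' p p' ∧ p ∈ S.alive (k + 1) ∧ p' ∈ S.alive (k + 1)) ∧
      S.NotDividedEff (k + 1)
        {q | S.partRel k s s' p q ∧ p ∈ S.alive (k + 1) ∧ q ∈ S.alive (k + 1)} p p' := by
  rw [h.partRel_succ hε hik]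
  by_cases hp : p ∈ S.alive (k + 1)
  · simp only [hp, true_and]
    rw [and_left_comm, and_assoc]
  · simp only [hp, false_and, and_false]

/-- The two facts must be proved together: a common speed at one time gives a common position at the
next, and this in turn gives a common speed to the refined classes. -/
theorem isPartRel_and_speed_eq (h : S.LastMeet i k s s') (hf : IsAdmissibleFlux f) (hε : 0 < ε)
    (hpos : S.isgn s = 1) : S.IsPartRel k (S.interval k s s') (S.partRel k s s') ∧
      ∀ p p', S.partRel k s s' p p' → S.speed k p = S.speed k p' := by
  obtain ⟨l, rfl⟩ := Nat.exists_eq_add_of_le h.le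
  induction l with
  | zero =>
    have hI := h.isBlock_interval hε hpos
    have h₀ := h.isPartRel_meet hε
    have hR := h.partRel_meet_iff hf hε hpos
    exact ⟨h₀.refine_isPartRel hI hR hf hε h.le_J,
      fun p p' => IsPartRel.refine_speed_eq hI h₀ hR hf hε h.le_J⟩
  | succ l ih =>
    have hl := h.of_le (Nat.le_add_right i l) (by omega)
    obtain ⟨h1, h2⟩ := ih hl
    have hI := h.isBlock_interval hε hpos
    have h₀ := isPartRel_succ h hε (Nat.le_add_right i l) h1 h2
    have hR := partRel_succ_iff h hε (Nat.le_add_right i l)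
    exact ⟨h₀.refine_isPartRel hI hR hf hε h.le_J,
      fun p p' => IsPartRel.refine_speed_eq hI h₀ hR hf hε h.le_J⟩

theorem isPartRel (h : S.LastMeet i k s s') (hf : IsAdmissibleFlux f) (hε : 0 < ε)
    (hpos : S.isgn s = 1) : S.IsPartRel k (S.interval k s s') (S.partRel k s s') :=
  (h.isPartRel_and_speed_eq hf hε hpos).1

theorem speed_eq_of_partRel (h : S.LastMeet i k s s') (hf : IsAdmissibleFlux f) (hε : 0 < ε)
    (hpos : S.isgn s = 1) {p p' : ℕ} (hpp : S.partRel k s s' p p') :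
    S.speed k p = S.speed k p' :=
  (h.isPartRel_and_speed_eq hf hε hpos).2 p p' hpp

/-- An effective flux does not divide the waves of an element of the partition. -/
theorem entSpeed_partClass (h : S.LastMeet i k s s') (hf : IsAdmissibleFlux f) (hε : 0 < ε)
    (hpos : S.isgn s = 1) {F : ℝ → ℝ} (hF : S.IsEffectiveFlux k (S.interval k s s') F) {p : ℕ}
    (hp : p ∈ S.interval k s s') :
    S.entSpeed F (S.partClass k s s' p) p = rhSpeed F (S.span (S.partClass k s s' p)) := by
  have hI := h.isBlock_interval hε hpos
  have hpp := (h.isPartRel hf hε hpos).refl p hp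
  obtain ⟨l, rfl⟩ := Nat.exists_eq_add_of_le h.le
  cases l with
  | zero =>
    have h₀ := h.isPartRel_meet hε
    have hR := h.partRel_meet_iff hf hε hpos
    obtain ⟨h1, h2⟩ := IsPartRel.refine_rhSpeed hI h₀ hR hf hε h.le_J hF hp
    exact (h2 p hpp).trans h1.symm
  | succ l =>
    have hl := h.of_le (Nat.le_add_right i l) (by omega)
    obtain ⟨h1, h2⟩ := hl.isPartRel_and_speed_eq hf hε hpos
    have h₀ := isPartRel_succ h hε (Nat.le_add_right i l) h1 h2
    have hR := partRel_succ_iff h hε (Nat.le_add_right i l)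
    obtain ⟨h1, h2⟩ := IsPartRel.refine_rhSpeed hI h₀ hR hf hε h.le_J hF hp
    exact (h2 p hpp).trans h1.symm

/-! ### The weights -/

theorem piWeight_succ (h : S.LastMeet i (k + 1) s s') (hε : 0 < ε) (hik : i ≤ k) (p p' : ℕ) :
    (S.Transversal k → S.piWeight (k + 1) s s' p p' = S.piWeight k s s' p p' +
      2 * normD3 f * S.vStrength (k + 1) * S.lengthM k s s' p p') ∧
    (¬ S.Transversal k → S.piWeight (k + 1) s s' p p' = S.piWeight k s s' p p') := by
  have hc := And.intro ((h.of_le hik (Nat.le_succ k)).alreadyInteracted hε)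
    (h.divided hik (Nat.lt_succ_self k))
  exact ⟨fun ht => by rw [piWeight, if_pos hc, if_pos ht], fun ht => by
    rw [piWeight, if_pos hc, if_neg ht]⟩

end LastMeet

theorem vStrength_nonneg (k : ℕ) : 0 ≤ S.vStrength k := abs_nonneg _

theorem lengthM_nonneg (hε : 0 < ε) (k s s' p p' : ℕ) : 0 ≤ S.lengthM k s s' p p' :=
  finsum_nonneg fun _ => finsum_nonneg fun _ => mul_nonneg hε.le (Nat.cast_nonneg _)

theorem piWeight_nonneg (hε : 0 < ε) (k s s' p p' : ℕ) : 0 ≤ S.piWeight k s s' p p' := by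
  induction k with
  | zero => exact le_rfl
  | succ k ih =>
    rw [piWeight]
    split_ifs
    · exact add_nonneg ih (mul_nonneg (mul_nonneg (mul_nonneg zero_le_two (normD3_nonneg f))
        (vStrength_nonneg _)) (lengthM_nonneg hε _ _ _ _ _))
    · exact ih
    · exact le_rfl

namespace LastMeet

variable {i k s s' : ℕ}

/-- The waves of `A` belong to elements of the partition which are counted in `lengthM`. -/
theorem card_le_lengthM (h : S.LastMeet i (k + 1) s s') (hf : IsAdmissibleFlux f) (hε : 0 < ε)
    (hik : i ≤ k) (hpos : S.isgn s = 1) (htr : S.Transversal k) {p p' : ℕ} {A : Finset ℕ}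
    (hA : ∀ q ∈ A, q ∈ S.interval (k + 1) s s' ∧ S.px (k + 1) q = S.xc (k + 1))
    (hp : ∀ q ∈ A, (∃ x, S.partRel k s s' p x ∧ x ≤ q))
    (hp' : ∀ q ∈ A, (∃ x, S.partRel k s s' p' x ∧ q ≤ x)) :
    ε * A.card ≤ S.lengthM k s s' p p' := by
  classical
  have hkJ : k < S.J := h.le_J
  have hk := h.of_le hik (Nat.le_succ k)
  have hP := hk.isPartRel hf hε hpos
  have hI := hk.isBlock_interval hε hpos
  have hAk : ∀ q ∈ A, q ∈ S.interval k s s' := fun q hq =>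
    ((h.mem_interval_succ hε hik).1 (hA q hq).1).1
  set 𝒞 := {C | C ∈ S.partition k s s' ∧
      (Precedes (S.partClass k s s' p) C ∨ S.partClass k s s' p = C) ∧
      (Precedes C (S.partClass k s s' p') ∨ C = S.partClass k s s' p') ∧
      C ⊆ {q | q ∈ S.waves ∧
        S.position (S.t (k + 1)) q = (S.xc (k + 1) : WithTop ℝ)}} with h𝒞
  have hfin : 𝒞.Finite := by
    refine (hI.finite.image (S.partClass k s s')).subset ?_
    rintro C ⟨⟨q, hq, rfl⟩, -⟩
    exact ⟨q, hq, rfl⟩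
  -- Classes are intervals, so the class of `q` lies after that of `p` or equals it as soon as some
  -- wave of the class of `p` is at most `q`; likewise for `p'`.
  have hmem : ∀ q ∈ A, S.partClass k s s' q ∈ 𝒞 := by
    intro q hq
    have hqq := hP.refl q (hAk q hq)
    refine ⟨⟨q, hAk q hq, rfl⟩, ?_, ?_, ?_⟩
    · by_cases hr : S.partRel k s s' p q
      · exact Or.inr (hP.class_eq hr)
      · left
        obtain ⟨x, hx, hxq⟩ := hp q hq
        have hn : ¬ S.partRel k s s' x q := fun h => hr (hP.trans _ _ _ hx h)
        exact fun a ha b hb =>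
          hP.lt_of_not_rel hI hxq hn (hP.trans _ _ _ (hP.symm _ _ hx) ha) hb
    · by_cases hr : S.partRel k s s' q p'
      · exact Or.inr (hP.class_eq hr)
      · left
        obtain ⟨x, hx, hxq⟩ := hp' q hq
        have hn : ¬ S.partRel k s s' q x := fun h => hr (hP.trans _ _ _ h (hP.symm _ _ hx))
        exact fun a ha b hb =>
          hP.lt_of_not_rel hI hxq hn ha (hP.trans _ _ _ (hP.symm _ _ hx) hb)
    -- The waves of the class of `q` travel together with `q` to the collision point, and at a
    -- transversal interaction none of them is removed.
    · intro x hx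
      have hxk := hI.alive x (hP.class_subset q hx)
      have hx1 := survives_of_transversal hε hkJ htr hxk
      have hq1 : q ∈ S.alive (k + 1) := ((h.mem_interval_succ hε hik).1 (hA q hq).1).2
      refine ⟨S.mem_waves_of_alive hx1, ?_⟩
      rw [position_t h.le_J, S.pos_eq_px hx1, px_succ_eq_of_joined hx1 hq1
        (hP.px_eq _ _ hx).symm (hk.speed_eq_of_partRel hf hε hpos hx).symm, (hA q hq).2]
  have hC : ∀ C ∈ 𝒞, (((S.alive k).filter fun x => x ∈ C : Finset ℕ) : Set ℕ) = C := by
    rintro C ⟨⟨q, hq, rfl⟩, -⟩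
    ext x
    rw [Finset.mem_coe, Finset.mem_filter]
    exact ⟨fun h => h.2, fun h => ⟨hI.alive x (hP.class_subset q h), h⟩⟩
  have hsub : A ⊆ hfin.toFinset.biUnion fun C => (S.alive k).filter fun x => x ∈ C := by
    intro q hq
    rw [Finset.mem_biUnion]
    exact ⟨_, hfin.mem_toFinset.2 (hmem q hq),
      Finset.mem_filter.2 ⟨hI.alive q (hAk q hq), hP.refl q (hAk q hq)⟩⟩
  have hcard := (Finset.card_le_card hsub).trans Finset.card_biUnion_le
  rw [lengthM, ← h𝒞, finsum_mem_eq_finite_toFinset_sum _ hfin]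
  calc ε * (A.card : ℝ) ≤ ε * ((∑ C ∈ hfin.toFinset,
        ((S.alive k).filter fun x => x ∈ C).card : ℕ) : ℝ) :=
        mul_le_mul_of_nonneg_left (by exact_mod_cast hcard) hε.le
    _ = ∑ C ∈ hfin.toFinset, S.strength C := by
        rw [Nat.cast_sum, Finset.mul_sum]
        refine Finset.sum_congr rfl fun C hCm => ?_
        have e := hC C (hfin.mem_toFinset.1 hCm)
        rw [strength, ← ncard_coe_finset, e]

end LastMeet

end WavefrontSolution

/-! ### Speeds of the elements of the partition against the weight -/

namespace WavefrontSolution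

variable {f : ℝ → ℝ → ℝ} {ε : ℝ} {S : WavefrontSolution f ε}

theorem IsEffectiveFlux.continuous_deriv {k : ℕ} {M : Set ℕ} {F : ℝ → ℝ}
    (h : S.IsEffectiveFlux k M F) : Continuous (deriv F) := h.1.continuous_deriv le_rfl

/-- The change of the effective flux from a collision time to the next one. -/
theorem LastMeet.effectiveFlux_compare_succ {i k s s' : ℕ} (h : S.LastMeet i (k + 1) s s')
    (hf : IsAdmissibleFlux f) {r : ℝ}
    (hyp : ∀ w v : ℝ, |w| ≤ r → |v| ≤ r → -1 < deriv (fun w' => f w' v) w)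
    (hε : 0 < ε) (hw : ∀ x, |S.w 0 x| ≤ r) (hv : ∀ x, |S.v 0 x| ≤ r) (hik : i ≤ k)
    (hpos : S.isgn s = 1) {F F' : ℝ → ℝ} (hF : S.IsEffectiveFlux (k + 1) (S.interval (k + 1) s s') F)
    (hF' : S.IsEffectiveFlux k (S.interval k s s') F') {p p' : ℕ} {A : Finset ℕ}
    (hA : ∀ q ∈ A, q ∈ S.interval (k + 1) s s')
    (hp : ∀ q ∈ A, (∃ x, S.partRel k s s' p x ∧ x ≤ q))
    (hp' : ∀ q ∈ A, (∃ x, S.partRel k s s' p' x ∧ q ≤ x)) {m n : ℤ}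
    (hT : S.IsTile 1 (A : Set ℕ) m n) {u u' : ℝ} (hu : u ∈ Icc ((m : ℝ) * ε) (n * ε))
    (hu' : u' ∈ Icc ((m : ℝ) * ε) (n * ε)) :
    S.piWeight k s s' p p' + |(deriv F u' - deriv F' u') - (deriv F u - deriv F' u)| ≤
      S.piWeight (k + 1) s s' p p' := by
  classical
  have hkJ : k < S.J := h.le_J
  have hI := h.isBlock_interval hε hpos
  have hAk : (A : Set ℕ) ⊆ S.interval k s s' := fun q hq =>
    ((h.mem_interval_succ hε hik).1 (hA q hq)).1
  have hcmp := effectiveFlux_compare hf hε h.le_J hkJ.le hT (hF.mono fun q hq => hA q hq)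
    (hF'.mono hAk) hu hu'
  have hval := fun q (hq : q ∈ A) => v_along_wave hf hyp hε hw hv hkJ (hI.alive q (hA q hq))
    (hI.pos q (hA q hq))
  obtain ⟨hw1, hw2⟩ := h.piWeight_succ hε hik p p'
  by_cases htr : S.Transversal k
  · rw [hw1 htr]
    refine add_le_add_right (hcmp.trans ?_) _
    set B := A.filter fun q => S.px (k + 1) q = S.xc (k + 1) with hB
    have hBl := h.card_le_lengthM hf hε hik hpos htr (A := B)
      (fun q hq => ⟨hA q (Finset.mem_filter.1 hq).1, (Finset.mem_filter.1 hq).2⟩)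
      (fun q hq => hp q (Finset.mem_filter.1 hq).1) fun q hq => hp' q (Finset.mem_filter.1 hq).1
    have hn3 : 0 ≤ normD3 f * S.vStrength (k + 1) :=
      mul_nonneg (normD3_nonneg f) (vStrength_nonneg _)
    calc ∑ q ∈ A, normD3 f *
          |S.v (S.t (k + 1)) (S.px (k + 1) q) - S.v (S.t k) (S.px k q)| * ε
        ≤ ∑ q ∈ A, if S.px (k + 1) q = S.xc (k + 1) then normD3 f * S.vStrength (k + 1) * ε
          else 0 := by
          refine Finset.sum_le_sum fun q hq => ?_
          rcases hval q hq with h1 | ⟨-, h1, h2⟩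
          · rw [h1, sub_self, abs_zero, mul_zero, zero_mul]
            split_ifs
            · exact mul_nonneg hn3 hε.le
            · exact le_rfl
          · rw [if_pos h1, h2]
      _ = normD3 f * S.vStrength (k + 1) * (ε * B.card) := by
          rw [← Finset.sum_filter, Finset.sum_const, nsmul_eq_mul]
          ring
      _ ≤ normD3 f * S.vStrength (k + 1) * S.lengthM k s s' p p' :=
          mul_le_mul_of_nonneg_left hBl hn3
      -- Half of the increment of the weight is enough here.
      _ ≤ 2 * normD3 f * S.vStrength (k + 1) * S.lengthM k s s' p p' := by
          have := mul_nonneg hn3 (lengthM_nonneg (S := S) hε k s s' p p')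
          linarith
  · rw [hw2 htr]
    rw [Finset.sum_eq_zero] at hcmp
    · linarith
    · intro q hq
      rcases hval q hq with h1 | ⟨h1, -⟩
      · rw [h1, sub_self, abs_zero, mul_zero, zero_mul]
      · exact absurd h1 htr

theorem exists_max_Icc {δ : ℝ → ℝ} (hδ : Continuous δ) {a b : ℝ} (hab : a ≤ b) :
    ∃ u ∈ Icc a b, ∀ x ∈ Icc a b, δ x ≤ δ u := by
  obtain ⟨u, hu, hmax⟩ := isCompact_Icc.exists_isMaxOn (nonempty_Icc.2 hab) hδ.continuousOn
  exact ⟨u, hu, fun x hx => hmax hx⟩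

theorem IsTile.bounds_le_of_max {D D' : Set ℕ} {m n m' n' : ℤ} (h : S.IsTile 1 D m n)
    (h' : S.IsTile 1 D' m' n') {p : ℕ} (hp : p ∈ D) (hup : ∀ q ∈ D, p ≤ q → q ∈ D') : n ≤ n' := by
  obtain ⟨q, hq, hqn⟩ := h.exists_mem h.lt le_rfl
  rw [one_mul] at hqn
  have h1 := h.mem_Ioc hp
  have := h'.mem_Ioc (hup q hq ((h.le_iff hp hq).1 (by omega)))
  omega

theorem IsTile.bounds_le_of_min {D D' : Set ℕ} {m n m' n' : ℤ} (h : S.IsTile 1 D m n)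
    (h' : S.IsTile 1 D' m' n') {p : ℕ} (hp : p ∈ D) (hup : ∀ q ∈ D, q ≤ p → q ∈ D') : m' ≤ m := by
  have hlt := h.lt
  obtain ⟨q, hq, hqn⟩ := h.exists_mem (i := m + 1) (by omega) (by omega)
  rw [one_mul] at hqn
  have h1 := h.mem_Ioc hp
  have := h'.mem_Ioc (hup q hq ((h.le_iff hq hp).1 (by omega)))
  omega

/-- The difference of the speeds given by the effective flux to two elements of the partition is
bounded by the weight. -/
theorem LastMeet.rhSpeed_sub_le {i k s s' : ℕ} (h : S.LastMeet i k s s')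
    (hf : IsAdmissibleFlux f) {r : ℝ}
    (hyp : ∀ w v : ℝ, |w| ≤ r → |v| ≤ r → -1 < deriv (fun w' => f w' v) w)
    (hε : 0 < ε) (hw : ∀ x, |S.w 0 x| ≤ r) (hv : ∀ x, |S.v 0 x| ≤ r)
    (hpos : S.isgn s = 1) {F : ℝ → ℝ} (hF : S.IsEffectiveFlux k (S.interval k s s') F) {p p' : ℕ}
    (hp : p ∈ S.interval k s s') (hp' : p' ∈ S.interval k s s') (hpp : p ≤ p') :
    rhSpeed F (S.span (S.partClass k s s' p)) - rhSpeed F (S.span (S.partClass k s s' p')) ≤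
      S.piWeight k s s' p p' := by
  classical
  obtain ⟨l, rfl⟩ := Nat.exists_eq_add_of_le h.le
  induction l generalizing F with
  | zero =>
    rw [Nat.add_zero] at h hF hp hp' ⊢
    have hI := h.isBlock_interval hε hpos
    have h₀ := h.isPartRel_meet hε
    have hR := h.partRel_meet_iff hf hε hpos
    obtain ⟨h1, -⟩ := IsPartRel.refine_rhSpeed hI h₀ hR hf hε h.le_J hF hp
    obtain ⟨h2, -⟩ := IsPartRel.refine_rhSpeed hI h₀ hR hf hε h.le_J hF hp'
    have hcl := h₀.class_eq ⟨hp, hp'⟩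
    obtain ⟨m, n, hT, -⟩ := (h₀.isBlock_class hI p).exists_tile hε h.le_J ⟨p, hp, hp⟩
    -- At the last meeting both speeds belong to one Riemann problem and are ordered, so any
    -- nonnegative weight will do.
    refine le_trans (sub_nonpos.2 ?_) (piWeight_nonneg hε _ _ _ _ _)
    rw [partClass, partClass, h1, h2, ← hcl]
    exact hT.entSpeed_mono (Or.inl rfl) hε F ⟨hp, hp⟩ ⟨hp, hp'⟩ hpp
  | succ l ih =>
    rw [← Nat.add_assoc] at h hF hp hp' ⊢
    have hik := Nat.le_add_right i l
    have hl := h.of_le hik (by omega)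
    have hkJ : i + l < S.J := h.le_J
    obtain ⟨hP, hsp⟩ := hl.isPartRel_and_speed_eq hf hε hpos
    have hI := h.isBlock_interval hε hpos
    have hIl := hl.isBlock_interval hε hpos
    have h₀ := isPartRel_succ h hε hik hP hsp
    have hR := partRel_succ_iff h hε hik
    obtain ⟨h1, -⟩ := IsPartRel.refine_rhSpeed hI h₀ hR hf hε h.le_J hF hp
    obtain ⟨h2, -⟩ := IsPartRel.refine_rhSpeed hI h₀ hR hf hε h.le_J hF hp'
    obtain ⟨hpl, hpa⟩ := (h.mem_interval_succ hε hik).1 hp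
    obtain ⟨hpl', hpa'⟩ := (h.mem_interval_succ hε hik).1 hp'
    have hrp := h₀.refl p hp
    have hrp' := h₀.refl p' hp'
    obtain ⟨m₁, n₁, hT₁, -⟩ := (h₀.isBlock_class hI p).exists_tile hε h.le_J ⟨p, hrp⟩
    rw [partClass, partClass, h1, h2]
    -- If `p` and `p'` were still in one element, the new elements come from splitting it, and
    -- entropic speeds are ordered inside it.
    by_cases hrel : S.partRel (i + l) s s' p p'
    · have hpp₀ : S.partRel (i + l) s s' p p' ∧ p ∈ S.alive (i + l + 1) ∧ p' ∈ S.alive (i + l + 1) :=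
        ⟨hrel, hpa, hpa'⟩
      refine le_trans (sub_nonpos.2 ?_) (piWeight_nonneg hε _ _ _ _ _)
      rw [← h₀.class_eq hpp₀]
      exact hT₁.entSpeed_mono (Or.inl rfl) hε F hrp hpp₀ hpp
    obtain ⟨m₂, n₂, hT₂, -⟩ := (h₀.isBlock_class hI p').exists_tile hε h.le_J ⟨p', hrp'⟩
    obtain ⟨F', hF'⟩ := hIl.exists_isEffectiveFlux hf hε hkJ.le ⟨p, hpl⟩
    have hih := ih hl hF' hpl hpl'
    -- An old element is not divided by its flux, so its Rankine-Hugoniot speed is the entropic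
    -- speed of its waves. This is the quantity that can be compared after cutting.
    rw [← hl.entSpeed_partClass hf hε hpos hF' hpl,
      ← hl.entSpeed_partClass hf hε hpos hF' hpl'] at hih
    have hblk := hP.isBlock_class hIl p
    have hblk' := hP.isBlock_class hIl p'
    obtain ⟨m₃, n₃, hT₃, -⟩ := hblk.exists_tile hε hkJ.le ⟨p, hP.refl p hpl⟩
    obtain ⟨m₄, n₄, hT₄, -⟩ := hblk'.exists_tile hε hkJ.le ⟨p', hP.refl p' hpl'⟩
    -- Hence the element of `p` keeps its right end (`hn₃`) and that of `p'` its left end (`hm₄`).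
    have hsurv : ∀ q ∈ S.alive (i + l), p ≤ q → q ≤ p' → q ∈ S.alive (i + l + 1) :=
      fun q hq hq1 hq2 => hIl.survivors_conv hε hkJ hpl hpl' hpa hpa' hq hq1 hq2
    have hsub₁ := hT₁.bounds_of_subset hT₃ fun q hq => hq.1
    have hsub₂ := hT₂.bounds_of_subset hT₄ fun q hq => hq.1
    have hn₃ : n₃ ≤ n₁ := hT₃.bounds_le_of_max hT₁ (hP.refl p hpl) fun q hq hpq =>
      ⟨hq, hpa, hsurv q (hblk.alive q hq) hpq
        (hP.lt_of_not_rel hIl hpp hrel hq (hP.refl p' hpl')).le⟩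
    have hm₄ : m₂ ≤ m₄ := hT₄.bounds_le_of_min hT₂ (hP.refl p' hpl') fun q hq hqp =>
      ⟨hq, hpa', hsurv q (hblk'.alive q hq)
        (hP.lt_of_not_rel hIl hpp hrel (hP.refl p hpl) hq).le hqp⟩
    -- The hull of the survivors of the two elements: the range on which the change of flux has to
    -- be controlled.
    set A := (S.alive (i + l + 1)).filter fun q => q ∈ S.interval (i + l + 1) s s' ∧
      (∃ x, (S.partRel (i + l) s s' p x ∧ p ∈ S.alive (i + l + 1) ∧ x ∈ S.alive (i + l + 1)) ∧
        x ≤ q) ∧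
      ∃ x, (S.partRel (i + l) s s' p' x ∧ p' ∈ S.alive (i + l + 1) ∧ x ∈ S.alive (i + l + 1)) ∧
        q ≤ x with hA
    have hAmem : ∀ q, q ∈ A ↔ q ∈ S.interval (i + l + 1) s s' ∧
      (∃ x, (S.partRel (i + l) s s' p x ∧ p ∈ S.alive (i + l + 1) ∧ x ∈ S.alive (i + l + 1)) ∧
        x ≤ q) ∧
      ∃ x, (S.partRel (i + l) s s' p' x ∧ p' ∈ S.alive (i + l + 1) ∧ x ∈ S.alive (i + l + 1)) ∧
        q ≤ x := fun q => by
      rw [hA, Finset.mem_filter, and_iff_right_iff_imp]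
      exact fun hq => hI.alive q hq.1
    have hAblk : S.IsBlock (i + l + 1) (A : Set ℕ) := by
      refine ⟨fun q hq => hI.alive q ((hAmem q).1 hq).1, fun q hq => hI.pos q ((hAmem q).1 hq).1,
        fun a ha b hb q hq haq hqb => ?_⟩
      obtain ⟨ha1, ⟨x, hx1, hx2⟩, -⟩ := (hAmem a).1 ha
      obtain ⟨hb1, -, ⟨y, hy1, hy2⟩⟩ := (hAmem b).1 hb
      exact (hAmem q).2 ⟨hI.conv a ha1 b hb1 q hq haq hqb, ⟨x, hx1, hx2.trans haq⟩,
        ⟨y, hy1, hqb.trans hy2⟩⟩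
    have hsubA₁ : ∀ q, S.partRel (i + l) s s' p q ∧ p ∈ S.alive (i + l + 1) ∧
        q ∈ S.alive (i + l + 1) → q ∈ (A : Set ℕ) := fun q hq =>
      (hAmem q).2 ⟨h₀.class_subset p hq, ⟨q, hq, le_rfl⟩, ⟨p', hrp',
        (hP.lt_of_not_rel hIl hpp hrel hq.1 (hP.refl p' hpl')).le⟩⟩
    have hsubA₂ : ∀ q, S.partRel (i + l) s s' p' q ∧ p' ∈ S.alive (i + l + 1) ∧
        q ∈ S.alive (i + l + 1) → q ∈ (A : Set ℕ) := fun q hq =>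
      (hAmem q).2 ⟨h₀.class_subset p' hq, ⟨p, hrp,
        (hP.lt_of_not_rel hIl hpp hrel (hP.refl p hpl) hq.1).le⟩, ⟨q, hq, le_rfl⟩⟩
    obtain ⟨m, n, hT, -⟩ := hAblk.exists_tile hε h.le_J ⟨p, hsubA₁ p hrp⟩
    have hA₁ := hT₁.bounds_of_subset hT hsubA₁
    have hA₂ := hT₂.bounds_of_subset hT hsubA₂
    have hcast : ∀ {a b : ℤ}, a ≤ b → (a : ℝ) * ε ≤ b * ε := fun hab =>
      mul_le_mul_of_nonneg_right (by exact_mod_cast hab) hε.le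
    have hlt₁ := hT₁.lt
    have hlt₂ := hT₂.lt
    have hlt₃ := hT₃.mem_Ioc (hP.refl p hpl)
    have hlt₁' := hT₁.mem_Ioc hrp
    have hlt₄ := hT₄.mem_Ioc (hP.refl p' hpl')
    have hlt₂' := hT₂.mem_Ioc hrp'
    have hcont : Continuous fun u => deriv F u - deriv F' u :=
      hF.continuous_deriv.sub hF'.continuous_deriv
    -- The speed on the left grows at most by the maximum of the change of derivative on its tile,
    -- attained at `u₁`; the speed on the right falls at most by minus the minimum on its tile,
    -- attained at `u₂`.
    obtain ⟨u₁, hu₁, hmax⟩ := exists_max_Icc hcont (hcast (show m₁ ≤ n₃ by omega))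
    obtain ⟨u₂, hu₂, hmin⟩ := exists_max_Icc hcont.neg (hcast (show m₄ ≤ n₂ by omega))
    have e₁ := hT₁.entSpeed_le_add hT₃ hε hsub₁.1 hn₃ hF.differentiable hF'.differentiable hmax
      hrp (hP.refl p hpl)
    have e₂ := hT₄.entSpeed_le_add hT₂ hε hm₄ hsub₂.2 hF'.differentiable hF.differentiable
      (c := -(deriv F u₂ - deriv F' u₂)) (fun u hu => by
        have : -(deriv F u - deriv F' u) ≤ -(deriv F u₂ - deriv F' u₂) := hmin u hu
        linarith) (hP.refl p' hpl') hrp'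
    -- Both `u₁` and `u₂` lie in the hull, so the total growth is an oscillation paid for by the
    -- increment of the weight.
    have hfin := h.effectiveFlux_compare_succ hf hyp hε hw hv hik hpos hF hF'
      (p := p) (p' := p') (A := A) (fun q hq => ((hAmem q).1 hq).1)
      (fun q hq => by
        obtain ⟨x, hx, hxq⟩ := ((hAmem q).1 hq).2.1
        exact ⟨x, hx.1, hxq⟩)
      (fun q hq => by
        obtain ⟨x, hx, hxq⟩ := ((hAmem q).1 hq).2.2
        exact ⟨x, hx.1, hxq⟩) hT (u := u₂) (u' := u₁)
      ⟨(hcast (show m ≤ m₄ by omega)).trans hu₂.1, hu₂.2.trans (hcast hA₂.2)⟩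
      ⟨(hcast hA₁.1).trans hu₁.1, hu₁.2.trans (hcast (show n₃ ≤ n by omega))⟩
    have habs := le_abs_self ((deriv F u₁ - deriv F' u₁) - (deriv F u₂ - deriv F' u₂))
    rw [partClass, partClass] at hih
    linarith

end WavefrontSolution

/-! ### Averages over classes, rectangles of pairs -/

/-- If `h` is bounded by `g` in the mean on the classes of a partition, then so are their sums. -/
theorem sum_le_sum_of_class_mean {ι : Type*} [DecidableEq ι] (P : Finset ι) (cls : ι → Finset ι)
    (h g : ι → ℝ) (hsub : ∀ x ∈ P, cls x ⊆ P) (hself : ∀ x ∈ P, x ∈ cls x)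
    (heq : ∀ x ∈ P, ∀ y ∈ cls x, cls y = cls x)
    (hle : ∀ x ∈ P, ∑ y ∈ cls x, h y ≤ (cls x).card * g x) : ∑ x ∈ P, h x ≤ ∑ x ∈ P, g x := by
  have hcard : ∀ x ∈ P, (0 : ℝ) < (cls x).card := fun x hx => by
    exact_mod_cast Finset.card_pos.2 ⟨x, hself x hx⟩
  -- Each value of `h` is spread evenly over its class; exchanging the sums replaces `h` by its
  -- class means.
  calc ∑ x ∈ P, h x = ∑ y ∈ P, ∑ _x ∈ cls y, h y / (cls y).card := by
        refine Finset.sum_congr rfl fun y hy => ?_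
        rw [Finset.sum_const, nsmul_eq_mul, mul_div_cancel₀ _ (hcard y hy).ne']
    _ = ∑ x ∈ P, ∑ y ∈ cls x, h y / (cls y).card := by
        refine Finset.sum_comm' fun y x => ?_
        constructor
        · rintro ⟨hy, hx⟩
          exact ⟨by rw [heq y hy x hx]; exact hself y hy, hsub y hy hx⟩
        · rintro ⟨hy, hx⟩
          exact ⟨hsub x hx hy, by rw [heq x hx y hy]; exact hself x hx⟩
    _ ≤ ∑ x ∈ P, g x := by
        refine Finset.sum_le_sum fun x hx => ?_
        rw [Finset.sum_congr rfl fun y hy => by rw [heq x hx y hy], ← Finset.sum_div,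
          div_le_iff₀ (hcard x hx), mul_comm]
        exact hle x hx

theorem sum_Ioc_sub_pred (G : ℤ → ℝ) {m n : ℤ} (hmn : m ≤ n) :
    ∑ i ∈ Finset.Ioc m n, (G i - G (i - 1)) = G n - G m := by
  induction n, hmn using Int.leInduction with
  | base => simp
  | succ n hmn ih =>
    have : Finset.Ioc m (n + 1) = insert (n + 1) (Finset.Ioc m n) := by
      ext i
      simp only [Finset.mem_Ioc, Finset.mem_insert]
      omega
    rw [this, Finset.sum_insert (by simp), ih, add_sub_cancel_right]
    ring

theorem sum_product_sub (A B : Finset ℕ) (φ : ℕ → ℝ) :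
    ∑ x ∈ A ×ˢ B, (φ x.1 - φ x.2) =
      B.card * ∑ s ∈ A, φ s - A.card * ∑ s ∈ B, φ s := by
  rw [Finset.sum_product]
  simp only [Finset.sum_sub_distrib, Finset.sum_const, nsmul_eq_mul]
  rw [Finset.mul_sum, Finset.mul_sum]

namespace WavefrontSolution

variable {f : ℝ → ℝ → ℝ} {ε : ℝ} {S : WavefrontSolution f ε}

variable (S) in
/-- Slope of the piecewise affine interpolation of `F` on the segment of a positive wave. -/
def cellSlope (F : ℝ → ℝ) (s : ℕ) : ℝ :=
  (F (S.kap s * ε) - F (((S.kap s - 1 : ℤ) : ℝ) * ε)) / ε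

theorem IsTile.card_eq {A : Finset ℕ} {m n : ℤ} (h : S.IsTile 1 (A : Set ℕ) m n) :
    A.image S.kap = Finset.Ioc m n ∧ (A.card : ℤ) = n - m := by
  have h1 : A.image S.kap = Finset.Ioc m n := by
    rw [← Finset.coe_inj, Finset.coe_image, Finset.coe_Ioc, ← h.image]
    simp only [one_mul]
  have hinj : Set.InjOn S.kap A := by
    have := h.mono.injOn
    simpa only [one_mul] using this
  have hlt := h.lt
  refine ⟨h1, ?_⟩
  rw [← Finset.card_image_of_injOn hinj, h1, Int.card_Ioc]
  omega

/-- Telescoping over the consecutive cells of the tile. -/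
theorem IsTile.sum_cellSlope {A : Finset ℕ} {m n : ℤ} (h : S.IsTile 1 (A : Set ℕ) m n) (hε : 0 < ε)
    (F : ℝ → ℝ) : ∑ s ∈ A, S.cellSlope F s = A.card * rhSpeed F (S.span A) := by
  have hinj : Set.InjOn S.kap A := by
    have := h.mono.injOn
    simpa only [one_mul] using this
  obtain ⟨h1, h2⟩ := h.card_eq
  have hlt := h.bounds_lt hε
  have h3 : (A.card : ℝ) = n - m := by exact_mod_cast h2
  have e : ∑ s ∈ A, S.cellSlope F s =
      (∑ i ∈ A.image S.kap, (F (i * ε) - F (((i - 1 : ℤ) : ℝ) * ε))) / ε := by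
    rw [Finset.sum_image hinj, Finset.sum_div]
    rfl
  rw [e, h1, sum_Ioc_sub_pred (fun i : ℤ => F (i * ε)) h.lt.le, h.rhSpeed_eq hε, h3,
    ← sub_mul]
  have : (n : ℝ) - m ≠ 0 := by
    have : (m : ℝ) < n := by exact_mod_cast h.lt
    linarith
  field_simp

/-- The slopes of an effective flux on the segments of a tile differ by at most its strength
multiplied by the maximal curvature. -/
theorem IsTile.cellSlope_sub_le {A : Finset ℕ} {m n : ℤ} (h : S.IsTile 1 (A : Set ℕ) m n)
    (hf : IsAdmissibleFlux f) (hε : 0 < ε) {k : ℕ} {F : ℝ → ℝ} (hF : S.IsEffectiveFlux k A F)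
    {s s' : ℕ} (hs : s ∈ A) (hs' : s' ∈ A) :
    S.cellSlope F s - S.cellSlope F s' ≤ normD2 f * (ε * A.card) := by
  -- By the mean value theorem each cell slope is a value of the derivative of `F`.
  have key : ∀ p ∈ A, ∃ u ∈ Icc ((m : ℝ) * ε) (n * ε), deriv F u = S.cellSlope F p := by
    intro p hp
    have hlt : ((S.kap p - 1 : ℤ) : ℝ) * ε < S.kap p * ε :=
      mul_lt_mul_of_pos_right (by exact_mod_cast (show S.kap p - 1 < S.kap p by omega)) hε
    obtain ⟨u, hu, hd⟩ := exists_deriv_eq_slope F hlt hF.differentiable.continuous.continuousOn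
      hF.differentiable.differentiableOn
    have hk := h.mem_Ioc hp
    rw [one_mul] at hk
    refine ⟨u, ⟨le_trans ?_ hu.1.le, hu.2.le.trans ?_⟩, ?_⟩
    · exact mul_le_mul_of_nonneg_right (by exact_mod_cast (show m ≤ S.kap p - 1 by omega)) hε.le
    · exact mul_le_mul_of_nonneg_right (by exact_mod_cast hk.2) hε.le
    · rw [hd, cellSlope]
      congr 1
      push_cast
      ring
  obtain ⟨u, hu, e⟩ := key s hs
  obtain ⟨u', hu', e'⟩ := key s' hs'
  obtain ⟨-, ⟨K, hK⟩, h3⟩ := hF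
  have := h.abs_sub_le_sum hε hK (fun _ => normD2 f) (fun _ _ => normD2_nonneg f)
    (fun q hq => by
      filter_upwards [h3 q hq] with x hx hxq
      rw [(hx hxq).deriv]
      exact hf.abs_fww_le _ _) hu' hu
  rw [Finset.sum_const, nsmul_eq_mul] at this
  rw [← e, ← e']
  linarith [le_abs_self (deriv F u - deriv F u')]

/-! ### The rectangles of pairs of waves with a common history -/

namespace LastMeet

variable {i k s s' p p' : ℕ}

theorem partRel_of_le (h : S.LastMeet i k s s') (hε : 0 < ε) {l : ℕ} (hil : i ≤ l) (hlk : l ≤ k)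
    {q q' : ℕ} (hqq : S.partRel k s s' q q') : S.partRel l s s' q q' := by
  induction k, hlk using Nat.le_induction with
  | base => exact hqq
  | succ k hlk ih =>
    have hik := hil.trans hlk
    exact ih (h.of_le hik (Nat.le_succ k)) ((h.partRel_succ hε hik).1 hqq).2.2.1

theorem px_eq_of_partRel (h : S.LastMeet i k s s') (hf : IsAdmissibleFlux f) (hε : 0 < ε)
    (hpos : S.isgn s = 1) {l : ℕ} (hil : i ≤ l) (hlk : l ≤ k) {q q' : ℕ}
    (hqq : S.partRel k s s' q q') : S.px l q = S.px l q' :=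
  ((h.of_le hil hlk).isPartRel hf hε hpos).px_eq _ _ (h.partRel_of_le hε hil hlk hqq)

/-- The recursion sees the pair only through its last meeting, that is, through the time `t i` and
the point where it happens. -/
theorem partRel_congr (h : S.LastMeet i k s s') (h' : S.LastMeet i k p p') (hε : 0 < ε)
    (hp : S.px i p = S.px i s) : S.partRel k s s' = S.partRel k p p' := by
  obtain ⟨l, rfl⟩ := Nat.exists_eq_add_of_le h.le
  induction l with
  | zero =>
    rw [Nat.add_zero] at h h' ⊢
    ext q q'
    rw [h.partRel_self hε, h'.partRel_self hε, h.mem_interval hε, h.mem_interval hε,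
      h'.mem_interval hε, h'.mem_interval hε, hp]
  | succ l ih =>
    rw [← Nat.add_assoc] at h h' ⊢
    have hik := Nat.le_add_right i l
    have := ih (h.of_le hik (Nat.le_succ _)) (h'.of_le hik (Nat.le_succ _))
    ext q q'
    rw [h.partRel_succ hε hik, h'.partRel_succ hε hik, this]

/-- Partitions only get finer with time, so waves of one final element have had equal positions
since `t i`. Replacing `s` by `p` and `s'` by `p'` therefore changes no meeting. -/
theorem of_partRel (h : S.LastMeet i k s s') (hf : IsAdmissibleFlux f) (hε : 0 < ε)
    (hpos : S.isgn s = 1) (hp : S.partRel k s s' s p) (hp' : S.partRel k s s' s' p') :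
    S.LastMeet i k p p' := by
  have hP := h.isPartRel hf hε hpos
  have hI := h.isBlock_interval hε hpos
  have e : ∀ l, i ≤ l → l ≤ k → S.px l s = S.px l p ∧ S.px l s' = S.px l p' := fun l h1 h2 =>
    ⟨h.px_eq_of_partRel hf hε hpos h1 h2 hp, h.px_eq_of_partRel hf hε hpos h1 h2 hp'⟩
  refine ⟨h.le_J, h.le, hI.alive p (hP.class_subset _ hp), hI.alive p' (hP.class_subset _ hp'), ?_,
    fun l h1 h2 => ?_⟩
  · rw [← (e i le_rfl h.le).1, ← (e i le_rfl h.le).2, h.meet]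
  · rw [← (e l h1.le h2).1, ← (e l h1.le h2).2]
    exact h.later l h1 h2

end LastMeet

theorem IsBlock.union {k : ℕ} {D D' : Set ℕ} (h : S.IsBlock k D) (h' : S.IsBlock k D') {p : ℕ}
    (hp : p ∈ D) (hp' : p ∈ D') : S.IsBlock k (D ∪ D') where
  alive s hs := hs.elim (h.alive s) (h'.alive s)
  pos s hs := hs.elim (h.pos s) (h'.pos s)
  conv a ha b hb q hq haq hqb := by
    rcases le_total q p with hqp | hqp
    · rcases ha with ha | ha
      · exact Or.inl (h.conv a ha p hp q hq haq hqp)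
      · exact Or.inr (h'.conv a ha p hp' q hq haq hqp)
    · rcases hb with hb | hb
      · exact Or.inl (h.conv p hp b hb q hq hqp hqb)
      · exact Or.inr (h'.conv p hp' b hb q hq hqp hqb)

/-! ### Wavefronts as sets of waves -/

theorem mem_wavesOf {k : ℕ} (hk : k ≤ S.J) {a : Front} {s : ℕ} :
    s ∈ S.wavesOf k a ↔ s ∈ S.alive k ∧ S.px k s = a.start ∧ S.speed k s = a.speed := by
  rw [wavesOf, Set.mem_ofPred_eq, alive_iff hk, position_t hk]
  refine and_congr_right fun hs => ?_
  rw [S.pos_eq_px hs, WithTop.coe_inj]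

theorem isgn_of_isPositiveFront (hε : 0 < ε) {k : ℕ} (hk : k ≤ S.J) {a : Front}
    (ha : S.IsPositiveFront k a) {s : ℕ} (hs : s ∈ S.wavesOf k a) : S.isgn s = 1 := by
  obtain ⟨h1, h2, -⟩ := (mem_wavesOf hk).1 hs
  have hs' : s ∈ S.wavesAt k a.start := S.mem_wavesAt.2 ⟨h1, h2⟩
  obtain ⟨σ, m, n, hσ, hT, e1, e2⟩ := (waveProfile hε hk).exists_isTile_wavesAt hε ⟨s, hs'⟩
  have hlt := ha.2
  rw [e1, e2, mul_lt_mul_iff_left₀ hε, Int.cast_lt] at hlt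
  have := hT.lt
  rw [hT.isgn_eq s hs']
  rcases hσ with rfl | rfl
  · rfl
  · omega

/-- The waves of the two wavefronts of a positive interaction form an interval. -/
theorem isBlock_of_positiveInteraction (hε : 0 < ε) {k : ℕ} (hk : k < S.J) {a b : Front}
    (hab : S.PositiveInteraction k a b) : S.IsBlock k (S.wavesOf k a ∪ S.wavesOf k b) := by
  obtain ⟨hcol, ha, hb⟩ := hab
  have hprof := waveProfile (S := S) hε hk.le
  have hset : ∀ s, s ∈ S.wavesOf k a ∪ S.wavesOf k b ↔ s ∈ S.arrivals k := by
    intro s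
    rw [mem_union, mem_wavesOf hk.le, mem_wavesOf hk.le, mem_arrivals, arrival]
    constructor
    · rintro (⟨h1, h2, h3⟩ | ⟨h1, h2, h3⟩)
      · exact ⟨h1, by rw [h2, h3]; exact hcol.2.2.2.1⟩
      · exact ⟨h1, by rw [h2, h3]; exact hcol.2.2.2.2⟩
    · rintro ⟨h1, h2⟩
      obtain ⟨c, d, -, hcd, -, huniq⟩ := hprof.exists_collision hε hk
      obtain ⟨e1, e2⟩ := huniq a b hcol
      have hab : (⟨.second, S.px k s, S.speed k s⟩ : Front) = a ∨
          (⟨.second, S.px k s, S.speed k s⟩ : Front) = b := by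
        have hne := hcol.2.2.1
        rcases hcd s h1 h2 with h | h <;> rcases e1 with e1 | e1 <;> rcases e2 with e2 | e2 <;>
          first
          | exact absurd (e1.trans e2.symm) hne
          | exact Or.inl (h.trans e1.symm)
          | exact Or.inr (h.trans e2.symm)
      rcases hab with h | h
      · exact Or.inl ⟨h1, by rw [← h], by rw [← h]⟩
      · exact Or.inr ⟨h1, by rw [← h], by rw [← h]⟩
  refine ⟨fun s hs => (mem_arrivals.1 ((hset s).1 hs)).1, fun s hs => ?_,
    fun x hx y hy q hq h1 h2 => ?_⟩
  · rcases hs with hs | hs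
    · exact isgn_of_isPositiveFront hε hk.le ha hs
    · exact isgn_of_isPositiveFront hε hk.le hb hs
  · exact (hset q).2
      (hprof.arrivals_ordConnected hε hk ((hset x).1 hx) ((hset y).1 hy) hq h1 h2)

theorem IsBlock.left_of_precedes {k : ℕ} {L R : Set ℕ} (h : S.IsBlock k (L ∪ R))
    (hLR : Precedes L R) : S.IsBlock k L where
  alive s hs := h.alive s (Or.inl hs)
  pos s hs := h.pos s (Or.inl hs)
  conv a ha b hb q hq h1 h2 := (h.conv a (Or.inl ha) b (Or.inl hb) q hq h1 h2).resolve_right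
    fun hR => absurd (hLR b hb q hR) (not_lt.2 h2)

theorem IsBlock.right_of_precedes {k : ℕ} {L R : Set ℕ} (h : S.IsBlock k (L ∪ R))
    (hLR : Precedes L R) : S.IsBlock k R where
  alive s hs := h.alive s (Or.inr hs)
  pos s hs := h.pos s (Or.inr hs)
  conv a ha b hb q hq h1 h2 := (h.conv a (Or.inr ha) b (Or.inr hb) q hq h1 h2).resolve_left
    fun hL => absurd (hLR q hL a ha) (not_lt.2 h1)

end WavefrontSolution

end
end TriangularSystem
-- Summation over the pairs of waves
open TriangularSystem in
theorem mainTheorem5 (f : ℝ → ℝ → ℝ) (hf : IsAdmissibleFlux f)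
    (r : ℝ) (hr : 0 < r)
    (hyp : ∀ w v : ℝ, |w| ≤ r → |v| ≤ r → -1 < deriv (fun w' => f w' v) w)
    (ε : ℝ) (hε : 0 < ε) (S : WavefrontSolution f ε)
    (hw : ∀ x, |S.w 0 x| ≤ r) (hv : ∀ x, |S.v 0 x| ≤ r)
    (j : ℕ) (hj : j < S.J)
    (a b : Front) (hab : S.PositiveInteraction j a b)
    (L R : Set ℕ) (hL : L = S.wavesOf j a) (hR : R = S.wavesOf j b) (hLR : Precedes L R)
    (s₀ : ℕ) (hs₀ : s₀ ∈ L) (feff : ℝ → ℝ)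
    (hfeff : S.IsEffectiveFlux j (S.homComponent j s₀) feff) :
    (rhSpeed feff (S.span L) - rhSpeed feff (S.span R)) * S.strength L * S.strength R ≤
      (∑ᶠ p ∈ {p : ℕ × ℕ | p.1 ∈ L ∧ p.2 ∈ R ∧ S.AlreadyInteracted j p.1 p.2},
        S.piWeight j p.1 p.2 p.1 p.2 * ε * ε) +
      ∑ᶠ p ∈ {p : ℕ × ℕ | p.1 ∈ L ∧ p.2 ∈ R ∧ S.NeverInteracted j p.1 p.2},
        normD2 f * (S.strength L + S.strength R) * ε * ε := by
  classical
  have hjJ := hj.le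
  have hLR' := WavefrontSolution.isBlock_of_positiveInteraction hε hj hab
  rw [← hL, ← hR] at hLR'
  have hLb := hLR'.left_of_precedes hLR
  have hRb := hLR'.right_of_precedes hLR
  obtain ⟨t₀, ht₀⟩ : R.Nonempty := by
    obtain ⟨t, h⟩ := (WavefrontSolution.waveProfile hε hjJ).exists_wave hε hab.1.2.1 hab.2.2.1
    exact ⟨t, hR ▸ (WavefrontSolution.mem_wavesOf hjJ).2 h⟩
  have hfLR := hfeff.mono (hLR'.subset_homComponent hε hjJ (Or.inl hs₀))
  -- A front contains every wave joined to one of its waves. This keeps the rectangles inside `L ×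
  -- R`.
  have hclL : ∀ p q, p ∈ L → q ∈ S.alive j → S.px j p = S.px j q → S.speed j p = S.speed j q →
      q ∈ L := fun p q hp hq h1 h2 => by
    rw [hL, WavefrontSolution.mem_wavesOf hjJ] at hp ⊢
    exact ⟨hq, h1 ▸ hp.2.1, h2 ▸ hp.2.2⟩
  have hclR : ∀ p q, p ∈ R → q ∈ S.alive j → S.px j p = S.px j q → S.speed j p = S.speed j q →
      q ∈ R := fun p q hp hq h1 h2 => by
    rw [hR, WavefrontSolution.mem_wavesOf hjJ] at hp ⊢
    exact ⟨hq, h1 ▸ hp.2.1, h2 ▸ hp.2.2⟩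
  clear hL hR
  obtain ⟨A, rfl⟩ := hLb.finite.exists_finset_coe
  obtain ⟨B, rfl⟩ := hRb.finite.exists_finset_coe
  obtain ⟨m₁, n₁, hTA, -⟩ := hLb.exists_tile hε hjJ ⟨s₀, hs₀⟩
  obtain ⟨m₂, n₂, hTB, -⟩ := hRb.exists_tile hε hjJ ⟨t₀, ht₀⟩
  obtain ⟨m, n, hT, -⟩ := hLR'.exists_tile hε hjJ ⟨s₀, Or.inl hs₀⟩
  set φ := S.cellSlope feff with hφ
  have halive : ∀ x ∈ A ×ˢ B, x.1 ∈ S.alive j ∧ x.2 ∈ S.alive j ∧ x.1 < x.2 := fun x hx => by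
    obtain ⟨h1, h2⟩ := Finset.mem_product.1 hx
    exact ⟨hLb.alive _ h1, hRb.alive _ h2, hLR _ h1 _ h2⟩
  have hset₁ : {p : ℕ × ℕ | p.1 ∈ (A : Set ℕ) ∧ p.2 ∈ (B : Set ℕ) ∧
      S.AlreadyInteracted j p.1 p.2} =
      ↑((A ×ˢ B).filter fun p => S.AlreadyInteracted j p.1 p.2) := by
    ext p
    rw [Finset.mem_coe, Finset.mem_filter, Finset.mem_product, and_assoc]
    rfl
  -- Both waves are alive, so never having interacted is the negation of having already interacted,
  -- and the two sums split that over `L × R`.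
  have hset₂ : {p : ℕ × ℕ | p.1 ∈ (A : Set ℕ) ∧ p.2 ∈ (B : Set ℕ) ∧
      S.NeverInteracted j p.1 p.2} =
      ↑((A ×ˢ B).filter fun p => ¬ S.AlreadyInteracted j p.1 p.2) := by
    ext p
    rw [Finset.mem_coe, Finset.mem_filter, Finset.mem_product, Set.mem_ofPred_eq,
      ← and_assoc]
    refine and_congr_right fun hp => ?_
    obtain ⟨h1, h2, -⟩ := halive p (Finset.mem_product.2 hp)
    rw [← WavefrontSolution.alive_iff hjJ] at h1 h2
    constructor
    · rintro ⟨-, -, h⟩ ⟨-, -, τ, h3, h4, h5⟩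
      exact h τ h3 h4 h5
    · exact fun h => ⟨h1, h2, fun τ h3 h4 h5 => h ⟨h1, h2, τ, h3, h4, h5⟩⟩
  have hnever : ∑ x ∈ A ×ˢ B with ¬ S.AlreadyInteracted j x.1 x.2, (φ x.1 - φ x.2) ≤
      ∑ x ∈ A ×ˢ B with ¬ S.AlreadyInteracted j x.1 x.2,
        normD2 f * (S.strength A + S.strength B) := by
    refine Finset.sum_le_sum fun x hx => ?_
    obtain ⟨h1, h2⟩ := Finset.mem_product.1 (Finset.mem_filter.1 hx).1
    rw [← Finset.coe_union] at hT hfLR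
    refine (hT.cellSlope_sub_le hf hε hfLR (Finset.mem_union_left _ h1)
      (Finset.mem_union_right _ h2)).trans (mul_le_mul_of_nonneg_left ?_ (normD2_nonneg f))
    rw [WavefrontSolution.strength, WavefrontSolution.strength, Set.ncard_coe_finset,
      Set.ncard_coe_finset, ← mul_add]
    refine mul_le_mul_of_nonneg_left ?_ hε.le
    exact_mod_cast Finset.card_union_le A B
  have halready : ∑ x ∈ A ×ˢ B with S.AlreadyInteracted j x.1 x.2, (φ x.1 - φ x.2) ≤
      ∑ x ∈ A ×ˢ B with S.AlreadyInteracted j x.1 x.2, S.piWeight j x.1 x.2 x.1 x.2 := by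
    have hposL : ∀ s ∈ A, S.isgn s = 1 := fun s hs => hLb.pos s hs
    set cl : ℕ × ℕ → ℕ → Finset ℕ := fun x p =>
      (S.alive j).filter fun q => q ∈ S.partClass j x.1 x.2 p with hcl
    have hclcoe : ∀ {i s s'}, S.LastMeet i j s s' → S.isgn s = 1 → ∀ p,
        (cl (s, s') p : Set ℕ) = S.partClass j s s' p := fun {i s s'} h hs p => by
      ext q
      rw [Finset.mem_coe, hcl, Finset.mem_filter, and_iff_right_iff_imp]
      exact fun hq => (h.isBlock_interval hε hs).alive q
        ((h.isPartRel hf hε hs).class_subset p hq)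
    have hmem : ∀ {i s s'}, S.LastMeet i j s s' → S.isgn s = 1 → ∀ p q,
        q ∈ cl (s, s') p ↔ S.partRel j s s' p q := fun h hs p q => by
      rw [← Finset.mem_coe, hclcoe h hs]
      rfl
    have hint : ∀ {i s s'}, S.LastMeet i j s s' → s ∈ S.interval j s s' ∧
        s' ∈ S.interval j s s' := fun h =>
      ⟨(h.mem_interval hε).2 ⟨h.alive_left, rfl⟩,
        (h.mem_interval hε).2 ⟨h.alive_right, h.meet.symm⟩⟩
    -- The class of a pair is the product of the elements of its partition containing the two waves.
    -- The goals are: it stays among the interacted pairs of `L × R`, it contains the pair, it is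
    -- the same for all its pairs, and the mean bound holds on it.
    refine sum_le_sum_of_class_mean _ (fun x => cl x x.1 ×ˢ cl x x.2) _ _ ?_ ?_ ?_ ?_
    · rintro ⟨s, s'⟩ hx ⟨p, p'⟩ hy
      obtain ⟨hx1, hx2⟩ := Finset.mem_filter.1 hx
      obtain ⟨hs, hs'⟩ := Finset.mem_product.1 hx1
      obtain ⟨i, h⟩ := WavefrontSolution.exists_lastMeet hε hjJ hx2
      have hpos := hposL s hs
      have hP := h.isPartRel hf hε hpos
      obtain ⟨hp, hp'⟩ := Finset.mem_product.1 hy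
      rw [hmem h hpos] at hp hp'
      have hpp := h.of_partRel hf hε hpos hp hp'
      exact Finset.mem_filter.2 ⟨Finset.mem_product.2
        ⟨hclL s p hs hpp.alive_left (hP.px_eq _ _ hp) (h.speed_eq_of_partRel hf hε hpos hp),
          hclR s' p' hs' hpp.alive_right (hP.px_eq _ _ hp')
            (h.speed_eq_of_partRel hf hε hpos hp')⟩, hpp.alreadyInteracted hε⟩
    · rintro ⟨s, s'⟩ hx
      obtain ⟨hx1, hx2⟩ := Finset.mem_filter.1 hx
      obtain ⟨hs, hs'⟩ := Finset.mem_product.1 hx1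
      obtain ⟨i, h⟩ := WavefrontSolution.exists_lastMeet hε hjJ hx2
      have hpos := hposL s hs
      have hP := h.isPartRel hf hε hpos
      exact Finset.mem_product.2 ⟨(hmem h hpos _ _).2 (hP.refl _ (hint h).1),
        (hmem h hpos _ _).2 (hP.refl _ (hint h).2)⟩
    · rintro ⟨s, s'⟩ hx ⟨p, p'⟩ hy
      obtain ⟨hx1, hx2⟩ := Finset.mem_filter.1 hx
      obtain ⟨hs, hs'⟩ := Finset.mem_product.1 hx1
      obtain ⟨i, h⟩ := WavefrontSolution.exists_lastMeet hε hjJ hx2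
      have hpos := hposL s hs
      have hP := h.isPartRel hf hε hpos
      obtain ⟨hp, hp'⟩ := Finset.mem_product.1 hy
      rw [hmem h hpos] at hp hp'
      have hpp := h.of_partRel hf hε hpos hp hp'
      have hrel := h.partRel_congr hpp hε (h.px_eq_of_partRel hf hε hpos le_rfl h.le hp).symm
      have e : ∀ q, S.partClass j p p' q = S.partClass j s s' q := fun q => by
        rw [WavefrontSolution.partClass, WavefrontSolution.partClass, hrel]
      have e1 : S.partClass j s s' p = S.partClass j s s' s := (hP.class_eq hp).symm
      have e2 : S.partClass j s s' p' = S.partClass j s s' s' := (hP.class_eq hp').symm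
      simp only [hcl, e, e1, e2]
    · rintro ⟨s, s'⟩ hx
      obtain ⟨hx1, hx2⟩ := Finset.mem_filter.1 hx
      obtain ⟨hs, hs'⟩ := Finset.mem_product.1 hx1
      obtain ⟨i, h⟩ := WavefrontSolution.exists_lastMeet hε hjJ hx2
      have hpos := hposL s hs
      have hP := h.isPartRel hf hε hpos
      have hI := h.isBlock_interval hε hpos
      -- The interval meets `L` at `s`, so its union with `L` is a homogeneous interval containing
      -- `s₀`, inside the maximal one where `feff` is effective.
      have hF : S.IsEffectiveFlux j (S.interval j s s') feff :=
        hfeff.mono (subset_union_left.trans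
          ((hI.union hLb (hint h).1 hs).subset_homComponent hε hjJ (Or.inr hs₀)))
      have hle := h.rhSpeed_sub_le hf hyp hε hw hv hpos hF (hint h).1 (hint h).2
        (halive (s, s') hx1).2.2.le
      have hb₁ := hP.isBlock_class hI s
      have hb₂ := hP.isBlock_class hI s'
      obtain ⟨k₁, l₁, hT₁, -⟩ := hb₁.exists_tile hε hjJ ⟨s, hP.refl s (hint h).1⟩
      obtain ⟨k₂, l₂, hT₂, -⟩ := hb₂.exists_tile hε hjJ ⟨s', hP.refl s' (hint h).2⟩
      change S.IsTile 1 (S.partClass j s s' s) k₁ l₁ at hT₁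
      change S.IsTile 1 (S.partClass j s s' s') k₂ l₂ at hT₂
      rw [← hclcoe h hpos] at hT₁ hT₂ hle
      rw [← hclcoe h hpos] at hle
      -- On the rectangle the sum is the product of the two cardinalities times the difference of
      -- the Rankine-Hugoniot speeds.
      rw [sum_product_sub, hφ, hT₁.sum_cellSlope hε, hT₂.sum_cellSlope hε, Finset.card_product,
        Nat.cast_mul]
      have := mul_le_mul_of_nonneg_left hle (mul_nonneg
        (Nat.cast_nonneg (α := ℝ) (cl (s, s') s).card) (Nat.cast_nonneg (cl (s, s') s').card))
      linarith
  rw [hset₁, hset₂, finsum_mem_coe_finset, finsum_mem_coe_finset, ← Finset.sum_mul,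
    ← Finset.sum_mul, ← Finset.sum_mul, ← Finset.sum_mul, ← add_mul, ← add_mul]
  -- The two families together give the sum over the whole of `L × R`, which telescopes to the
  -- Rankine-Hugoniot speeds of the two fronts; it remains to multiply by `ε` twice.
  have htot := add_le_add halready hnever
  rw [Finset.sum_filter_add_sum_filter_not, sum_product_sub, hφ, hTA.sum_cellSlope hε,
    hTB.sum_cellSlope hε] at htot
  have := mul_le_mul_of_nonneg_right (mul_le_mul_of_nonneg_right htot hε.le) hε.le
  refine le_trans (le_of_eq ?_) this
  rw [WavefrontSolution.strength, WavefrontSolution.strength, Set.ncard_coe_finset,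
    Set.ncard_coe_finset]
  ring
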